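/- Let $G=(V,E)$ be a simple undirected graph with $n=|V|$ vertices, $m=|E|$ edges and $p=\binom n2$ vertex pairs. A clustering $\zeta$ of $G$ is a partition of $V$. Let $i_e(\zeta)$ be the number of edges of $G$ with both endpoints in the same cluster, let $i_p(\zeta)=\sum_{C\in\zeta}\binom{|C|}{2}$, and define the surprise of $\zeta$ by $$S(\zeta)=\sum_{i=i_e(\zeta)}^{m}\frac{\binom{i_p(\zeta)}{i}\binom{p-i_p(\zeta)}{m-i}}{\binom{p}{m}}.$$ A clustering is surprise optimal if it minimizes $S$ among all clusterings of $G$. Theorem. There is an algorithm that, given any (unweighted) tree $T$ with $n$ vertices, computes a surprise optimal clustering of $T$ in $O(n^5)$ time. Here time is the number of steps of a word RAM whose words have $O(\log n)$ bits, the vertices are $0,\dots,n-1$, the input consists of $n$ and a list of the edges in arbitrary order, and the output is a cluster label for each vertex. -/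

import Mathlib

/-! ### Surprise of a clustering -/

namespace Surprise

variable {V : Type*} [Fintype V] [DecidableEq V]

/-- The number of edges of `G` having both endpoints in `C`. -/
noncomputable def clusterEdges (G : SimpleGraph V) (C : Finset V) : ℕ :=
  {e | e ∈ G.edgeSet ∧ ∀ v ∈ e, v ∈ C}.ncard

/-- The number `i_e` of intracluster edges of a clustering (a partition of the vertex set). -/
noncomputable def intraEdges (G : SimpleGraph V)
    (ζ : Finpartition (Finset.univ : Finset V)) : ℕ :=
  ∑ C ∈ ζ.parts, clusterEdges G C

/-- The number `i_p` of intracluster vertex pairs of a clustering. -/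
def intraPairs (ζ : Finpartition (Finset.univ : Finset V)) : ℕ :=
  ∑ C ∈ ζ.parts, C.card.choose 2

/-- The hypergeometric tail `S(i_p, i_e)` for a graph with `p` vertex pairs and `m` edges. -/
def hyperTail (p m ip ie : ℕ) : ℚ :=
  ∑ i ∈ Finset.Icc ie m, ((ip.choose i : ℚ) * ((p - ip).choose (m - i) : ℚ)) / (p.choose m : ℚ)

/-- The surprise `S(ζ)` of a clustering `ζ` of `G`. -/
noncomputable def surprise (G : SimpleGraph V)
    (ζ : Finpartition (Finset.univ : Finset V)) : ℚ :=
  hyperTail ((Fintype.card V).choose 2) G.edgeSet.ncard (intraPairs ζ) (intraEdges G ζ)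

/-- Smaller surprise is better: `ζ` is optimal if its surprise is minimum. -/
def IsOptimal (G : SimpleGraph V) (ζ : Finpartition (Finset.univ : Finset V)) : Prop :=
  ∀ ζ' : Finpartition (Finset.univ : Finset V), surprise G ζ ≤ surprise G ζ'

end Surprise

/-! ### A word RAM

The machine has registers and a random access memory, all of whose cells hold natural numbers
below a word bound `W`. Programs are structured (sequence, conditional, loop) and do not depend
on the input. Every instruction and every evaluation of a test takes one step. An instruction
whose result would reach `W` cannot be executed, so a program that halts never overflows. -/

namespace WordRAM

/-- Arithmetic instructions: addition, truncated subtraction, multiplication, and division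
rounded down (with `x / 0 = 0`). -/
inductive Op
  | add | sub | mul | div

/-- The value computed by an arithmetic instruction. -/
def Op.eval : Op → ℕ → ℕ → ℕ
  | .add, x, y => x + y
  | .sub, x, y => x - y
  | .mul, x, y => x * y
  | .div, x, y => x / y

/-- Programs. Below, `R i` is register `i` and `M a` is the memory cell with address `a`. -/
inductive Prog
  /-- do nothing -/
  | skip
  /-- `R i := k` -/
  | const (i k : ℕ)
  /-- `R i := R j ∘ R k` -/
  | arith (o : Op) (i j k : ℕ)
  /-- `R i := M (R j)` -/
  | load (i j : ℕ)
  /-- `M (R i) := R j` -/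
  | store (i j : ℕ)
  /-- `P`, then `Q` -/
  | seq (P Q : Prog)
  /-- if `R i < R j` then `P` else `Q` -/
  | ifLt (i j : ℕ) (P Q : Prog)
  /-- as long as `R i < R j`, repeat `P` -/
  | whileLt (i j : ℕ) (P : Prog)

/-- A configuration of the machine. -/
structure State where
  reg : ℕ → ℕ
  mem : ℕ → ℕ

/-- Write the value `x` into register `i`. -/
def State.setReg (s : State) (i x : ℕ) : State := { s with reg := Function.update s.reg i x }

/-- Write the value `x` into the memory cell with address `a`. -/
def State.setMem (s : State) (a x : ℕ) : State := { s with mem := Function.update s.mem a x }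

/-- `Runs W P s t s'`: with word bound `W`, the program `P` started in `s` halts after exactly
`t` steps in `s'`. -/
inductive Runs (W : ℕ) : Prog → State → ℕ → State → Prop
  | skip (s : State) : Runs W .skip s 1 s
  | const (s : State) (i k : ℕ) (h : k < W) : Runs W (.const i k) s 1 (s.setReg i k)
  | arith (s : State) (o : Op) (i j k : ℕ) (h : o.eval (s.reg j) (s.reg k) < W) :
      Runs W (.arith o i j k) s 1 (s.setReg i (o.eval (s.reg j) (s.reg k)))
  | load (s : State) (i j : ℕ) (h : s.mem (s.reg j) < W) :
      Runs W (.load i j) s 1 (s.setReg i (s.mem (s.reg j)))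
  | store (s : State) (i j : ℕ) : Runs W (.store i j) s 1 (s.setMem (s.reg i) (s.reg j))
  | seq {P Q : Prog} {s s₁ s₂ : State} {t₁ t₂ : ℕ} (h₁ : Runs W P s t₁ s₁)
      (h₂ : Runs W Q s₁ t₂ s₂) : Runs W (.seq P Q) s (t₁ + t₂) s₂
  | ifTrue {i j : ℕ} {P Q : Prog} {s s₁ : State} {t : ℕ} (hlt : s.reg i < s.reg j)
      (h : Runs W P s t s₁) : Runs W (.ifLt i j P Q) s (t + 1) s₁
  | ifFalse {i j : ℕ} {P Q : Prog} {s s₁ : State} {t : ℕ} (hge : ¬ s.reg i < s.reg j)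
      (h : Runs W Q s t s₁) : Runs W (.ifLt i j P Q) s (t + 1) s₁
  | whileTrue {i j : ℕ} {P : Prog} {s s₁ s₂ : State} {t₁ t₂ : ℕ} (hlt : s.reg i < s.reg j)
      (h₁ : Runs W P s t₁ s₁) (h₂ : Runs W (.whileLt i j P) s₁ t₂ s₂) :
      Runs W (.whileLt i j P) s (t₁ + t₂ + 1) s₂
  | whileFalse {i j : ℕ} {P : Prog} {s : State} (hge : ¬ s.reg i < s.reg j) :
      Runs W (.whileLt i j P) s 1 s

/-- `L` lists every edge of `G` exactly once, in any order, each with its endpoints in either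
order. -/
def IsEdgeList {n : ℕ} (G : SimpleGraph (Fin n)) (L : List (Fin n × Fin n)) : Prop :=
  (L.map (fun q => s(q.1, q.2))).Nodup ∧
    ∀ e : Sym2 (Fin n), e ∈ L.map (fun q => s(q.1, q.2)) ↔ e ∈ G.edgeSet

/-- The input as a sequence of words: the number of vertices, then the endpoints of the edges. -/
def inputWords {n : ℕ} (L : List (Fin n × Fin n)) : List ℕ :=
  n :: L.flatMap (fun q => [(q.1 : ℕ), (q.2 : ℕ)])

/-- Initially the input occupies the first memory cells; all else is zero. -/
def initState {n : ℕ} (L : List (Fin n × Fin n)) : State where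
  reg := fun _ => 0
  mem := fun a => (inputWords L).getD a 0

/-- The first `n` memory cells of `s` hold cluster labels of the vertices `0, …, n - 1`: two
vertices are in the same cluster of `ζ` exactly if their labels agree. -/
def Outputs {n : ℕ} (s : State) (ζ : Finpartition (Finset.univ : Finset (Fin n))) : Prop :=
  ∀ u v : Fin n, s.mem u = s.mem v ↔ ζ.part u = ζ.part v

end WordRAM

/-! A tree has `n - 1` edges, so the surprise of a clustering depends only on its numbers of
intracluster edges and pairs. For a fixed number `k` of edges the tail grows with the number of
pairs (`tailNum_mono`), hence for each `k` only the least possible number of pairs matters.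
Splitting clusters into the components spanned by their intracluster edges keeps the edge count and
does not increase the pair count (`contract_cost_le_intraPairs`). So only the clusterings obtained
by cutting a set of edges need be considered, and `isOptimal_ofLabel` reduces the theorem to the
minimum pair count for every `k`, followed by a comparison of `n` tails.

The minima come from dynamic programming. The tree is contracted edge by edge, from the leaves
towards the root `0`. A contracted vertex carries the size of its top cluster, the number of kept
edges and the number of intracluster pairs; keeping an edge between top clusters of sizes `a` and
`b` adds `a * b` pairs. A quadratic potential (`contract_potential`) shows that this accumulated
cost is the true number of pairs. A table stores the least cost for each size and each number of
kept edges. Merging two tables tries `n ^ 4` combinations, and there are `n - 1` merges. The tables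
bound every contraction from below (`Filled.lower`), and the recorded choices lead back from a root
entry to a contraction that attains it (`traceBack_spec`).

The tails are compared exactly, through their integer numerators. Such a numerator is a coefficient
of a truncated `(1 + X) ^ ip` times `(1 + X) ^ (p - ip)`, so it results from Pascal steps, which
need only additions (`tailNum_eq_pascalStep`). All numbers involved have at most `n` digits in base
`n ^ 2 + 2`. For one `k` there are at most `n ^ 2` Pascal steps on `n` numbers of `n` digits, and
over all `k` this again gives `n ^ 5`.

The algorithm is written in a small language of bounded loops, in which the exponent of the running
time is read off the syntax. `Stmt.exists_prog` compiles any statement to the word RAM. Stored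
values are clamped, so the word bound is polynomial whatever the statement does; that the clamps
never act in this algorithm belongs to its correctness proof, `optimalClustering_spec`. -/

namespace LoopLang
open WordRAM

/-! ### A language of bounded loops -/

/-- Program variables. -/
inductive Var
  | pass | edge | step | quad | cnt | size | kept | inner | row | dig | carry | less
  | minCost | minSize | bestKept | bestSize
  deriving DecidableEq

/-- Arrays, with three indices each. -/
inductive Arr
  | seen | par | child | table | cost | flag | sizeL | keptL | sizeR | keptR
  | digit | best | wantSize | wantKept
  deriving DecidableEq

/-- A store: the values of the variables, the first memory cells, and the arrays. -/
structure Store where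
  v : Var → ℕ
  lo : ℕ → ℕ
  a : Arr → ℕ → ℕ → ℕ → ℕ

/-- Expressions; `len` is the number of vertices. -/
inductive Ex
  | lit (k : ℕ)
  | len
  | var (x : Var)
  | lo (e : Ex)
  | get (b : Arr) (e f g : Ex)
  | op (o : Op) (e f : Ex)

/-- Statements. -/
inductive Stmt
  | skip
  | asg (x : Var) (e : Ex)
  | putLo (i e : Ex)
  | put (b : Arr) (i j k e : Ex)
  | seq (P Q : Stmt)
  | ite (e f : Ex) (P Q : Stmt)
  | loop (x : Var) (d : ℕ) (e : Ex) (P : Stmt)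

/-- Stored values stay below this bound. -/
def cap (n : ℕ) : ℕ := (n + 2) ^ 6

/-- Values that reach the bound are replaced by `0`. -/
def clamp (n w : ℕ) : ℕ := if w < cap n then w else 0

/-- Write a variable. -/
def Store.setV (σ : Store) (x : Var) (w : ℕ) : Store :=
  { σ with v := Function.update σ.v x w }

/-- Write one of the first memory cells. -/
def Store.setLo (σ : Store) (i w : ℕ) : Store :=
  { σ with lo := Function.update σ.lo i w }

/-- Write an array element. -/
def Store.setA (σ : Store) (b : Arr) (i j k w : ℕ) : Store :=
  { σ with a := fun b' i' j' k' =>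
      if b' = b ∧ i' = i ∧ j' = j ∧ k' = k then w else σ.a b' i' j' k' }

/-- The value of an expression. -/
def Ex.ev (n : ℕ) (σ : Store) : Ex → ℕ
  | .lit k => k
  | .len => n
  | .var x => σ.v x
  | .lo e => σ.lo (e.ev n σ % (2 * n))
  | .get b e f g => σ.a b (e.ev n σ) (f.ev n σ) (g.ev n σ)
  | .op o e f => o.eval (e.ev n σ) (f.ev n σ)

/-- Run `body i` for `i = 0, …, m - 1`. -/
def iter (body : ℕ → Store → Store) : ℕ → Store → Store
  | 0, σ => σ
  | m + 1, σ => body m (iter body m σ)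

/-- The effect of a statement. A loop runs at most `n ^ d` times. -/
def Stmt.run (n : ℕ) : Stmt → Store → Store
  | .skip, σ => σ
  | .asg x e, σ => σ.setV x (clamp n (e.ev n σ))
  | .putLo i e, σ => σ.setLo (i.ev n σ % (2 * n)) (clamp n (e.ev n σ))
  | .put b i j k e, σ => σ.setA b (i.ev n σ) (j.ev n σ) (k.ev n σ) (clamp n (e.ev n σ))
  | .seq P Q, σ => Q.run n (P.run n σ)
  | .ite e f P Q, σ => if e.ev n σ < f.ev n σ then P.run n σ else Q.run n σ
  | .loop x d e P, σ =>
      iter (fun i τ => P.run n (τ.setV x (clamp n i))) (min (e.ev n σ) (n ^ d)) σ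

/-- The exponent of the running time. -/
def Stmt.deg : Stmt → ℕ
  | .skip => 0
  | .asg _ _ => 0
  | .putLo _ _ => 0
  | .put _ _ _ _ _ => 0
  | .seq P Q => max P.deg Q.deg
  | .ite _ _ P Q => max P.deg Q.deg
  | .loop _ d _ P => d + P.deg

/-! ### Compilation -/

/-- `W`-bounded execution of `P` from `s` within `T` steps, ending in a state satisfying `Q`. -/
def Exec (W : ℕ) (P : Prog) (s : State) (T : ℕ) (Q : State → Prop) : Prop :=
  ∃ t s', Runs W P s t s' ∧ t ≤ T ∧ Q s'

/-! ### Step-counting rules for RAM programs. -/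

section Exec
variable {W : ℕ} {s : State} {Q : State → Prop}

lemma Exec.skip (h : Q s) : Exec W .skip s 1 Q := ⟨1, _, .skip s, le_rfl, h⟩

lemma Exec.const {i k : ℕ} (hk : k < W) (h : Q (s.setReg i k)) : Exec W (.const i k) s 1 Q :=
  ⟨1, _, .const s i k hk, le_rfl, h⟩

lemma Exec.arith {o : Op} {i j k : ℕ} (hk : o.eval (s.reg j) (s.reg k) < W)
    (h : Q (s.setReg i (o.eval (s.reg j) (s.reg k)))) : Exec W (.arith o i j k) s 1 Q :=
  ⟨1, _, .arith s o i j k hk, le_rfl, h⟩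

lemma Exec.load {i j : ℕ} (hk : s.mem (s.reg j) < W) (h : Q (s.setReg i (s.mem (s.reg j)))) :
    Exec W (.load i j) s 1 Q :=
  ⟨1, _, .load s i j hk, le_rfl, h⟩

lemma Exec.store {i j : ℕ} (h : Q (s.setMem (s.reg i) (s.reg j))) :
    Exec W (.store i j) s 1 Q :=
  ⟨1, _, .store s i j, le_rfl, h⟩

lemma Exec.seq {P P' : Prog} {T T' : ℕ} (h : Exec W P s T fun s' => Exec W P' s' T' Q) :
    Exec W (.seq P P') s (T + T') Q := by
  obtain ⟨t, s', h1, h2, t', s'', h3, h4, h5⟩ := h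
  exact ⟨_, _, .seq h1 h3, by omega, h5⟩

lemma Exec.ifLt {P P' : Prog} {i j T : ℕ} (h₁ : s.reg i < s.reg j → Exec W P s T Q)
    (h₂ : ¬ s.reg i < s.reg j → Exec W P' s T Q) : Exec W (.ifLt i j P P') s (T + 1) Q := by
  by_cases h : s.reg i < s.reg j
  · obtain ⟨t, s', h3, h4, h5⟩ := h₁ h
    exact ⟨_, _, .ifTrue h h3, by omega, h5⟩
  · obtain ⟨t, s', h3, h4, h5⟩ := h₂ h
    exact ⟨_, _, .ifFalse h h3, by omega, h5⟩

lemma Exec.mono {P : Prog} {T T' : ℕ} {Q' : State → Prop} (h : Exec W P s T Q) (hT : T ≤ T')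
    (hQ : ∀ s', Q s' → Q' s') : Exec W P s T' Q' := by
  obtain ⟨t, s', h1, h2, h3⟩ := h
  exact ⟨t, s', h1, h2.trans hT, hQ _ h3⟩

/-- A loop whose counter `R i` runs from `m` to the value `M` of `R j`. -/
lemma Exec.whileLt {P : Prog} {i j T M : ℕ} (I : ℕ → State → Prop)
    (hi : ∀ m s, I m s → s.reg i = m ∧ s.reg j = M)
    (hP : ∀ m s, m < M → I m s → Exec W P s T (I (m + 1))) :
    ∀ r m s, m + r = M → I m s → Exec W (.whileLt i j P) s (r * (T + 1) + 1) (I M) := by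
  intro r
  induction r with
  | zero =>
    intro m s hm hI
    obtain ⟨h1, h2⟩ := hi _ _ hI
    exact ⟨1, s, .whileFalse (by omega), by omega, by rwa [← hm]⟩
  | succ r ih =>
    intro m s hm hI
    obtain ⟨h1, h2⟩ := hi _ _ hI
    obtain ⟨t, s', h3, h4, h5⟩ := hP m s (by omega) hI
    obtain ⟨t', s'', h6, h7, h8⟩ := ih (m + 1) s' (by omega) h5
    exact ⟨_, _, .whileTrue (by omega) h3 h6, by rw [Nat.succ_mul]; omega, h8⟩

end Exec

/-! ### Memory addresses and the representation of stores. -/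

/-- An injective pairing of natural numbers. -/
def pr (x y : ℕ) : ℕ := (x + y) * (x + y) + y

/-- The pair lies between `(x + y) ^ 2` and `(x + y + 1) ^ 2`, the latter excluded, so it determines
`x + y` and then `y`. -/
lemma pr_inj {x y x' y' : ℕ} (h : pr x y = pr x' y') : x = x' ∧ y = y' := by
  unfold pr at h
  have h1 : x + y = x' + y' := by
    rcases lt_trichotomy (x + y) (x' + y') with h2 | h2 | h2
    · nlinarith
    · exact h2
    · nlinarith
  rw [h1] at h
  omega

/-- The address of an array element. -/
def addr (n : ℕ) (b : Arr) (i j k : ℕ) : ℕ := pr (pr i j) k * 32 + b.ctorIdx + 2 * n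

lemma Arr.ctorIdx_lt (b : Arr) : b.ctorIdx < 32 := by cases b <;> decide

lemma Arr.ctorIdx_inj {b b' : Arr} (h : b.ctorIdx = b'.ctorIdx) : b = b' := by
  cases b <;> cases b' <;> first | rfl | (exact absurd h (by decide))

lemma Var.ctorIdx_inj {b b' : Var} (h : b.ctorIdx = b'.ctorIdx) : b = b' := by
  cases b <;> cases b' <;> first | rfl | (exact absurd h (by decide))

lemma addr_inj {n : ℕ} {b b' : Arr} {i j k i' j' k' : ℕ}
    (h : addr n b i j k = addr n b' i' j' k') : b = b' ∧ i = i' ∧ j = j' ∧ k = k' := by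
  unfold addr at h
  have h1 := b.ctorIdx_lt
  have h2 := b'.ctorIdx_lt
  obtain ⟨h3, h4⟩ := pr_inj (show pr (pr i j) k = pr (pr i' j') k' by omega)
  obtain ⟨h5, h6⟩ := pr_inj h3
  exact ⟨Arr.ctorIdx_inj (by omega), h5, h6, h4⟩

/-- The machine state `s` represents the store `σ`. Register `4 x` holds a variable, registers
`4 d + 1` hold temporary values, registers `4 l + 2` and `4 l + 3` with `2 ≤ l` control the loops
at nesting depth `l`. -/
structure Good (n : ℕ) (σ : Store) (s : State) : Prop where
  pos : 0 < n
  v : ∀ x : Var, s.reg (4 * x.ctorIdx) = σ.v x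
  len : s.reg 3 = n
  two : s.reg 2 = 2 * n
  cap : s.reg 6 = cap n
  lo : ∀ i < 2 * n, s.mem i = σ.lo i
  a : ∀ b i j k, s.mem (addr n b i j k) = σ.a b i j k
  v_lt : ∀ x, σ.v x < LoopLang.cap n
  lo_lt : ∀ i < 2 * n, σ.lo i < LoopLang.cap n
  a_lt : ∀ b i j k, σ.a b i j k < LoopLang.cap n

/-- Temporaries and loop registers are free: the representation looks only at the variables and at
the reserved registers 2, 3 and 6. -/
lemma Good.congr {n : ℕ} {σ : Store} {s s' : State} (h : Good n σ s) (hm : s'.mem = s.mem)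
    (hr : ∀ r, r % 4 = 0 ∨ r = 2 ∨ r = 3 ∨ r = 6 → s'.reg r = s.reg r) : Good n σ s' where
  pos := h.pos
  v x := by rw [hr _ (by omega), h.v]
  len := by rw [hr _ (by omega), h.len]
  two := by rw [hr _ (by omega), h.two]
  cap := by rw [hr _ (by omega), h.cap]
  lo := by rw [hm]; exact h.lo
  a := by rw [hm]; exact h.a
  v_lt := h.v_lt
  lo_lt := h.lo_lt
  a_lt := h.a_lt

/-! ### RAM code for expressions. -/

/-- `R i := R j` for `i ≠ j`. -/
def mov (i j : ℕ) : Prog := .seq (.const i 0) (.arith .add i i j)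

lemma Exec.mov {W : ℕ} {s : State} {Q : State → Prop} {i j : ℕ} (hij : i ≠ j)
    (hj : s.reg j < W)
    (h : ∀ s', s'.mem = s.mem → s'.reg i = s.reg j → (∀ r, r ≠ i → s'.reg r = s.reg r) → Q s') :
    Exec W (mov i j) s 2 Q := by
  refine Exec.seq (T := 1) (T' := 1) (Exec.const (by omega) (Exec.arith ?_ ?_))
  · simpa [State.setReg, Function.update_of_ne hij.symm, Op.eval] using hj
  · apply h
    · rfl
    · simp [State.setReg, Function.update_of_ne hij.symm, Op.eval]
    · intro r hr
      simp [State.setReg, Function.update_of_ne hr]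

/-- Replace the temporary values at `d`, `d + 1` by their pair. -/
def pairP (d : ℕ) : Prog :=
  .seq (.arith .add (4 * d + 1) (4 * d + 1) (4 * (d + 1) + 1))
    (.seq (.arith .mul (4 * d + 1) (4 * d + 1) (4 * d + 1))
      (.arith .add (4 * d + 1) (4 * d + 1) (4 * (d + 1) + 1)))

lemma Exec.pairP {W : ℕ} {s : State} {Q : State → Prop} {d : ℕ}
    (hW : pr (s.reg (4 * d + 1)) (s.reg (4 * (d + 1) + 1)) < W)
    (h : ∀ s', s'.mem = s.mem →
      s'.reg (4 * d + 1) = pr (s.reg (4 * d + 1)) (s.reg (4 * (d + 1) + 1)) →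
      (∀ r, r ≠ 4 * d + 1 → s'.reg r = s.reg r) → Q s') :
    Exec W (pairP d) s 3 Q := by
  have h1 : 4 * (d + 1) + 1 ≠ 4 * d + 1 := by omega
  have h2 := Nat.le_mul_self (s.reg (4 * d + 1) + s.reg (4 * (d + 1) + 1))
  unfold pr at hW
  refine Exec.seq (T := 1) (T' := 2) (Exec.arith ?_ (Exec.seq (T := 1) (T' := 1)
    (Exec.arith ?_ (Exec.arith ?_ ?_))))
  · simp only [Op.eval]; omega
  · simp only [State.setReg, Op.eval, Function.update_self]; omega
  · simp only [State.setReg, Op.eval, Function.update_self, Function.update_of_ne h1]; omega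
  · apply h
    · rfl
    · simp only [State.setReg, Op.eval, Function.update_self, Function.update_of_ne h1, pr]
    · intro r hr
      simp [State.setReg, Function.update_of_ne hr]

/-- Turn the pair at `d` into an address. -/
def addrP (b : Arr) (d : ℕ) : Prog :=
  .seq (.const (4 * (d + 1) + 1) 32)
    (.seq (.arith .mul (4 * d + 1) (4 * d + 1) (4 * (d + 1) + 1))
      (.seq (.const (4 * (d + 1) + 1) b.ctorIdx)
        (.seq (.arith .add (4 * d + 1) (4 * d + 1) (4 * (d + 1) + 1))
          (.arith .add (4 * d + 1) (4 * d + 1) 2))))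

lemma Exec.addrP {W n : ℕ} {s : State} {Q : State → Prop} {d : ℕ} {b : Arr} {i j k : ℕ}
    (hW : addr n b i j k < W) (h32 : 32 < W) (hr : s.reg (4 * d + 1) = pr (pr i j) k)
    (h2 : s.reg 2 = 2 * n)
    (h : ∀ s', s'.mem = s.mem → s'.reg (4 * d + 1) = addr n b i j k →
      (∀ r, r ≠ 4 * d + 1 → r ≠ 4 * (d + 1) + 1 → s'.reg r = s.reg r) → Q s') :
    Exec W (addrP b d) s 5 Q := by
  have h1 : 4 * (d + 1) + 1 ≠ 4 * d + 1 := by omega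
  have h3 : 2 ≠ 4 * d + 1 := by omega
  have h4 : 2 ≠ 4 * (d + 1) + 1 := by omega
  have hb := b.ctorIdx_lt
  unfold addr at hW
  refine Exec.seq (T := 1) (T' := 4) (Exec.const h32 (Exec.seq (T := 1) (T' := 3)
    (Exec.arith ?_ (Exec.seq (T := 1) (T' := 2) (Exec.const (by omega) (Exec.seq (T := 1) (T' := 1)
      (Exec.arith ?_ (Exec.arith ?_ ?_))))))))
  · simp only [State.setReg, Op.eval, Function.update_self, Function.update_of_ne h1.symm, hr]
    omega
  · simp only [State.setReg, Op.eval, Function.update_self, Function.update_of_ne h1.symm,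
      hr]
    omega
  · simp only [State.setReg, Op.eval, Function.update_self, Function.update_of_ne h1.symm,
      Function.update_of_ne h3, Function.update_of_ne h4, hr, h2]
    omega
  · apply h
    · rfl
    · simp only [State.setReg, Op.eval, Function.update_self, Function.update_of_ne h1.symm,
        Function.update_of_ne h3, Function.update_of_ne h4, hr, h2, addr]
    · intro r hr hr'
      simp [State.setReg, Function.update_of_ne hr, Function.update_of_ne hr']

/-- Reduce the temporary value at `d` modulo `R 2`. -/
def modP (d : ℕ) : Prog :=
  .seq (.arith .div (4 * (d + 1) + 1) (4 * d + 1) 2)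
    (.seq (.arith .mul (4 * (d + 1) + 1) (4 * (d + 1) + 1) 2)
      (.arith .sub (4 * d + 1) (4 * d + 1) (4 * (d + 1) + 1)))

lemma Exec.modP {W n : ℕ} {s : State} {Q : State → Prop} {d : ℕ}
    (hW : s.reg (4 * d + 1) < W) (h2 : s.reg 2 = 2 * n)
    (h : ∀ s', s'.mem = s.mem → s'.reg (4 * d + 1) = s.reg (4 * d + 1) % (2 * n) →
      (∀ r, r ≠ 4 * d + 1 → r ≠ 4 * (d + 1) + 1 → s'.reg r = s.reg r) → Q s') :
    Exec W (modP d) s 3 Q := by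
  have h1 : 4 * d + 1 ≠ 4 * (d + 1) + 1 := by omega
  have h4 : 2 ≠ 4 * (d + 1) + 1 := by omega
  have h5 := Nat.div_mul_le_self (s.reg (4 * d + 1)) (2 * n)
  refine Exec.seq (T := 1) (T' := 2) (Exec.arith ?_ (Exec.seq (T := 1) (T' := 1)
    (Exec.arith ?_ (Exec.arith ?_ ?_))))
  · simp only [Op.eval]
    exact (Nat.div_le_self _ _).trans_lt hW
  · simp only [State.setReg, Op.eval, Function.update_self, Function.update_of_ne h4, h2]
    omega
  · simp only [State.setReg, Op.eval, Function.update_self, Function.update_of_ne h4, h2,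
      Function.update_of_ne h1]
    omega
  · apply h
    · rfl
    · simp only [State.setReg, Op.eval, Function.update_self, Function.update_of_ne h4, h2,
        Function.update_of_ne h1]
      have := Nat.div_add_mod' (s.reg (4 * d + 1)) (2 * n)
      omega
    · intro r hr hr'
      simp [State.setReg, Function.update_of_ne hr, Function.update_of_ne hr']

/-- Given code for the indices, compute the address of an array element. -/
def addrOf (b : Arr) (P Q R : Prog) (d : ℕ) : Prog :=
  .seq P (.seq Q (.seq (pairP d) (.seq R (.seq (pairP d) (addrP b d)))))

/-- Code that evaluates an expression into the temporary register at `d`. -/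
def Ex.comp : Ex → ℕ → Prog
  | .lit k, d => .const (4 * d + 1) k
  | .len, d => mov (4 * d + 1) 3
  | .var x, d => mov (4 * d + 1) (4 * x.ctorIdx)
  | .lo e, d => .seq (e.comp d) (.seq (modP d) (.load (4 * d + 1) (4 * d + 1)))
  | .get b e f g, d => .seq (addrOf b (e.comp d) (f.comp (d + 1)) (g.comp (d + 1)) d)
      (.load (4 * d + 1) (4 * d + 1))
  | .op o e f, d => .seq (e.comp d) (.seq (f.comp (d + 1))
      (.arith o (4 * d + 1) (4 * d + 1) (4 * (d + 1) + 1)))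

/-- Bounds a literal uniformly in `n`, with the literal itself as exponent. -/
lemma lt_base_pow (n k : ℕ) : k < (n + 2) ^ k := Nat.lt_pow_self (by omega)

lemma base_pow_mono (n : ℕ) {k l : ℕ} (h : k ≤ l) : (n + 2) ^ k ≤ (n + 2) ^ l :=
  Nat.pow_le_pow_right (by omega) h

/-- Squaring a sum of two numbers costs a factor of at most 4; the three extra exponents supply at
least 8, because the base is at least 2. -/
lemma pr_lt_base_pow {n x y a : ℕ} (hx : x < (n + 2) ^ a) (hy : y < (n + 2) ^ a) :
    pr x y < (n + 2) ^ (2 * a + 3) := by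
  unfold pr
  have h8 : 8 ≤ (n + 2) ^ 3 := by
    calc 8 = 2 ^ 3 := rfl
      _ ≤ _ := Nat.pow_le_pow_left (by omega) 3
  have e : (n + 2) ^ (2 * a + 3) = (n + 2) ^ a * (n + 2) ^ a * (n + 2) ^ 3 := by
    rw [← pow_add, ← pow_add]; ring_nf
  rw [e]
  generalize (n + 2) ^ a = A at *
  have h1 : x + y + 2 ≤ 2 * A := by omega
  have h2 : (x + y) * (x + y) + y < (x + y + 2) * (x + y + 2) := by nlinarith
  have h3 : (x + y + 2) * (x + y + 2) ≤ (2 * A) * (2 * A) := Nat.mul_le_mul h1 h1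
  have h4 : A * A * 8 ≤ A * A * (n + 2) ^ 3 := Nat.mul_le_mul_left _ h8
  nlinarith

lemma op_eval_lt_base_pow {n x y a b : ℕ} (o : Op) (hx : x < (n + 2) ^ a)
    (hy : y < (n + 2) ^ b) : o.eval x y < (n + 2) ^ (a + b + 1) := by
  have h1 : (n + 2) ^ a ≤ (n + 2) ^ (a + b) := base_pow_mono n (by omega)
  have h2 : (n + 2) ^ b ≤ (n + 2) ^ (a + b) := base_pow_mono n (by omega)
  have h3 : (n + 2) ^ (a + b) * 2 ≤ (n + 2) ^ (a + b + 1) := by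
    rw [pow_succ]; exact Nat.mul_le_mul_left _ (by omega)
  cases o with
  | add => simp only [Op.eval]; omega
  | sub => simp only [Op.eval]; omega
  | mul =>
    have h4 : x * y < (n + 2) ^ a * (n + 2) ^ b := Nat.mul_lt_mul'' hx hy
    rw [← pow_add] at h4
    simp only [Op.eval]; omega
  | div => simp only [Op.eval]; exact (Nat.div_le_self _ _).trans_lt (by omega)

/-- The compiled expression computes its value, with a polynomial bound on all numbers. -/
def Ex.Spec (e : Ex) : Prop := ∃ c T, ∀ {n W : ℕ} {σ : Store} {s : State},
    Good n σ s → (n + 2) ^ c ≤ W → e.ev n σ < (n + 2) ^ c ∧ ∀ (d : ℕ) (Q : State → Prop),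
      (∀ s', s'.mem = s.mem → s'.reg (4 * d + 1) = e.ev n σ →
        (∀ r, r % 4 ≠ 1 ∨ r < 4 * d + 1 → s'.reg r = s.reg r) → Q s') →
      Exec W (e.comp d) s T Q

/-- Code at depth `d + 1` leaves the temporary at depth `d` intact. So a partial pair survives the
evaluation of the next index. -/
lemma Ex.Spec.addrOf {e f g : Ex} (ihe : e.Spec) (ihf : f.Spec) (ihg : g.Spec) (b : Arr) :
    ∃ c T, ∀ {n W : ℕ} {σ : Store} {s : State},
      Good n σ s → (n + 2) ^ c ≤ W → ∀ (d : ℕ) (Q : State → Prop),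
      (∀ s', s'.mem = s.mem →
        s'.reg (4 * d + 1) = addr n b (e.ev n σ) (f.ev n σ) (g.ev n σ) →
        (∀ r, r % 4 ≠ 1 ∨ r < 4 * d + 1 → s'.reg r = s.reg r) → Q s') →
      Exec W (addrOf b (e.comp d) (f.comp (d + 1)) (g.comp (d + 1)) d) s T Q := by
  obtain ⟨c1, T1, ihe⟩ := ihe
  obtain ⟨c2, T2, ihf⟩ := ihf
  obtain ⟨c3, T3, ihg⟩ := ihg
  -- The exponent after two pairings. Six more exponents give a factor of at least 64, which absorbs
  -- the multiplication by 32 and the offset in `addr`.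
  obtain ⟨C, hC⟩ : ∃ C, C = 2 * (2 * (c1 + c2 + c3) + 3) + 3 := ⟨_, rfl⟩
  refine ⟨C + 6, T1 + (T2 + (3 + (T3 + (3 + 5)))), fun {n W σ s} hG hW d Q hQ => ?_⟩
  obtain ⟨hb1, ihe⟩ := ihe hG ((base_pow_mono n (show c1 ≤ C + 6 by omega)).trans hW)
  have hb2 := (ihf hG ((base_pow_mono n (show c2 ≤ C + 6 by omega)).trans hW)).1
  have hb3 := (ihg hG ((base_pow_mono n (show c3 ≤ C + 6 by omega)).trans hW)).1
  have hb1' := hb1.trans_le (base_pow_mono n (show c1 ≤ c1 + c2 + c3 by omega))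
  have hb2' := hb2.trans_le (base_pow_mono n (show c2 ≤ c1 + c2 + c3 by omega))
  have hb3' := hb3.trans_le (base_pow_mono n (show c3 ≤ 2 * (c1 + c2 + c3) + 3 by omega))
  have hp1 := pr_lt_base_pow hb1' hb2'
  have hp2 := pr_lt_base_pow hp1 hb3'
  rw [← hC] at hp2
  have hpC : (n + 2) ^ (2 * (c1 + c2 + c3) + 3) ≤ (n + 2) ^ (C + 6) :=
    base_pow_mono n (by omega)
  have hCC : (n + 2) ^ C * 64 ≤ (n + 2) ^ (C + 6) := by
    rw [pow_add]
    refine Nat.mul_le_mul_left _ ?_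
    calc 64 = 2 ^ 6 := rfl
      _ ≤ _ := Nat.pow_le_pow_left (by omega) 6
  have hn : n < (n + 2) ^ C := by
    calc n < (n + 2) ^ 1 := by simp
      _ ≤ _ := base_pow_mono n (by omega)
  have hC1 : 1 ≤ (n + 2) ^ C := Nat.one_le_pow _ _ (by omega)
  have hA : addr n b (e.ev n σ) (f.ev n σ) (g.ev n σ) < W := by
    unfold addr
    have := b.ctorIdx_lt
    omega
  refine Exec.seq (ihe d _ ?_)
  intro s1 hm1 hr1 hs1
  have hG1 := hG.congr hm1 fun r hr => hs1 r (by omega)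
  obtain ⟨-, ihf⟩ := ihf hG1 ((base_pow_mono n (show c2 ≤ C + 6 by omega)).trans hW)
  refine Exec.seq (ihf (d + 1) _ ?_)
  intro s2 hm2 hr2 hs2
  have hd2 : s2.reg (4 * d + 1) = e.ev n σ := by rw [hs2 _ (by omega), hr1]
  refine Exec.seq (Exec.pairP (by rw [hd2, hr2]; omega) ?_)
  intro s3 hm3 hr3 hs3
  rw [hd2, hr2] at hr3
  have hG3 := hG1.congr (s' := s3) (by rw [hm3, hm2]) fun r hr => by
    rw [hs3 r (by omega), hs2 r (by omega)]
  obtain ⟨-, ihg⟩ := ihg hG3 ((base_pow_mono n (show c3 ≤ C + 6 by omega)).trans hW)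
  refine Exec.seq (ihg (d + 1) _ ?_)
  intro s4 hm4 hr4 hs4
  have hd4 : s4.reg (4 * d + 1) = pr (e.ev n σ) (f.ev n σ) := by rw [hs4 _ (by omega), hr3]
  refine Exec.seq (Exec.pairP (by rw [hd4, hr4]; omega) ?_)
  intro s5 hm5 hr5 hs5
  rw [hd4, hr4] at hr5
  have hG5 := hG3.congr (s' := s5) (by rw [hm5, hm4]) fun r hr => by
    rw [hs5 r (by omega), hs4 r (by omega)]
  refine Exec.addrP hA (by omega) hr5 hG5.two ?_
  intro s6 hm6 hr6 hs6
  refine hQ _ ?_ hr6 fun r hr => ?_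
  · exact hm6.trans (hm5.trans (hm4.trans (hm3.trans (hm2.trans hm1))))
  · rw [hs6 r (by omega) (by omega), hs5 r (by omega),
      hs4 r (by omega), hs3 r (by omega), hs2 r (by omega), hs1 r hr]

/-- The exponent and the step count depend on the expression only. Whatever is read from the store
is below `cap n`, hence the exponent 6 for reads; arithmetic adds exponents. -/
lemma Ex.spec (e : Ex) : e.Spec := by
  induction e with
  | lit k =>
    refine ⟨k, 1, fun {n W σ s} hG hW => ⟨lt_base_pow n k, fun d Q hQ => ?_⟩⟩
    refine Exec.const ((lt_base_pow n k).trans_le hW) (hQ _ rfl ?_ ?_)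
    · simp [State.setReg, Ex.ev]
    · intro r hr
      simp only [State.setReg]
      rw [Function.update_of_ne (by omega)]
  | len =>
    refine ⟨1, 2, fun {n W σ s} hG hW => ?_⟩
    have h1 : n < (n + 2) ^ 1 := by simp
    refine ⟨h1, fun d Q hQ => Exec.mov (by omega) (by rw [hG.len]; omega) ?_⟩
    intro s' h2 h3 h4
    exact hQ _ h2 (by rw [h3, hG.len]; rfl) fun r hr => h4 r (by omega)
  | var x =>
    refine ⟨6, 2, fun {n W σ s} hG hW => ?_⟩
    have h1 : σ.v x < (n + 2) ^ 6 := hG.v_lt x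
    refine ⟨h1, fun d Q hQ => Exec.mov (by omega) (by rw [hG.v]; omega) ?_⟩
    intro s' h2 h3 h4
    exact hQ _ h2 (by rw [h3, hG.v]; rfl) fun r hr => h4 r (by omega)
  | lo e ih =>
    obtain ⟨c, T, ih⟩ := ih
    refine ⟨c + 6, T + (3 + 1), fun {n W σ s} hG hW => ?_⟩
    have hp := hG.pos
    have hm : e.ev n σ % (2 * n) < 2 * n := Nat.mod_lt _ (by omega)
    have h6 : (n + 2) ^ 6 ≤ (n + 2) ^ (c + 6) := base_pow_mono n (by omega)
    have hc : (n + 2) ^ c ≤ (n + 2) ^ (c + 6) := base_pow_mono n (by omega)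
    have hl : σ.lo (e.ev n σ % (2 * n)) < (n + 2) ^ 6 := hG.lo_lt _ hm
    refine ⟨hl.trans_le h6, fun d Q hQ => ?_⟩
    obtain ⟨hb, ih⟩ := ih hG (hc.trans hW)
    refine Exec.seq (ih d _ ?_)
    intro s1 hm1 hr1 hs1
    refine Exec.seq (Exec.modP (n := n) (by omega) (by rw [hs1 2 (by omega), hG.two]) ?_)
    intro s2 hm2 hr2 hs2
    have hl2 : s2.mem (s2.reg (4 * d + 1)) = σ.lo (e.ev n σ % (2 * n)) := by
      rw [hr2, hm2, hm1, hr1, hG.lo _ hm]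
    refine Exec.load (by omega) (hQ _ (hm2.trans hm1) ?_ ?_)
    · simp only [State.setReg, Function.update_self, hl2, Ex.ev]
    · intro r hr
      simp only [State.setReg]
      rw [Function.update_of_ne (by omega), hs2 r (by omega) (by omega), hs1 r hr]
  | get b e f g ihe ihf ihg =>
    obtain ⟨c, T, ih⟩ := Ex.Spec.addrOf ihe ihf ihg b
    refine ⟨c + 6, T + 1, fun {n W σ s} hG hW => ?_⟩
    have h6 : (n + 2) ^ 6 ≤ (n + 2) ^ (c + 6) := base_pow_mono n (by omega)
    have hl : σ.a b (e.ev n σ) (f.ev n σ) (g.ev n σ) < (n + 2) ^ 6 := hG.a_lt _ _ _ _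
    refine ⟨hl.trans_le h6, fun d Q hQ => ?_⟩
    refine Exec.seq (ih hG ((base_pow_mono n (by omega)).trans hW) d _ ?_)
    intro s1 hm1 hr1 hs1
    have hl1 : s1.mem (s1.reg (4 * d + 1)) = σ.a b (e.ev n σ) (f.ev n σ) (g.ev n σ) := by
      rw [hr1, hm1, hG.a]
    refine Exec.load (by omega) (hQ _ hm1 ?_ ?_)
    · simp only [State.setReg, Function.update_self, hl1, Ex.ev]
    · intro r hr
      simp only [State.setReg]
      rw [Function.update_of_ne (by omega), hs1 r hr]
  | op o e f ihe ihf =>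
    obtain ⟨c1, T1, ihe⟩ := ihe
    obtain ⟨c2, T2, ihf⟩ := ihf
    refine ⟨c1 + c2 + 1, T1 + (T2 + 1), fun {n W σ s} hG hW => ?_⟩
    obtain ⟨hb1, ihe⟩ := ihe hG ((base_pow_mono n (by omega)).trans hW)
    have hb2 := (ihf hG ((base_pow_mono n (by omega)).trans hW)).1
    have hop := op_eval_lt_base_pow o hb1 hb2
    refine ⟨hop, fun d Q hQ => ?_⟩
    refine Exec.seq (ihe d _ ?_)
    intro s1 hm1 hr1 hs1
    have hG1 := hG.congr hm1 fun r hr => hs1 r (by omega)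
    obtain ⟨-, ihf⟩ := ihf hG1 ((base_pow_mono n (by omega)).trans hW)
    refine Exec.seq (ihf (d + 1) _ ?_)
    intro s2 hm2 hr2 hs2
    have hd2 : s2.reg (4 * d + 1) = e.ev n σ := by rw [hs2 _ (by omega), hr1]
    refine Exec.arith (by rw [hd2, hr2]; omega) (hQ _ (hm2.trans hm1) ?_ ?_)
    · simp only [State.setReg, Function.update_self, hd2, hr2, Ex.ev]
    · intro r hr
      simp only [State.setReg]
      rw [Function.update_of_ne (by omega), hs2 r (by omega), hs1 r hr]

/-! ### RAM code for statements. -/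

/-- Clamp the temporary value at `d`. -/
def clampP (d : ℕ) : Prog := .ifLt (4 * d + 1) 6 .skip (.const (4 * d + 1) 0)

lemma Exec.clampP {W n : ℕ} {s : State} {Q : State → Prop} {d : ℕ} (hW : 0 < W)
    (h6 : s.reg 6 = cap n)
    (h : ∀ s', s'.mem = s.mem → s'.reg (4 * d + 1) = clamp n (s.reg (4 * d + 1)) →
      (∀ r, r ≠ 4 * d + 1 → s'.reg r = s.reg r) → Q s') :
    Exec W (clampP d) s 2 Q := by
  refine Exec.ifLt (T := 1) (fun hlt => Exec.skip (h _ rfl ?_ fun _ _ => rfl))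
    (fun hlt => Exec.const hW (h _ rfl ?_ fun r hr => ?_))
  · rw [h6] at hlt
    simp [clamp, hlt]
  · rw [h6] at hlt
    simp [clamp, hlt, State.setReg]
  · simp [State.setReg, Function.update_of_ne hr]

/-- Multiply `R i` by the `d`-th power of `R 3`. -/
def powP (i : ℕ) : ℕ → Prog
  | 0 => .skip
  | d + 1 => .seq (powP i d) (.arith .mul i i 3)

lemma Exec.powP {W n i : ℕ} {s : State} (hi : i ≠ 3) (h1 : s.reg i = 1) (h3 : s.reg 3 = n) :
    ∀ (d : ℕ) (Q : State → Prop), (n + 2) ^ d ≤ W →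
    (∀ s', s'.mem = s.mem → s'.reg i = n ^ d → (∀ r, r ≠ i → s'.reg r = s.reg r) → Q s') →
    Exec W (powP i d) s (d + 1) Q := by
  intro d
  induction d with
  | zero =>
    intro Q _ h
    exact Exec.skip (h s rfl (by simp [h1]) fun _ _ => rfl)
  | succ d ih =>
    intro Q hW h
    refine Exec.seq (ih _ ((base_pow_mono n (by omega)).trans hW) ?_)
    intro s' hm hr hs
    have e : Op.mul.eval (s'.reg i) (s'.reg 3) = n ^ (d + 1) := by
      rw [hr, hs 3 hi.symm, h3, pow_succ]; rfl
    refine Exec.arith ?_ (h _ hm ?_ ?_)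
    · rw [e]
      exact (Nat.pow_lt_pow_left (by omega) (by omega)).trans_le hW
    · simp only [State.setReg, Function.update_self, e]
    · intro r hr
      simp only [State.setReg, Function.update_of_ne hr, hs r hr]

/-- Code for a statement at nesting depth `l`. -/
def Stmt.comp : Stmt → ℕ → Prog
  | .skip, _ => .skip
  | .asg x e, _ => .seq (e.comp 0) (.seq (clampP 0) (mov (4 * x.ctorIdx) 1))
  | .putLo i e, _ => .seq (i.comp 0) (.seq (modP 0) (.seq (e.comp 1) (.seq (clampP 1)
      (.store 1 5))))
  | .put b i j k e, _ => .seq (addrOf b (i.comp 0) (j.comp 1) (k.comp 1) 0)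
      (.seq (e.comp 1) (.seq (clampP 1) (.store 1 5)))
  | .seq P Q, l => .seq (P.comp l) (Q.comp l)
  | .ite e f P Q, l => .seq (e.comp 0) (.seq (f.comp 1) (.ifLt 1 5 (P.comp l) (Q.comp l)))
  | .loop x d e P, l => .seq (e.comp 0) (.seq (.const 5 1) (.seq (powP 5 d)
      (.seq (.ifLt 1 5 (mov (4 * l + 3) 1) (mov (4 * l + 3) 5)) (.seq (.const (4 * l + 2) 0)
        (.whileLt (4 * l + 2) (4 * l + 3)
          (.seq (mov 1 (4 * l + 2)) (.seq (clampP 0) (.seq (mov (4 * x.ctorIdx) 1)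
            (.seq (P.comp (l + 1)) (.seq (.const 1 1)
              (.arith .add (4 * l + 2) (4 * l + 2) 1)))))))))))

lemma clamp_lt_cap (n w : ℕ) : clamp n w < cap n := by
  unfold clamp
  split_ifs with h
  · exact h
  · exact Nat.pos_of_ne_zero (by unfold cap; positivity)

lemma Good.setV {n : ℕ} {σ : Store} {s s' : State} {x : Var} {w : ℕ} (h : Good n σ s)
    (hm : s'.mem = s.mem) (hx : s'.reg (4 * x.ctorIdx) = clamp n w)
    (hr : ∀ r, r % 4 = 0 ∨ r = 2 ∨ r = 3 ∨ r = 6 → r ≠ 4 * x.ctorIdx → s'.reg r = s.reg r) :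
    Good n (σ.setV x (clamp n w)) s' where
  pos := h.pos
  v y := by
    by_cases hy : y = x
    · subst hy; simp [hx, Store.setV]
    · rw [hr _ (by omega) fun h => hy (Var.ctorIdx_inj (by omega)), h.v]
      simp [Store.setV, hy]
  len := by rw [hr _ (by omega) (by omega), h.len]
  two := by rw [hr _ (by omega) (by omega), h.two]
  cap := by rw [hr _ (by omega) (by omega), h.cap]
  lo := by rw [hm]; exact h.lo
  a := by rw [hm]; exact h.a
  v_lt y := by
    by_cases hy : y = x
    · subst hy; simp [Store.setV, clamp_lt_cap]
    · simp [Store.setV, hy, h.v_lt]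
  lo_lt := h.lo_lt
  a_lt := h.a_lt

/-- Array addresses start at `2 * n`, so a write below `2 * n` cannot touch an array. -/
lemma Good.setLo {n : ℕ} {σ : Store} {s s' : State} {i w : ℕ} (h : Good n σ s) (hi : i < 2 * n)
    (hm : s'.mem = Function.update s.mem i (clamp n w)) (hr : s'.reg = s.reg) :
    Good n (σ.setLo i (clamp n w)) s' where
  pos := h.pos
  v y := by rw [hr, h.v]; rfl
  len := by rw [hr, h.len]
  two := by rw [hr, h.two]
  cap := by rw [hr, h.cap]
  lo j hj := by
    by_cases hy : j = i
    · subst hy; simp [hm, Store.setLo]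
    · simp [hm, Store.setLo, hy, h.lo j hj]
  a b j k l := by
    rw [hm, Function.update_of_ne (by unfold addr; omega), h.a]; rfl
  v_lt := h.v_lt
  lo_lt j hj := by
    by_cases hy : j = i
    · subst hy; simp [Store.setLo, clamp_lt_cap]
    · simp [Store.setLo, hy, h.lo_lt j hj]
  a_lt := h.a_lt

lemma Good.setA {n : ℕ} {σ : Store} {s s' : State} {b : Arr} {i j k w : ℕ} (h : Good n σ s)
    (hm : s'.mem = Function.update s.mem (addr n b i j k) (clamp n w)) (hr : s'.reg = s.reg) :
    Good n (σ.setA b i j k (clamp n w)) s' where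
  pos := h.pos
  v y := by rw [hr, h.v]; rfl
  len := by rw [hr, h.len]
  two := by rw [hr, h.two]
  cap := by rw [hr, h.cap]
  lo l hl := by
    rw [hm, Function.update_of_ne (by unfold addr; omega), h.lo l hl]; rfl
  a b' i' j' k' := by
    simp only [Store.setA]
    split_ifs with hc
    · obtain ⟨rfl, rfl, rfl, rfl⟩ := hc
      simp [hm]
    · rw [hm, Function.update_of_ne (fun h => hc (addr_inj h)), h.a]
  v_lt := h.v_lt
  lo_lt := h.lo_lt
  a_lt b' i' j' k' := by
    simp only [Store.setA]
    split_ifs with hc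
    · exact clamp_lt_cap _ _
    · exact h.a_lt _ _ _ _

/-- The compiled statement simulates the statement, in time `O(n ^ deg)` and with words of
polynomial size. -/
lemma Stmt.spec (P : Stmt) : ∃ c K, ∀ {n W : ℕ} {σ : Store} {s : State} {l : ℕ},
    Good n σ s → 2 ≤ l → (n + 2) ^ c ≤ W →
    Exec W (P.comp l) s (K * n ^ P.deg) fun s' => Good n (P.run n σ) s' ∧
      ∀ r, 2 ≤ r % 4 → r < 4 * l + 2 → s'.reg r = s.reg r := by
  induction P with
  | skip =>
    refine ⟨0, 1, fun {n W σ s l} hG _ _ => (Exec.skip ⟨hG, fun _ _ _ => rfl⟩).mono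
      (by simp [Stmt.deg]) fun _ h => h⟩
  | asg x e =>
    obtain ⟨c, T, ih⟩ := e.spec
    refine ⟨c + 6, T + (2 + 2), fun {n W σ s l} hG _ hW =>
      Exec.mono (T := T + (2 + 2)) ?_ (by simp [Stmt.deg]) fun _ h => h⟩
    have hcap : cap n ≤ W := (base_pow_mono n (by omega)).trans hW
    refine Exec.seq ((ih hG ((base_pow_mono n (by omega)).trans hW)).2 0 _ ?_)
    intro s1 hm1 hr1 hs1
    have hG1 := hG.congr hm1 fun r hr => hs1 r (by omega)
    refine Exec.seq (Exec.clampP (hG.pos.trans_le ?_) hG1.cap ?_)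
    · exact (Nat.le_of_lt ((by simp : n < (n + 2) ^ 1))).trans
        ((base_pow_mono n (by omega)).trans hW)
    intro s2 hm2 hr2 hs2
    rw [hr1] at hr2
    refine Exec.mov (by omega) ?_ ?_
    · exact hr2 ▸ (clamp_lt_cap n _).trans_le hcap
    intro s3 hm3 hr3 hs3
    refine ⟨hG1.setV (hm3.trans hm2) (hr3.trans hr2) fun r hr hrx => ?_, fun r hr _ => ?_⟩
    · rw [hs3 r hrx, hs2 r (by omega)]
    · rw [hs3 r (by omega), hs2 r (by omega), hs1 r (by omega)]
  | putLo i e =>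
    obtain ⟨c1, T1, ih1⟩ := i.spec
    obtain ⟨c2, T2, ih2⟩ := e.spec
    refine ⟨c1 + c2 + 1, T1 + (3 + (T2 + (2 + 1))), fun {n W σ s l} hG _ hW =>
      Exec.mono (T := T1 + (3 + (T2 + (2 + 1)))) ?_ (by simp [Stmt.deg]) fun _ h => h⟩
    have hp := hG.pos
    obtain ⟨hb1, ih1⟩ := ih1 hG ((base_pow_mono n (by omega)).trans hW)
    refine Exec.seq (ih1 0 _ ?_)
    intro s1 hm1 hr1 hs1
    have hG1 := hG.congr hm1 fun r hr => hs1 r (by omega)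
    refine Exec.seq (Exec.modP (n := n) ?_ hG1.two ?_)
    · rw [hr1]
      exact hb1.trans_le ((base_pow_mono n (by omega)).trans hW)
    intro s2 hm2 hr2 hs2
    rw [hr1] at hr2
    have hG2 := hG1.congr hm2 fun r hr => hs2 r (by omega) (by omega)
    refine Exec.seq ((ih2 hG2 ((base_pow_mono n (by omega)).trans hW)).2 1 _ ?_)
    intro s3 hm3 hr3 hs3
    have hG3 := hG2.congr hm3 fun r hr => hs3 r (by omega)
    refine Exec.seq (Exec.clampP (hp.trans_le ?_) hG3.cap ?_)
    · exact (Nat.le_of_lt ((by simp : n < (n + 2) ^ 1))).trans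
        ((base_pow_mono n (by omega)).trans hW)
    intro s4 hm4 hr4 hs4
    rw [hr3] at hr4
    have hG4 := hG3.congr hm4 fun r hr => hs4 r (by omega)
    have h1 : s4.reg 1 = i.ev n σ % (2 * n) := by
      rw [hs4 1 (by omega), hs3 1 (by omega)]; exact hr2
    refine Exec.store ⟨hG4.setLo (Nat.mod_lt _ (by omega)) ?_ rfl, fun r hr _ => ?_⟩
    · simp only [State.setMem, h1, ← hr4]
    · change s4.reg r = _
      rw [hs4 r (by omega), hs3 r (by omega), hs2 r (by omega) (by omega), hs1 r (by omega)]
  | put b i j k e =>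
    obtain ⟨c1, T1, ih1⟩ := Ex.Spec.addrOf i.spec j.spec k.spec b
    obtain ⟨c2, T2, ih2⟩ := e.spec
    refine ⟨c1 + c2 + 1, T1 + (T2 + (2 + 1)), fun {n W σ s l} hG _ hW =>
      Exec.mono (T := T1 + (T2 + (2 + 1))) ?_ (by simp [Stmt.deg]) fun _ h => h⟩
    have hp := hG.pos
    refine Exec.seq (ih1 hG ((base_pow_mono n (by omega)).trans hW) 0 _ ?_)
    intro s2 hm2 hr2 hs2
    have hG2 := hG.congr hm2 fun r hr => hs2 r (by omega)
    refine Exec.seq ((ih2 hG2 ((base_pow_mono n (by omega)).trans hW)).2 1 _ ?_)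
    intro s3 hm3 hr3 hs3
    have hG3 := hG2.congr hm3 fun r hr => hs3 r (by omega)
    refine Exec.seq (Exec.clampP (hp.trans_le ?_) hG3.cap ?_)
    · exact (Nat.le_of_lt ((by simp : n < (n + 2) ^ 1))).trans
        ((base_pow_mono n (by omega)).trans hW)
    intro s4 hm4 hr4 hs4
    rw [hr3] at hr4
    have hG4 := hG3.congr hm4 fun r hr => hs4 r (by omega)
    have h1 : s4.reg 1 = addr n b (i.ev n σ) (j.ev n σ) (k.ev n σ) := by
      rw [hs4 1 (by omega), hs3 1 (by omega)]; exact hr2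
    refine Exec.store ⟨hG4.setA ?_ rfl, fun r hr _ => ?_⟩
    · simp only [State.setMem, h1, ← hr4]
    · change s4.reg r = _
      rw [hs4 r (by omega), hs3 r (by omega), hs2 r (by omega)]
  | seq P Q ihP ihQ =>
    obtain ⟨c1, K1, ih1⟩ := ihP
    obtain ⟨c2, K2, ih2⟩ := ihQ
    refine ⟨c1 + c2, K1 + K2, fun {n W σ s l} hG hl hW => ?_⟩
    have hp := hG.pos
    have e1 : K1 * n ^ P.deg ≤ K1 * n ^ max P.deg Q.deg :=
      Nat.mul_le_mul_left _ (Nat.pow_le_pow_right hp (by omega))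
    have e2 : K2 * n ^ Q.deg ≤ K2 * n ^ max P.deg Q.deg :=
      Nat.mul_le_mul_left _ (Nat.pow_le_pow_right hp (by omega))
    refine Exec.mono (Exec.seq ((ih1 hG hl ((base_pow_mono n (by omega)).trans hW)).mono e1 ?_))
      (by simp only [Stmt.deg]; rw [Nat.add_mul]) fun _ h => h
    intro s1 ⟨hG1, hs1⟩
    refine (ih2 hG1 hl ((base_pow_mono n (by omega)).trans hW)).mono e2 ?_
    intro s2 ⟨hG2, hs2⟩
    exact ⟨hG2, fun r hr hr' => (hs2 r hr hr').trans (hs1 r hr hr')⟩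
  | ite e f P Q ihP ihQ =>
    obtain ⟨c1, K1, ih1⟩ := ihP
    obtain ⟨c2, K2, ih2⟩ := ihQ
    obtain ⟨c3, T3, ih3⟩ := e.spec
    obtain ⟨c4, T4, ih4⟩ := f.spec
    refine ⟨c1 + c2 + c3 + c4, T3 + T4 + 1 + K1 + K2, fun {n W σ s l} hG hl hW => ?_⟩
    have hp := hG.pos
    have e1 : K1 * n ^ P.deg ≤ K1 * n ^ max P.deg Q.deg :=
      Nat.mul_le_mul_left _ (Nat.pow_le_pow_right hp (by omega))
    have e2 : K2 * n ^ Q.deg ≤ K2 * n ^ max P.deg Q.deg :=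
      Nat.mul_le_mul_left _ (Nat.pow_le_pow_right hp (by omega))
    have e3 : 1 ≤ n ^ max P.deg Q.deg := Nat.one_le_pow _ _ hp
    have e4 : T3 + (T4 + ((K1 + K2) * n ^ max P.deg Q.deg + 1)) ≤
        (T3 + T4 + 1 + K1 + K2) * n ^ max P.deg Q.deg := by
      have : (T3 + T4 + 1) * 1 ≤ (T3 + T4 + 1) * n ^ max P.deg Q.deg :=
        Nat.mul_le_mul_left _ e3
      nlinarith
    refine Exec.mono ?_ e4 fun _ h => h
    refine Exec.seq ((ih3 hG ((base_pow_mono n (by omega)).trans hW)).2 0 _ ?_)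
    intro s1 hm1 hr1 hs1
    have hG1 := hG.congr hm1 fun r hr => hs1 r (by omega)
    refine Exec.seq ((ih4 hG1 ((base_pow_mono n (by omega)).trans hW)).2 1 _ ?_)
    intro s2 hm2 hr2 hs2
    have hG2 := hG1.congr hm2 fun r hr => hs2 r (by omega)
    have hr1' : s2.reg 1 = e.ev n σ := by rw [hs2 1 (by omega)]; exact hr1
    have hr2' : s2.reg 5 = f.ev n σ := hr2
    refine Exec.ifLt (fun hlt => ?_) (fun hlt => ?_)
    · rw [hr1', hr2'] at hlt
      refine (ih1 hG2 hl ((base_pow_mono n (by omega)).trans hW)).mono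
        (by rw [Nat.add_mul]; omega) ?_
      intro s3 ⟨hG3, hs3⟩
      refine ⟨by simpa [Stmt.run, hlt] using hG3, fun r hr hr' => ?_⟩
      rw [hs3 r hr hr', hs2 r (by omega), hs1 r (by omega)]
    · rw [hr1', hr2'] at hlt
      refine (ih2 hG2 hl ((base_pow_mono n (by omega)).trans hW)).mono
        (by rw [Nat.add_mul]; omega) ?_
      intro s3 ⟨hG3, hs3⟩
      refine ⟨by simpa [Stmt.run, hlt] using hG3, fun r hr hr' => ?_⟩
      rw [hs3 r hr hr', hs2 r (by omega), hs1 r (by omega)]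
  | loop x d e P ih =>
    obtain ⟨c1, K1, ih1⟩ := ih
    obtain ⟨c2, T2, ih2⟩ := e.spec
    refine ⟨c1 + c2 + d + 6, T2 + d + K1 + 16, fun {n W σ s l} hG hl hW => ?_⟩
    have hp := hG.pos
    obtain ⟨M, hM⟩ : ∃ M, M = min (e.ev n σ) (n ^ d) := ⟨_, rfl⟩
    have hMd : M ≤ n ^ d := by omega
    have hdW : n ^ d < W := by
      calc n ^ d ≤ (n + 2) ^ d := Nat.pow_le_pow_left (by omega) d
        _ < (n + 2) ^ (d + 1) := Nat.pow_lt_pow_right (by omega) (by omega)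
        _ ≤ _ := (base_pow_mono n (by omega)).trans hW
    have hd1 : 1 ≤ n ^ d := Nat.one_le_pow _ _ hp
    have hcap : cap n ≤ W := (base_pow_mono n (by omega)).trans hW
    -- The step count of the code, bracketed as `Exec.seq` produces it: at most `n ^ d` rounds, each
    -- taking the time of the body plus a constant.
    have hT : T2 + (1 + ((d + 1) + ((2 + 1) + (1 + (M * ((2 + (2 + (2 + (K1 * n ^ P.deg +
        (1 + 1))))) + 1) + 1))))) ≤ (T2 + d + K1 + 16) * n ^ (d + P.deg) := by
      have e3 : 1 ≤ n ^ P.deg := Nat.one_le_pow _ _ hp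
      have e4 : 1 ≤ n ^ d * n ^ P.deg := Nat.mul_pos (by omega) (by omega)
      have e5 : M * (K1 * n ^ P.deg + 9) ≤ n ^ d * ((K1 + 9) * n ^ P.deg) :=
        Nat.mul_le_mul hMd (by nlinarith)
      rw [pow_add]
      have e6 : (T2 + d + 7) * 1 ≤ (T2 + d + 7) * (n ^ d * n ^ P.deg) :=
        Nat.mul_le_mul_left _ e4
      nlinarith
    refine Exec.mono ?_ hT fun _ h => h
    obtain ⟨hb2, ih2⟩ := ih2 hG ((base_pow_mono n (by omega)).trans hW)
    have hb2 := hb2.trans_le ((base_pow_mono n (show c2 ≤ c1 + c2 + d + 6 by omega)).trans hW)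
    refine Exec.seq (ih2 0 _ ?_)
    intro s1 hm1 hr1 hs1
    refine Exec.seq (Exec.const (by omega) (Exec.seq (Exec.powP (n := n) (by omega) ?_ ?_ d _
      ((base_pow_mono n (by omega)).trans hW) ?_)))
    · simp [State.setReg]
    · simp only [State.setReg]
      rw [Function.update_of_ne (by omega), hs1 3 (by omega), hG.len]
    intro s2 hm2 hr2 hs2
    have hs2' : ∀ r, r % 4 ≠ 1 → s2.reg r = s.reg r := fun r hr => by
      rw [hs2 r (by omega)]
      simp only [State.setReg]
      rw [Function.update_of_ne (by omega), hs1 r (by omega)]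
    have hr1' : s2.reg 1 = e.ev n σ := by
      rw [hs2 1 (by omega)]
      simp only [State.setReg]
      rw [Function.update_of_ne (by omega)]
      exact hr1
    have hlim : Exec W (.ifLt 1 5 (mov (4 * l + 3) 1) (mov (4 * l + 3) 5)) s2 (2 + 1)
        fun s3 => s3.mem = s.mem ∧ s3.reg (4 * l + 3) = M ∧
          ∀ r, r % 4 ≠ 1 → r ≠ 4 * l + 3 → s3.reg r = s.reg r := by
      refine Exec.ifLt (fun hlt => Exec.mov (by omega) (by omega) ?_)
        (fun hlt => Exec.mov (by omega) (by omega) ?_)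
      · intro s3 hm3 hr3 hs3
        refine ⟨hm3.trans (hm2.trans hm1), by omega, fun r h1 h2 => ?_⟩
        rw [hs3 r (by omega), hs2' r h1]
      · intro s3 hm3 hr3 hs3
        refine ⟨hm3.trans (hm2.trans hm1), by omega, fun r h1 h2 => ?_⟩
        rw [hs3 r (by omega), hs2' r h1]
    refine Exec.seq (hlim.mono le_rfl ?_)
    intro s3 ⟨hm3, hr3, hs3⟩
    refine Exec.seq (Exec.const (by omega) ?_)
    -- The state represents the store after `m` rounds. The last clause protects the control
    -- registers of the enclosing loops, which have smaller numbers.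
    let I : ℕ → State → Prop := fun m s' =>
      Good n (iter (fun i τ => P.run n (τ.setV x (clamp n i))) m σ) s' ∧
      s'.reg (4 * l + 2) = m ∧ s'.reg (4 * l + 3) = M ∧
      ∀ r, 2 ≤ r % 4 → r < 4 * l + 2 → s'.reg r = s.reg r
    refine (Exec.whileLt I (fun m s h => ⟨h.2.1, h.2.2.1⟩) ?_ M 0 _ (by omega) ?_).mono le_rfl
      fun s' h => ?_
    · intro m t hm ⟨hGt, hrt, hlt, hst⟩
      refine Exec.seq (Exec.mov (by omega) (by omega) ?_)
      intro t1 hm1 hr1 hs1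
      have hG1 := hGt.congr hm1 fun r hr => hs1 r (by omega)
      refine Exec.seq (Exec.clampP (by omega) hG1.cap ?_)
      intro t2 hm2 hr2 hs2
      have hr2' : t2.reg 1 = clamp n m := by rw [← hrt, ← hr1]; exact hr2
      refine Exec.seq (Exec.mov (by omega) ?_ ?_)
      · rw [hr2']
        exact (clamp_lt_cap n _).trans_le hcap
      intro t3 hm3 hr3 hs3
      have hG3 : Good n _ t3 := hG1.setV (x := x) (w := m) (hm3.trans hm2) (hr3.trans hr2')
        fun r hr hrx => by rw [hs3 r hrx, hs2 r (by omega)]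
      refine Exec.seq ((ih1 (l := l + 1) hG3 (by omega)
        ((base_pow_mono n (by omega)).trans hW)).mono le_rfl ?_)
      intro t4 ⟨hG4, hs4⟩
      have hs : ∀ r, 2 ≤ r % 4 → r < 4 * (l + 1) + 2 → t4.reg r = t.reg r := fun r h1 h2 => by
        rw [hs4 r h1 h2, hs3 r (by omega), hs2 r (by omega), hs1 r (by omega)]
      refine Exec.seq (Exec.const (by omega) ?_)
      have e1 : Op.add.eval ((t4.setReg 1 1).reg (4 * l + 2)) ((t4.setReg 1 1).reg 1) =
          m + 1 := by
        simp only [State.setReg, Op.eval, Function.update_self]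
        rw [Function.update_of_ne (by omega), hs _ (by omega) (by omega), hrt]
      refine Exec.arith (by omega) ?_
      rw [e1]
      refine ⟨hG4.congr rfl fun r hr => ?_, ?_, ?_, fun r h1 h2 => ?_⟩
      · simp only [State.setReg]
        rw [Function.update_of_ne (by omega), Function.update_of_ne (by omega)]
      · simp [State.setReg]
      · simp only [State.setReg]
        rw [Function.update_of_ne (by omega), Function.update_of_ne (by omega),
          hs _ (by omega) (by omega), hlt]
      · simp only [State.setReg]
        rw [Function.update_of_ne (by omega), Function.update_of_ne (by omega),
          hs _ (by omega) (by omega), hst r h1 h2]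
    · refine ⟨hG.congr hm3 fun r hr => ?_, ?_, ?_, fun r h1 h2 => ?_⟩
      · simp only [State.setReg]
        rw [Function.update_of_ne (by omega), hs3 r (by omega) (by omega)]
      · simp [State.setReg]
      · simp only [State.setReg]
        rw [Function.update_of_ne (by omega), hr3]
      · simp only [State.setReg]
        rw [Function.update_of_ne (by omega), hs3 r (by omega) (by omega)]
    · obtain ⟨hG', -, -, hs'⟩ := h
      refine ⟨?_, hs'⟩
      rw [hM] at hG'
      exact hG'

/-! ### From statements to RAM programs. -/

/-- The store that holds the input. -/
def startStore (w : ℕ → ℕ) : Store where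
  v _ := 0
  lo := w
  a _ _ _ _ := 0

/-- Code that fills the reserved registers. -/
def prologue : Prog :=
  .seq (.load 3 1) (.seq (.arith .add 2 3 3) (.seq (.const 1 2) (.seq (.arith .add 1 1 3)
    (.seq (.arith .mul 5 1 1) (.seq (.arith .mul 5 5 1) (.seq (.arith .mul 6 5 5) .skip))))))

/-- Every statement is computed by a word RAM program, in time `O(n ^ deg)`. -/
theorem Stmt.exists_prog (P : Stmt) : ∃ (R : Prog) (c K : ℕ), ∀ (n : ℕ) (s : State),
    0 < n → s.mem 0 = n → (∀ r, s.reg r = 0) → (∀ i, s.mem i ≤ n) →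
    (∀ i, 2 * n ≤ i → s.mem i = 0) →
    ∃ t s', Runs ((n + 2) ^ c) R s t s' ∧ t ≤ K * n ^ P.deg ∧
      ∀ i < 2 * n, s'.mem i = (P.run n (startStore s.mem)).lo i := by
  obtain ⟨c, K, h⟩ := P.spec
  -- Depth 2 keeps the loop registers away from 2, 3 and 6. The prologue takes 8 steps and computes
  -- `(n + 2) ^ 6`, which has to stay strictly below the word bound, hence the 7.
  refine ⟨.seq prologue (P.comp 2), c + 7, 8 + K, fun n s hp h0 hr hle hz => ?_⟩
  have hn7 : (n + 2) ^ 7 ≤ (n + 2) ^ (c + 7) := base_pow_mono n (by omega)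
  have e1 : (n + 2) * (n + 2) * (n + 2) * ((n + 2) * (n + 2) * (n + 2)) < (n + 2) ^ (c + 7) := by
    refine lt_of_lt_of_le ?_ hn7
    calc _ = (n + 2) ^ 6 := by ring
      _ < _ := Nat.pow_lt_pow_right (by omega) (by omega)
  have e2 : (n + 2) * (n + 2) * (n + 2) < (n + 2) ^ (c + 7) := by
    refine lt_of_lt_of_le ?_ hn7
    calc _ = (n + 2) ^ 3 := by ring
      _ < _ := Nat.pow_lt_pow_right (by omega) (by omega)
  have e3 : (n + 2) * (n + 2) < (n + 2) ^ (c + 7) := by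
    refine lt_of_lt_of_le ?_ hn7
    calc _ = (n + 2) ^ 2 := by ring
      _ < _ := Nat.pow_lt_pow_right (by omega) (by omega)
  have e4 : n + n < (n + 2) ^ (c + 7) := lt_of_le_of_lt (by nlinarith) e3
  have e5 : n + 2 < (n + 2) ^ (c + 7) := lt_of_le_of_lt (by nlinarith) e3
  have hcap : n < cap n := by
    calc n < (n + 2) ^ 1 := by simp
      _ ≤ _ := base_pow_mono n (by omega)
  have hcap0 : 0 < cap n := by omega
  have hE : Exec ((n + 2) ^ (c + 7)) (.seq prologue (P.comp 2)) s (8 + K * n ^ P.deg)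
      fun s' => ∀ i < 2 * n, s'.mem i = (P.run n (startStore s.mem)).lo i := by
    refine Exec.seq (T := 8) (Exec.mono (T := 1 + (1 + (1 + (1 + (1 + (1 + (1 + 1)))))))
      ?_ le_rfl fun _ h => h)
    unfold prologue
    refine Exec.seq (Exec.load ?_ (Exec.seq (Exec.arith ?_ (Exec.seq (Exec.const ?_
      (Exec.seq (Exec.arith ?_ (Exec.seq (Exec.arith ?_ (Exec.seq (Exec.arith ?_
        (Exec.seq (Exec.arith ?_ (Exec.skip ?_))))))))))))))
    all_goals try simp [State.setReg, Op.eval, hr, h0, add_comm 2 n]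
    any_goals omega
    refine (h (n := n) (l := 2) (σ := startStore s.mem) ⟨hp, ?_, ?_, ?_, ?_, ?_, ?_, ?_, ?_, ?_⟩
      le_rfl (base_pow_mono n (by omega))).mono le_rfl ?_
    · intro x
      have h1 : 4 * x.ctorIdx ≠ 6 ∧ 4 * x.ctorIdx ≠ 5 ∧ 4 * x.ctorIdx ≠ 1 ∧
        4 * x.ctorIdx ≠ 2 ∧ 4 * x.ctorIdx ≠ 3 := by omega
      simp [h1, startStore, hr]
    · simp
    · simp; omega
    · simp [cap]; ring
    · simp [startStore]
    · intro b i j k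
      simp only [startStore]
      exact hz _ (by unfold addr; omega)
    · intro x; exact hcap0
    · intro i _; exact (hle i).trans_lt hcap
    · intro _ _ _ _; exact hcap0
    · intro s' ⟨hG, _⟩ i hi
      exact hG.lo i hi
  obtain ⟨t, s', h1, h2, h3⟩ := hE
  refine ⟨t, s', h1, h2.trans ?_, h3⟩
  have : 1 ≤ n ^ P.deg := Nat.one_le_pow _ _ hp
  nlinarith

end LoopLang

namespace Surprise

/-! ### The hypergeometric tail -/

/-- The numerator of the hypergeometric tail. -/
def tailNum (p m ip ie : ℕ) : ℕ := ∑ i ∈ Finset.Icc ie m, ip.choose i * (p - ip).choose (m - i)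

lemma hyperTail_eq (p m ip ie : ℕ) : hyperTail p m ip ie = tailNum p m ip ie / p.choose m := by
  unfold hyperTail tailNum
  rw [← Finset.sum_div]
  push_cast
  rfl

lemma hyperTail_le_of_tailNum_le {p m ip ie ip' ie' : ℕ}
    (h : tailNum p m ip ie ≤ tailNum p m ip' ie') :
    hyperTail p m ip ie ≤ hyperTail p m ip' ie' := by
  rw [hyperTail_eq, hyperTail_eq]
  exact div_le_div_of_nonneg_right (by exact_mod_cast h) (by positivity)

/-- When one more pair is counted as intracluster, the `m`-subsets that newly enter the tail are
those that contain this pair and have one element too few among the old `ip` pairs. The induction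
lowers the start `m - e` of the tail. -/
lemma tailNum_succ_add (r ip m : ℕ) : ∀ e ≤ m,
    tailNum (ip + 1 + r) m (ip + 1) (m - e) =
      tailNum (ip + 1 + r) m ip (m - e) +
        (if m - e = 0 then 0 else ip.choose (m - e - 1) * r.choose e) := by
  have h1 : ip + 1 + r - (ip + 1) = r := by omega
  have h2 : ip + 1 + r - ip = r + 1 := by omega
  intro e
  induction e with
  | zero =>
    intro _
    simp only [tailNum, h1, h2, Nat.sub_zero, Finset.Icc_self, Finset.sum_singleton,
      Nat.sub_self, Nat.choose_zero_right, mul_one]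
    cases m with
    | zero => simp
    | succ m => simp [Nat.choose_succ_succ]; ring
  | succ e ih =>
    intro he
    have ih := ih (by omega)
    obtain ⟨x, hx⟩ : ∃ x, m - e = x + 1 := ⟨m - e - 1, by omega⟩
    have hx' : m - (e + 1) = x := by omega
    have hmx : m - x = e + 1 := by omega
    rw [hx] at ih
    rw [hx']
    have hI : Finset.Icc x m = insert x (Finset.Icc (x + 1) m) := by
      ext y; simp only [Finset.mem_Icc, Finset.mem_insert]; omega
    unfold tailNum at ih ⊢
    rw [hI, Finset.sum_insert (by simp), Finset.sum_insert (by simp), ih, h1, h2, hmx]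
    cases x with
    | zero => simp [Nat.choose_succ_succ]; ring
    | succ x => simp [Nat.choose_succ_succ]; ring

/-- The increment in `tailNum_succ_add` is nonnegative. This is why, for a given number of kept
edges, fewer pairs are better. -/
lemma tailNum_mono {p m ip ip' : ℕ} (ie : ℕ) (h : ip ≤ ip') (hp : ip' ≤ p) :
    tailNum p m ip ie ≤ tailNum p m ip' ie := by
  induction ip', h using Nat.le_induction with
  | base => exact le_rfl
  | succ k hk ih =>
    refine (ih (by omega)).trans ?_
    by_cases hm : ie ≤ m
    · have := tailNum_succ_add (p - (k + 1)) k m (m - ie) (by omega)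
      rw [show k + 1 + (p - (k + 1)) = p by omega, show m - (m - ie) = ie by omega] at this
      omega
    · simp [tailNum, Finset.Icc_eq_empty hm]

/-! ### Tails as entries of a modified Pascal triangle. -/

/-- One step in Pascal's triangle. -/
def pascalStep (R : ℕ → ℕ) : ℕ → ℕ
  | 0 => R 0
  | j + 1 => R (j + 1) + R j

/-- In terms of generating functions, `y` steps multiply by `(1 + X) ^ y`. -/
lemma pascalStep_iterate (R : ℕ → ℕ) (y j : ℕ) :
    pascalStep^[y] R j = ∑ i ∈ Finset.range (j + 1), y.choose (j - i) * R i := by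
  induction y generalizing j with
  | zero =>
    rw [Finset.sum_eq_single_of_mem j (by simp)]
    · simp
    · intro i hi hij
      rw [Finset.mem_range] at hi
      rw [Nat.choose_eq_zero_of_lt (by omega), zero_mul]
  | succ y ih =>
    rw [Function.iterate_succ_apply']
    cases j with
    | zero => simp [pascalStep, ih]
    | succ j =>
      simp only [pascalStep, ih]
      rw [Finset.sum_range_succ _ (j + 1), Finset.sum_range_succ _ (j + 1)]
      have : ∑ i ∈ Finset.range (j + 1), (y + 1).choose (j + 1 - i) * R i =
          ∑ i ∈ Finset.range (j + 1), y.choose (j + 1 - i) * R i +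
            ∑ i ∈ Finset.range (j + 1), y.choose (j - i) * R i := by
        rw [← Finset.sum_add_distrib]
        refine Finset.sum_congr rfl fun i hi => ?_
        rw [Finset.mem_range] at hi
        rw [show j + 1 - i = j - i + 1 by omega, Nat.choose_succ_succ]
        ring
      rw [this]
      simp
      ring

/-- The first row of Pascal's triangle. -/
def pascalZero : ℕ → ℕ := fun j => if j = 0 then 1 else 0

lemma pascalStep_iterate_zero (x : ℕ) : pascalStep^[x] pascalZero = x.choose := by
  funext j
  rw [pascalStep_iterate, Finset.sum_eq_single_of_mem 0 (by simp)]
  · simp [pascalZero]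
  · intro i _ hi
    simp [pascalZero, hi]

/-- Pascal steps preserve domination by the true triangle. This bounds all intermediate numbers
after rows have been erased, so that `n` digits suffice. -/
lemma pascalStep_iterate_le {R : ℕ → ℕ} {x : ℕ} (hR : ∀ j, R j ≤ x.choose j) (y j : ℕ) :
    pascalStep^[y] R j ≤ (x + y).choose j := by
  induction y generalizing j with
  | zero => exact hR j
  | succ y ih =>
    rw [Function.iterate_succ_apply']
    cases j with
    | zero => simpa [pascalStep] using ih 0
    | succ j =>
      have h1 := ih j
      have h2 := ih (j + 1)
      rw [← add_assoc, Nat.choose_succ_succ']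
      simp only [pascalStep]
      omega

/-- Row `ip` of Pascal's triangle with the entries below `ie` erased. -/
def cutRow (ip ie : ℕ) : ℕ → ℕ := fun j => if j < ie then 0 else ip.choose j

/-- The restriction to `i ≥ ie` concerns only the factor `ip.choose i`. It can be imposed once on
row `ip`, before the remaining `p - ip` steps perform the convolution. -/
lemma tailNum_eq_pascalStep (p m ip ie : ℕ) :
    tailNum p m ip ie = pascalStep^[p - ip] (cutRow ip ie) m := by
  rw [pascalStep_iterate, tailNum]
  have : Finset.Icc ie m = (Finset.range (m + 1)).filter (fun i => ¬ i < ie) := by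
    ext i; simp only [Finset.mem_Icc, Finset.mem_filter, Finset.mem_range]; omega
  rw [this, Finset.sum_filter]
  refine Finset.sum_congr rfl fun i _ => ?_
  unfold cutRow
  by_cases h : i < ie <;> simp [h, mul_comm]

lemma cutRow_le (ip ie j : ℕ) : cutRow ip ie j ≤ ip.choose j := by
  unfold cutRow; split_ifs <;> simp

/-! ### Pairs of vertices -/

section Pairs
variable {V : Type*} [Fintype V] [DecidableEq V]

/-- A cluster of size `c` has `c ^ 2 = 2 * c.choose 2 + c` ordered pairs, the diagonal included.
Ordered pairs depend only on the relation of lying in one part, which makes them easy to compare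
between clusterings. -/
lemma two_mul_intraPairs_add (ζ : Finpartition (Finset.univ : Finset V)) :
    2 * intraPairs ζ + Fintype.card V =
      (Finset.univ.filter fun q : V × V => ζ.part q.1 = ζ.part q.2).card := by
  have h1 : ∀ C : Finset V, 2 * C.card.choose 2 + C.card = C.card * C.card := by
    intro C
    rw [Nat.choose_two_right, Nat.mul_div_cancel' (Nat.even_mul_pred_self _).two_dvd]
    cases C.card with
    | zero => rfl
    | succ k => simp; ring
  have h2 : Fintype.card V = ∑ C ∈ ζ.parts, C.card := by
    rw [ζ.sum_card_parts, Finset.card_univ]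
  rw [h2, intraPairs, Finset.mul_sum, ← Finset.sum_add_distrib]
  have h3 : (Finset.univ.filter fun q : V × V => ζ.part q.1 = ζ.part q.2) =
      ζ.parts.biUnion fun C => C ×ˢ C := by
    ext ⟨u, v⟩
    simp only [Finset.mem_filter, Finset.mem_univ, true_and, Finset.mem_biUnion,
      Finset.mem_product]
    constructor
    · intro h
      exact ⟨ζ.part u, ζ.part_mem.2 (Finset.mem_univ u), ζ.mem_part (Finset.mem_univ u),
        h ▸ ζ.mem_part (Finset.mem_univ v)⟩
    · rintro ⟨C, hC, hu, hv⟩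
      rw [ζ.part_eq_of_mem hC hu, ζ.part_eq_of_mem hC hv]
  rw [h3, Finset.card_biUnion]
  · refine Finset.sum_congr rfl fun C _ => ?_
    rw [h1, Finset.card_product]
  · intro C hC D hD hne
    rw [Function.onFun, Finset.disjoint_left] 
    rintro ⟨u, v⟩ h h'
    simp only [Finset.mem_product] at h h'
    exact hne ((ζ.part_eq_of_mem hC h.1).symm.trans (ζ.part_eq_of_mem hD h'.1))

lemma intraPairs_le_of_refines {ζ ξ : Finpartition (Finset.univ : Finset V)}
    (h : ∀ u v, ζ.part u = ζ.part v → ξ.part u = ξ.part v) : intraPairs ζ ≤ intraPairs ξ := by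
  have h1 := two_mul_intraPairs_add ζ
  have h2 := two_mul_intraPairs_add ξ
  have h3 : (Finset.univ.filter fun q : V × V => ζ.part q.1 = ζ.part q.2).card ≤
      (Finset.univ.filter fun q : V × V => ξ.part q.1 = ξ.part q.2).card := by
    refine Finset.card_le_card fun q hq => ?_
    simp only [Finset.mem_filter, Finset.mem_univ, true_and] at hq ⊢
    exact h _ _ hq
  omega

lemma intraPairs_le_choose (ζ : Finpartition (Finset.univ : Finset V)) :
    intraPairs ζ ≤ (Fintype.card V).choose 2 := by
  have h1 := two_mul_intraPairs_add ζ
  have h2 : (Finset.univ.filter fun q : V × V => ζ.part q.1 = ζ.part q.2).card ≤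
      Fintype.card V * Fintype.card V := by
    rw [← Fintype.card_prod]
    exact Finset.card_le_univ _
  rw [Nat.choose_two_right, Nat.le_div_iff_mul_le (by omega)]
  cases h : Fintype.card V with
  | zero => rw [h] at h1 h2; omega
  | succ k => rw [h] at h1 h2; simp only [Nat.add_sub_cancel]; nlinarith

end Pairs

/-! ### Contracting a tree edge by edge -/

/-- The edges `{par i, child i}` are listed from the root `0` of a tree on `0, …, n - 1`
downwards. -/
structure EdgeOrder (n : ℕ) (par child : ℕ → ℕ) : Prop where
  pos : 0 < n
  child_lt : ∀ i < n - 1, child i < n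
  child_ne : ∀ i < n - 1, child i ≠ 0
  child_inj : ∀ i < n - 1, ∀ j < n - 1, child i = child j → i = j
  par_mem : ∀ i < n - 1, par i = 0 ∨ ∃ j < i, par i = child j
  cover : ∀ v < n, v = 0 ∨ ∃ i < n - 1, v = child i

section
variable {n : ℕ} {par child : ℕ → ℕ}

lemma EdgeOrder.par_lt (h : EdgeOrder n par child) {i : ℕ} (hi : i < n - 1) : par i < n := by
  rcases h.par_mem i hi with h1 | ⟨j, hj, h1⟩
  · rw [h1]; exact h.pos
  · rw [h1]; exact h.child_lt j (by omega)

/-- The parent of an edge is reached strictly before it, whereas `child j` is reached only by edge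
`j`. -/
lemma EdgeOrder.par_ne_child (h : EdgeOrder n par child) {i j : ℕ} (hij : i ≤ j)
    (hj : j < n - 1) : par i ≠ child j := by
  intro he
  rcases h.par_mem i (by omega) with h1 | ⟨k, hk, h1⟩
  · exact h.child_ne j hj (he.symm.trans h1)
  · have := h.child_inj k (by omega) j hj (h1.symm.trans he)
    omega

/-- The vertices that are not below the edges `i, i + 1, …`. -/
def Live (child : ℕ → ℕ) (i v : ℕ) : Prop := v = 0 ∨ ∃ j < i, v = child j

lemma Live.mono {i j v : ℕ} (h : Live child i v) (hij : i ≤ j) : Live child j v := by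
  rcases h with h | ⟨k, hk, h⟩
  · exact .inl h
  · exact .inr ⟨k, by omega, h⟩

lemma Live.of_succ {i v : ℕ} (h : Live child (i + 1) v) (hv : v ≠ child i) :
    Live child i v := by
  rcases h with h | ⟨k, hk, h⟩
  · exact .inl h
  · refine .inr ⟨k, ?_, h⟩
    rcases Nat.lt_succ_iff_lt_or_eq.1 hk with hk | rfl
    · exact hk
    · exact absurd h hv

lemma EdgeOrder.live_ne (h : EdgeOrder n par child) {i j v : ℕ} (hv : Live child i v)
    (hij : i ≤ j) (hj : j < n - 1) : v ≠ child j := by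
  rintro rfl
  rcases hv with h1 | ⟨k, hk, h1⟩
  · exact h.child_ne j hj h1
  · have := h.child_inj j hj k (by omega) h1
    omega

/-- For each vertex, the size of its cluster, and the numbers of kept edges and of intracluster
pairs among the vertices contracted into it. -/
structure Contraction where
  size : ℕ → ℕ
  kept : ℕ → ℕ
  cost : ℕ → ℕ

/-- Contract the edge from `p` to `c`, which is kept if `f = 1` and cut if `f = 0`. -/
def Contraction.merge (x : Contraction) (p c f : ℕ) : Contraction where
  size v := if v = c then 0 else if v = p then x.size p + f * x.size c else x.size v
  kept v := if v = c then 0 else if v = p then x.kept p + x.kept c + f else x.kept v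
  cost v := if v = c then 0 else if v = p then
    x.cost p + x.cost c + f * (x.size p * x.size c) else x.cost v

/-- The result of contracting the last `t` edges. -/
def contract (n : ℕ) (par child f : ℕ → ℕ) : ℕ → Contraction
  | 0 => ⟨fun _ => 1, fun _ => 0, fun _ => 0⟩
  | t + 1 => (contract n par child f t).merge (par (n - 2 - t)) (child (n - 2 - t))
      (f (n - 2 - t))

/-- Subtraction-free bookkeeping: the two overwritten values stand on the left, the new value on the
right. -/
lemma sum_merge {p c : ℕ} (g : ℕ → ℕ) (X : ℕ) (hp : p < n) (hc : c < n) (hpc : p ≠ c) :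
    ∑ v ∈ Finset.range n, (if v = c then 0 else if v = p then X else g v) + (g p + g c) =
      ∑ v ∈ Finset.range n, g v + X := by
  have h1 : ∀ v, (if v = c then 0 else if v = p then X else g v) +
      ((if v = p then g p else 0) + (if v = c then g c else 0)) =
      g v + (if v = p then X else 0) := by
    intro v
    by_cases h : v = c
    · subst h; simp [hpc.symm]
    · by_cases h' : v = p
      · subst h'; simp [h]; ring
      · simp [h, h']
  have h2 := Finset.sum_congr (rfl : Finset.range n = Finset.range n) fun v _ => h1 v
  simpa [Finset.sum_add_distrib, Finset.sum_ite_eq', hp, hc] using h2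

/-- Contracted vertices carry zeros, so sums over all vertices are sums over the live ones. Positive
sizes make the table index `size - 1` faithful, and the cost bound keeps every genuine entry below
`n * n * n + 2`. -/
lemma contract_spec (h : EdgeOrder n par child) {f : ℕ → ℕ} (hf : ∀ i, f i ≤ 1) (t : ℕ)
    (ht : t ≤ n - 1) :
    (∀ v, Live child (n - 1 - t) v → 1 ≤ (contract n par child f t).size v) ∧
    (∀ i, n - 1 - t ≤ i → i < n - 1 → (contract n par child f t).size (child i) = 0 ∧
      (contract n par child f t).kept (child i) = 0 ∧
      (contract n par child f t).cost (child i) = 0) ∧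
    ∑ v ∈ Finset.range n, (contract n par child f t).size v ≤ n ∧
    ∑ v ∈ Finset.range n, (contract n par child f t).kept v =
      ∑ i ∈ Finset.Ico (n - 1 - t) (n - 1), f i ∧
    ∑ v ∈ Finset.range n, (contract n par child f t).cost v ≤ t * (n * n) := by
  induction t with
  | zero =>
    refine ⟨fun v _ => by simp [contract], fun i hi hi' => by omega, ?_, ?_, ?_⟩ <;>
      simp [contract]
  | succ t ih =>
    obtain ⟨i1, i2, i3, i4, i5⟩ := ih (by omega)
    obtain ⟨i, hi⟩ : ∃ i, i = n - 2 - t := ⟨_, rfl⟩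
    have hi1 : n - 1 - t = i + 1 := by omega
    have hi2 : n - 1 - (t + 1) = i := by omega
    have hin : i < n - 1 := by omega
    rw [hi1] at i1 i2 i4
    rw [hi2]
    have hp := h.par_lt hin
    have hc := h.child_lt i hin
    have hpc := h.par_ne_child le_rfl hin
    simp only [contract, ← hi]
    generalize contract n par child f t = x at *
    have hsz : ∀ v < n, x.size v ≤ n := fun v hv =>
      (Finset.single_le_sum (f := x.size) (fun _ _ => Nat.zero_le _)
        (Finset.mem_range.2 hv)).trans i3
    refine ⟨fun v hv => ?_, fun j hj hj' => ?_, ?_, ?_, ?_⟩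
    · have hvc := h.live_ne hv le_rfl hin
      have h1 := i1 v (hv.mono (by omega))
      simp only [Contraction.merge, hvc, if_false]
      split_ifs with h2
      · subst h2; omega
      · exact h1
    · have hpj := h.par_ne_child hj hj'
      by_cases hij : j = i
      · subst hij; simp [Contraction.merge]
      · have hcj : child j ≠ child i := fun he => hij (h.child_inj _ hj' _ hin he)
        simp only [Contraction.merge, hcj, hpj.symm, if_false]
        exact i2 j (by omega) hj'
    · have := sum_merge x.size (x.size (par i) + f i * x.size (child i)) hp hc hpc
      have h1 : f i * x.size (child i) ≤ 1 * x.size (child i) := Nat.mul_le_mul_right _ (hf i)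
      simp only [Contraction.merge]
      omega
    · have := sum_merge x.kept (x.kept (par i) + x.kept (child i) + f i) hp hc hpc
      rw [Finset.sum_eq_sum_Ico_succ_bot hin, ← i4]
      simp only [Contraction.merge]
      omega
    · have := sum_merge x.cost (x.cost (par i) + x.cost (child i) +
        f i * (x.size (par i) * x.size (child i))) hp hc hpc
      have h1 : f i * (x.size (par i) * x.size (child i)) ≤ 1 * (n * n) :=
        Nat.mul_le_mul (hf i) (Nat.mul_le_mul (hsz _ hp) (hsz _ hc))
      simp only [Contraction.merge]
      rw [Nat.add_mul]
      omega

lemma contract_size_le (h : EdgeOrder n par child) {f : ℕ → ℕ} (hf : ∀ i, f i ≤ 1) {t v : ℕ}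
    (ht : t ≤ n - 1) (hv : v < n) : (contract n par child f t).size v ≤ n :=
  (Finset.single_le_sum (f := (contract n par child f t).size) (fun _ _ => Nat.zero_le _)
    (Finset.mem_range.2 hv)).trans (contract_spec h hf t ht).2.2.1

lemma contract_kept_lt (h : EdgeOrder n par child) {f : ℕ → ℕ} (hf : ∀ i, f i ≤ 1) {t v : ℕ}
    (ht : t ≤ n - 1) (hv : v < n) : (contract n par child f t).kept v < n := by
  have h1 := Finset.single_le_sum (f := (contract n par child f t).kept)
    (fun _ _ => Nat.zero_le _) (Finset.mem_range.2 hv)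
  rw [(contract_spec h hf t ht).2.2.2.1] at h1
  have h2 : ∑ i ∈ Finset.Ico (n - 1 - t) (n - 1), f i ≤ _ :=
    Finset.sum_le_card_nsmul _ _ 1 fun i _ => hf i
  simp only [Nat.card_Ico, smul_eq_mul, mul_one] at h2
  have := h.pos
  omega

lemma contract_cost_le (h : EdgeOrder n par child) {f : ℕ → ℕ} (hf : ∀ i, f i ≤ 1) {t v : ℕ}
    (ht : t ≤ n - 1) (hv : v < n) : (contract n par child f t).cost v ≤ t * (n * n) :=
  (Finset.single_le_sum (f := (contract n par child f t).cost) (fun _ _ => Nat.zero_le _)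
    (Finset.mem_range.2 hv)).trans (contract_spec h hf t ht).2.2.2.2

lemma sum_eq_root (h : EdgeOrder n par child) (g : ℕ → ℕ) (hg : ∀ i < n - 1, g (child i) = 0) :
    ∑ v ∈ Finset.range n, g v = g 0 := by
  refine Finset.sum_eq_single_of_mem 0 (Finset.mem_range.2 h.pos) fun v hv h0 => ?_
  rcases h.cover v (Finset.mem_range.1 hv) with h1 | ⟨i, hi, rfl⟩
  · exact absurd h1 h0
  · exact hg i hi

lemma contract_kept_root (h : EdgeOrder n par child) {f : ℕ → ℕ} (hf : ∀ i, f i ≤ 1) :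
    (contract n par child f (n - 1)).kept 0 = ∑ i ∈ Finset.range (n - 1), f i := by
  obtain ⟨-, h2, -, h4, -⟩ := contract_spec h hf (n - 1) le_rfl
  rw [← sum_eq_root h _ fun i hi => (h2 i (by omega) hi).2.1, h4]
  simp

/-! ### Cluster labels and the meaning of the cost. -/

/-- `lab` labels the clusters that result from cutting the edges `i` with `f i = 0`. -/
structure IsLabel (n : ℕ) (par child f lab : ℕ → ℕ) : Prop where
  root : lab 0 = 0
  child : ∀ i < n - 1, lab (child i) = if f i = 0 then child i else lab (par i)

/-- The label of a vertex is the topmost vertex of its cluster, which is reached no later than the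
vertex itself. -/
lemma IsLabel.live (h : EdgeOrder n par child) {f lab : ℕ → ℕ} (hl : IsLabel n par child f lab)
    {i v : ℕ} (hi : i ≤ n - 1) (hv : Live child i v) : Live child i (lab v) := by
  induction i generalizing v with
  | zero =>
    rcases hv with h1 | ⟨j, hj, -⟩
    · rw [h1, hl.root]; exact .inl rfl
    · omega
  | succ i ih =>
    by_cases hvc : v = child i
    · rw [hvc, hl.child i (by omega)]
      split_ifs with h1
      · exact .inr ⟨i, by omega, rfl⟩
      · exact (ih (by omega) (h.par_mem i (by omega))).mono (by omega)
    · exact (ih (by omega) (hv.of_succ hvc)).mono (by omega)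

lemma IsLabel.lt (h : EdgeOrder n par child) {f lab : ℕ → ℕ} (hl : IsLabel n par child f lab)
    {v : ℕ} (hv : v < n) : lab v < n := by
  rcases hl.live h le_rfl (h.cover v hv) with h1 | ⟨i, hi, h1⟩
  · rw [h1]; exact h.pos
  · rw [h1]; exact h.child_lt i hi

/-- The total size of the vertices labelled `l`. -/
def classSum (n : ℕ) (lab g : ℕ → ℕ) (l : ℕ) : ℕ :=
  ∑ v ∈ Finset.range n, if lab v = l then g v else 0

/-- Both sides start equal, and each contraction preserves the equality. Keeping an edge leaves the
class sums alone, while the squared sizes grow by twice the product that enters the cost. Cutting an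
edge removes the square of the child's size from both sides. At the end only the root has positive
size and the squares of sizes cancel. -/
lemma contract_potential (h : EdgeOrder n par child) {f lab : ℕ → ℕ} (hf : ∀ i, f i ≤ 1)
    (hl : IsLabel n par child f lab) (t : ℕ) (ht : t ≤ n - 1) :
    2 * ∑ v ∈ Finset.range n, (contract n par child f t).cost v + n +
      ∑ l ∈ Finset.range n, classSum n lab (contract n par child f t).size l ^ 2 =
    ∑ l ∈ Finset.range n, classSum n lab (fun _ => 1) l ^ 2 +
      ∑ v ∈ Finset.range n, (contract n par child f t).size v ^ 2 := by
  induction t with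
  | zero => simp [contract]; ring
  | succ t ih =>
    have ih := ih (by omega)
    obtain ⟨-, i2, -, -, -⟩ := contract_spec h hf t (by omega)
    obtain ⟨i, hi⟩ : ∃ i, i = n - 2 - t := ⟨_, rfl⟩
    have hi1 : n - 1 - t = i + 1 := by omega
    have hin : i < n - 1 := by omega
    rw [hi1] at i2
    have hp := h.par_lt hin
    have hc := h.child_lt i hin
    have hpc := h.par_ne_child le_rfl hin
    have hlc := hl.child i hin
    simp only [contract, ← hi]
    generalize contract n par child f t = x at *
    have hS : ∀ l, classSum n lab (x.merge (par i) (child i) (f i)).size l +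
        ((if lab (par i) = l then x.size (par i) else 0) +
          (if lab (child i) = l then x.size (child i) else 0)) =
        classSum n lab x.size l +
          (if lab (par i) = l then x.size (par i) + f i * x.size (child i) else 0) := by
      intro l
      have := sum_merge (fun v => if lab v = l then x.size v else 0)
        (if lab (par i) = l then x.size (par i) + f i * x.size (child i) else 0) hp hc hpc
      rw [classSum, classSum, ← this]
      congr 1
      refine Finset.sum_congr rfl fun v _ => ?_
      simp only [Contraction.merge]
      by_cases h1 : v = child i
      · simp [h1]
      · by_cases h2 : v = par i
        · subst h2; simp [h1]
        · simp [h1, h2]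
    have hC := sum_merge x.cost (x.cost (par i) + x.cost (child i) +
        f i * (x.size (par i) * x.size (child i))) hp hc hpc
    have hQ := sum_merge (fun v => x.size v ^ 2)
      ((x.size (par i) + f i * x.size (child i)) ^ 2) hp hc hpc
    have hQ' : ∑ v ∈ Finset.range n, (x.merge (par i) (child i) (f i)).size v ^ 2 =
        ∑ v ∈ Finset.range n, (if v = child i then 0 else if v = par i then
          (x.size (par i) + f i * x.size (child i)) ^ 2 else x.size v ^ 2) := by
      refine Finset.sum_congr rfl fun v _ => ?_
      simp only [Contraction.merge]
      split_ifs <;> simp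
    rw [hQ']
    have hC' : ∑ v ∈ Finset.range n, (x.merge (par i) (child i) (f i)).cost v =
        ∑ v ∈ Finset.range n, (if v = child i then 0 else if v = par i then
          x.cost (par i) + x.cost (child i) + f i * (x.size (par i) * x.size (child i))
          else x.cost v) := rfl
    rw [hC']
    rcases Nat.le_one_iff_eq_zero_or_eq_one.1 (hf i) with h0 | h1
    · rw [if_pos h0] at hlc
      -- No other vertex contributes to the class of `child i`: vertices reached before have labels
      -- reached before, and those reached later already have size 0.
      have hS1 : classSum n lab x.size (child i) = x.size (child i) := by
        unfold classSum
        rw [Finset.sum_eq_single_of_mem (child i) (Finset.mem_range.2 hc), if_pos hlc]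
        intro v hv hvc
        split_ifs with hvl
        · rcases h.cover v (Finset.mem_range.1 hv) with h2 | ⟨j, hj, h2⟩
          · rw [h2, hl.root] at hvl
            exact absurd hvl.symm (h.child_ne i hin)
          · by_cases hji : j < i
            · exact absurd hvl (h.live_ne (hl.live h (by omega) (Or.inr ⟨j, hji, h2⟩)) le_rfl hin)
            · have : j ≠ i := by rintro rfl; exact hvc h2
              rw [h2]
              exact (i2 j (by omega) hj).1
        · rfl
      have hS' : ∀ l, classSum n lab (x.merge (par i) (child i) (f i)).size l ^ 2 +
          (if l = child i then x.size (child i) ^ 2 else 0) = classSum n lab x.size l ^ 2 := by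
        intro l
        have h2 := hS l
        rw [h0, hlc] at h2
        by_cases hlc' : l = child i
        · subst hlc'
          have h3 : classSum n lab (x.merge (par i) (child i) (f i)).size (child i) = 0 := by
            rw [h0]
            simp only [if_true, zero_mul, add_zero] at h2
            omega
          simp [h3, hS1]
        · simp only [Ne.symm hlc', if_false, zero_mul, add_zero] at h2
          rw [h0]
          simp only [hlc', if_false, add_zero]
          congr 1
          omega
      have h3 := Finset.sum_congr (rfl : Finset.range n = Finset.range n) fun l _ => hS' l
      rw [Finset.sum_add_distrib, Finset.sum_ite_eq', if_pos (Finset.mem_range.2 hc)] at h3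
      simp only [h0, zero_mul, add_zero] at *
      omega
    · rw [if_neg (by omega)] at hlc
      have hS' : ∀ l, classSum n lab (x.merge (par i) (child i) (f i)).size l =
          classSum n lab x.size l := by
        intro l
        have h2 := hS l
        rw [hlc, h1] at h2
        rw [h1]
        split_ifs at h2 <;> omega
      simp only [hS']
      simp only [h1, one_mul] at hC hQ ⊢
      nlinarith

/-- The cost of the contracted tree counts the pairs with equal labels. -/
lemma two_mul_contract_cost_root (h : EdgeOrder n par child) {f lab : ℕ → ℕ}
    (hf : ∀ i, f i ≤ 1) (hl : IsLabel n par child f lab) :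
    2 * (contract n par child f (n - 1)).cost 0 + n =
      ∑ l ∈ Finset.range n, classSum n lab (fun _ => 1) l ^ 2 := by
  have h1 := contract_potential h hf hl (n - 1) le_rfl
  obtain ⟨-, h2, -, -, -⟩ := contract_spec h hf (n - 1) le_rfl
  generalize contract n par child f (n - 1) = x at *
  have h2 : ∀ i < n - 1, _ := fun i hi => h2 i (by omega) hi
  rw [sum_eq_root h x.cost fun i hi => (h2 i hi).2.2,
    sum_eq_root h (fun v => x.size v ^ 2) fun i hi => by simp [(h2 i hi).1]] at h1
  have h3 : ∀ l, classSum n lab x.size l = if l = 0 then x.size 0 else 0 := by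
    intro l
    unfold classSum
    rw [sum_eq_root h _ fun i hi => by simp [(h2 i hi).1], hl.root]
    simp [eq_comm]
  simp only [h3] at h1
  have h4 : ∑ l ∈ Finset.range n, (if l = 0 then x.size 0 else 0) ^ 2 = x.size 0 ^ 2 := by
    rw [Finset.sum_eq_single_of_mem 0 (Finset.mem_range.2 h.pos)]
    · simp
    · intro l _ hl; simp [hl]
  omega

end

/-! ### Clusterings of a tree -/

/-- The vertex with a given number. -/
def vert {n : ℕ} (hn : 0 < n) (v : ℕ) : Fin n := ⟨v % n, Nat.mod_lt _ hn⟩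

lemma vert_val {n : ℕ} (hn : 0 < n) {v : ℕ} (hv : v < n) : (vert hn v : ℕ) = v :=
  Nat.mod_eq_of_lt hv

lemma vert_coe {n : ℕ} (hn : 0 < n) (v : Fin n) : vert hn v = v :=
  Fin.ext (Nat.mod_eq_of_lt v.2)

lemma vert_inj {n : ℕ} (hn : 0 < n) {u v : ℕ} (hu : u < n) (hv : v < n)
    (h : vert hn u = vert hn v) : u = v := by
  rw [← vert_val hn hu, h, vert_val hn hv]

lemma ncard_edgeSet_of_isTree {n : ℕ} {T : SimpleGraph (Fin n)} (hT : T.IsTree) :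
    T.edgeSet.ncard = n - 1 := by
  classical
  have h1 := hT.card_edgeFinset
  rw [Fintype.card_fin] at h1
  rw [← SimpleGraph.coe_edgeFinset, Set.ncard_coe_finset]
  omega

section
variable {n : ℕ} {par child : ℕ → ℕ} {T : SimpleGraph (Fin n)}

/-- The `i`-th edge. -/
def edgeAt (hn : 0 < n) (par child : ℕ → ℕ) (i : ℕ) : Sym2 (Fin n) :=
  s(vert hn (par i), vert hn (child i))

/-- The lower endpoint of the later edge is not the upper endpoint of the earlier one, so equal
edges have equal children. -/
lemma edgeAt_injOn (h : EdgeOrder n par child) :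
    Set.InjOn (edgeAt h.pos par child) (Finset.range (n - 1)) := by
  have key : ∀ i j, i ≤ j → j < n - 1 → edgeAt h.pos par child i = edgeAt h.pos par child j →
      i = j := by
    intro i j hij hj he
    have hi : i < n - 1 := by omega
    have h1 : vert h.pos (child j) ∈ edgeAt h.pos par child i := by
      rw [he]; exact Sym2.mem_mk_right _ _
    rcases Sym2.mem_iff.1 h1 with h2 | h2
    · exact absurd (vert_inj h.pos (h.child_lt j hj) (h.par_lt hi) h2).symm
        (h.par_ne_child hij hj)
    · exact (h.child_inj j hj i hi (vert_inj h.pos (h.child_lt j hj) (h.child_lt i hi) h2)).symm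
  intro i hi j hj he
  simp only [Finset.coe_range, Set.mem_Iio] at hi hj
  rcases le_total i j with hij | hij
  · exact key i j hij hj he
  · exact (key j i hij hi he.symm).symm

/-- One inclusion is adjacency; the `n - 1` listed edges are distinct and a tree has no more. -/
lemma edgeSet_eq_image (h : EdgeOrder n par child) (hT : T.IsTree)
    (hadj : ∀ i < n - 1, T.Adj (vert h.pos (par i)) (vert h.pos (child i))) :
    T.edgeSet = (Finset.range (n - 1)).image (edgeAt h.pos par child) := by
  symm
  refine Set.eq_of_subset_of_ncard_le ?_ ?_ (Set.toFinite _)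
  · intro e he
    simp only [Finset.coe_image, Finset.coe_range, Set.mem_image, Set.mem_Iio] at he
    obtain ⟨i, hi, rfl⟩ := he
    exact hadj i hi
  · rw [Set.ncard_coe_finset, Finset.card_image_of_injOn (edgeAt_injOn h), Finset.card_range,
      ncard_edgeSet_of_isTree hT]

/-- Which edges are inside a cluster. -/
def keptOf (hn : 0 < n) (par child : ℕ → ℕ) (ζ : Finpartition (Finset.univ : Finset (Fin n)))
    (i : ℕ) : ℕ :=
  if ζ.part (vert hn (par i)) = ζ.part (vert hn (child i)) then 1 else 0

lemma intraEdges_eq (h : EdgeOrder n par child) (hT : T.IsTree)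
    (hadj : ∀ i < n - 1, T.Adj (vert h.pos (par i)) (vert h.pos (child i)))
    (ζ : Finpartition (Finset.univ : Finset (Fin n))) :
    intraEdges T ζ = ∑ i ∈ Finset.range (n - 1), keptOf h.pos par child ζ i := by
  have h1 : ∀ C : Finset (Fin n), clusterEdges T C = ∑ i ∈ Finset.range (n - 1),
      if vert h.pos (par i) ∈ C ∧ vert h.pos (child i) ∈ C then 1 else 0 := by
    intro C
    have h2 : {e | e ∈ T.edgeSet ∧ ∀ v ∈ e, v ∈ C} = (((Finset.range (n - 1)).filter fun i =>
        vert h.pos (par i) ∈ C ∧ vert h.pos (child i) ∈ C).image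
          (edgeAt h.pos par child) : Finset (Sym2 (Fin n))) := by
      ext e
      rw [edgeSet_eq_image h hT hadj]
      simp only [Finset.coe_image, Finset.coe_range, Set.mem_image, Set.mem_Iio,
        Set.mem_ofPred_eq, Finset.coe_filter, Finset.mem_range]
      constructor
      · rintro ⟨⟨i, hi, rfl⟩, h3⟩
        exact ⟨i, ⟨hi, h3 _ (Sym2.mem_mk_left _ _), h3 _ (Sym2.mem_mk_right _ _)⟩, rfl⟩
      · rintro ⟨i, ⟨hi, h3, h4⟩, rfl⟩
        refine ⟨⟨i, hi, rfl⟩, fun v hv => ?_⟩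
        rcases Sym2.mem_iff.1 hv with rfl | rfl
        · exact h3
        · exact h4
    rw [clusterEdges, h2, Set.ncard_coe_finset, Finset.card_image_of_injOn, Finset.card_filter]
    exact (edgeAt_injOn h).mono (Finset.coe_subset.2 (Finset.filter_subset _ _))
  simp only [intraEdges, h1]
  -- After the exchange of sums, edge `i` can be counted only by the cluster of its upper endpoint.
  rw [Finset.sum_comm]
  refine Finset.sum_congr rfl fun i _ => ?_
  unfold keptOf
  set u := vert h.pos (par i)
  set v := vert h.pos (child i)
  have hu := ζ.mem_part (Finset.mem_univ u)
  rw [Finset.sum_eq_single_of_mem (ζ.part u) (ζ.part_mem.2 (Finset.mem_univ u))]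
  · refine if_congr ?_ rfl rfl
    constructor
    · rintro ⟨-, h3⟩
      exact (ζ.part_eq_of_mem (ζ.part_mem.2 (Finset.mem_univ u)) h3).symm
    · intro h3
      exact ⟨hu, h3 ▸ ζ.mem_part (Finset.mem_univ v)⟩
  · intro C hC hne
    rw [if_neg]
    rintro ⟨h3, -⟩
    exact hne (ζ.part_eq_of_mem hC h3).symm

/-- Labels are assigned along the edge order. Setting the label of `child k` disturbs no earlier
equation, since `child k` differs from all earlier children and from all parents up to index `k`. -/
lemma exists_isLabel (h : EdgeOrder n par child) (f : ℕ → ℕ) :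
    ∃ lab, IsLabel n par child f lab := by
  have key : ∀ k ≤ n - 1, ∃ lab : ℕ → ℕ, lab 0 = 0 ∧
      ∀ i < k, lab (child i) = if f i = 0 then child i else lab (par i) := by
    intro k
    induction k with
    | zero => exact fun _ => ⟨fun _ => 0, rfl, fun i hi => by omega⟩
    | succ k ih =>
      intro hk
      obtain ⟨lab, h0, h1⟩ := ih (by omega)
      refine ⟨Function.update lab (child k) (if f k = 0 then child k else lab (par k)), ?_, ?_⟩
      · rw [Function.update_of_ne (h.child_ne k (by omega)).symm, h0]
      · intro i hi
        rw [Function.update_of_ne (h.par_ne_child (show i ≤ k by omega) (by omega))]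
        by_cases hik : i = k
        · subst hik; simp
        · rw [Function.update_of_ne
            (fun he => hik (h.child_inj i (by omega) k (by omega) he)), h1 i (by omega)]
  obtain ⟨lab, h0, h1⟩ := key (n - 1) le_rfl
  exact ⟨lab, h0, h1⟩

/-- Having the same label. -/
def labelSetoid (n : ℕ) (lab : ℕ → ℕ) : Setoid (Fin n) := Setoid.ker fun v : Fin n => lab v

instance (n : ℕ) (lab : ℕ → ℕ) : DecidableRel (labelSetoid n lab).r :=
  fun u v => decEq (lab u) (lab v)

/-- The clustering given by labels. -/
def ofLabel (n : ℕ) (lab : ℕ → ℕ) : Finpartition (Finset.univ : Finset (Fin n)) :=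
  Finpartition.ofSetoid (labelSetoid n lab)

lemma ofLabel_part_eq_iff (lab : ℕ → ℕ) (u v : Fin n) :
    (ofLabel n lab).part u = (ofLabel n lab).part v ↔ lab u = lab v := by
  have h1 : ∀ u v : Fin n, v ∈ (ofLabel n lab).part u ↔ lab u = lab v := fun u v => by
    unfold ofLabel
    rw [Finpartition.mem_part_ofSetoid_iff_rel]
    exact Iff.rfl
  constructor
  · intro h
    rw [← h1, h]
    exact Finpartition.mem_part _ (Finset.mem_univ v)
  · intro h
    ext w
    rw [h1, h1, h]

/-- Both numbers are determined by the count of ordered pairs with equal labels: one through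
`two_mul_intraPairs_add`, the other through the potential. -/
lemma intraPairs_ofLabel (h : EdgeOrder n par child) {f lab : ℕ → ℕ} (hf : ∀ i, f i ≤ 1)
    (hl : IsLabel n par child f lab) :
    intraPairs (ofLabel n lab) = (contract n par child f (n - 1)).cost 0 := by
  have h1 := two_mul_contract_cost_root h hf hl
  have h2 := two_mul_intraPairs_add (ofLabel n lab)
  simp only [ofLabel_part_eq_iff, Fintype.card_fin] at h2
  have h3 : (Finset.univ.filter fun q : Fin n × Fin n => lab q.1 = lab q.2).card =
      ∑ l ∈ Finset.range n, classSum n lab (fun _ => 1) l ^ 2 := by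
    have h4 : ∀ l, classSum n lab (fun _ => 1) l =
        (Finset.univ.filter fun v : Fin n => lab v = l).card := by
      intro l
      rw [classSum, Finset.card_filter,
        ← Fin.sum_univ_eq_sum_range (fun v => if lab v = l then 1 else 0)]
    rw [Finset.card_eq_sum_card_fiberwise (f := fun q => lab q.1) (t := Finset.range n)]
    · refine Finset.sum_congr rfl fun l _ => ?_
      rw [h4, sq, ← Finset.card_product]
      congr 1
      ext ⟨u, v⟩
      simp only [Finset.mem_filter, Finset.mem_univ, true_and, Finset.mem_product]
      constructor
      · rintro ⟨h5, h6⟩; exact ⟨h6, h5 ▸ h6⟩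
      · rintro ⟨h5, h6⟩; exact ⟨h5.trans h6.symm, h5⟩
    · intro q _
      simpa using hl.lt h q.1.2
  omega

lemma intraEdges_ofLabel (h : EdgeOrder n par child) (hT : T.IsTree)
    (hadj : ∀ i < n - 1, T.Adj (vert h.pos (par i)) (vert h.pos (child i)))
    {f lab : ℕ → ℕ} (hf : ∀ i, f i ≤ 1) (hl : IsLabel n par child f lab) :
    intraEdges T (ofLabel n lab) = (contract n par child f (n - 1)).kept 0 := by
  rw [intraEdges_eq h hT hadj, contract_kept_root h hf]
  refine Finset.sum_congr rfl fun i hi => ?_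
  rw [Finset.mem_range] at hi
  simp only [keptOf, ofLabel_part_eq_iff, vert_val h.pos (h.par_lt hi),
    vert_val h.pos (h.child_lt i hi), hl.child i hi]
  by_cases h0 : f i = 0
  · rw [if_pos h0, if_neg, h0]
    -- A cut edge joins different clusters: the label of its parent is reached before edge `i`, the
    -- label of its child is `child i`.
    exact h.live_ne (hl.live h (by omega) (h.par_mem i hi)) le_rfl hi
  · have := hf i
    rw [if_neg h0, if_pos rfl]
    omega

lemma keptOf_le_one (hn : 0 < n) (ζ : Finpartition (Finset.univ : Finset (Fin n))) (i : ℕ) :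
    keptOf hn par child ζ i ≤ 1 := by
  unfold keptOf; split_ifs <;> simp

/-- By induction along the edge order, each vertex shares its part of `ζ` with its label, because
labels are passed on only across edges inside parts. Hence the labelling refines `ζ`. -/
lemma contract_cost_le_intraPairs (h : EdgeOrder n par child)
    (ζ : Finpartition (Finset.univ : Finset (Fin n))) :
    (contract n par child (keptOf h.pos par child ζ) (n - 1)).cost 0 ≤ intraPairs ζ := by
  obtain ⟨lab, hl⟩ := exists_isLabel h (keptOf h.pos par child ζ)
  rw [← intraPairs_ofLabel h (keptOf_le_one h.pos ζ) hl]
  have key : ∀ k ≤ n - 1, ∀ v, Live child k v →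
      ζ.part (vert h.pos v) = ζ.part (vert h.pos (lab v)) := by
    intro k
    induction k with
    | zero =>
      rintro - v (h1 | ⟨j, hj, -⟩)
      · rw [h1, hl.root]
      · omega
    | succ k ih =>
      intro hk v hv
      by_cases hvc : v = child k
      · rw [hvc, hl.child k (by omega)]
        split_ifs with h0
        · rfl
        · rw [← ih (by omega) _ (h.par_mem k (by omega))]
          unfold keptOf at h0
          split_ifs at h0 with h1
          · exact h1.symm
          · exact absurd rfl h0
      · exact ih (by omega) v (hv.of_succ hvc)
  refine intraPairs_le_of_refines fun u v huv => ?_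
  rw [ofLabel_part_eq_iff] at huv
  have hu := key (n - 1) le_rfl u (h.cover u u.2)
  have hv := key (n - 1) le_rfl v (h.cover v v.2)
  rw [vert_coe] at hu hv
  rw [hu, hv, huv]

/-- If `V k` bounds the number of intracluster pairs of the clusterings with `k` intracluster
edges from below, then the best of these bounds is the optimum if it is attained. -/
theorem isOptimal_ofLabel (h : EdgeOrder n par child) (hT : T.IsTree)
    (hadj : ∀ i < n - 1, T.Adj (vert h.pos (par i)) (vert h.pos (child i)))
    {f lab V : ℕ → ℕ} {k : ℕ} (hf : ∀ i, f i ≤ 1) (hl : IsLabel n par child f lab)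
    (hV : ∀ g : ℕ → ℕ, (∀ i, g i ≤ 1) → V ((contract n par child g (n - 1)).kept 0) ≤
      (contract n par child g (n - 1)).cost 0)
    (hk : (contract n par child f (n - 1)).kept 0 = k)
    (hc : (contract n par child f (n - 1)).cost 0 = V k)
    (hbest : ∀ k' < n, tailNum (n.choose 2) (n - 1) (V k) k ≤
      tailNum (n.choose 2) (n - 1) (V k') k') :
    IsOptimal T (ofLabel n lab) := by
  intro ζ
  unfold surprise
  rw [Fintype.card_fin, ncard_edgeSet_of_isTree hT]
  refine hyperTail_le_of_tailNum_le ?_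
  have hz := keptOf_le_one (par := par) (child := child) h.pos ζ
  have h1 := hV _ hz
  have h2 := contract_cost_le_intraPairs h ζ
  have h3 := contract_kept_lt h hz (le_refl (n - 1)) h.pos
  have h4 := intraPairs_le_choose ζ
  rw [Fintype.card_fin] at h4
  have h5 : intraEdges T ζ =
      (contract n par child (keptOf h.pos par child ζ) (n - 1)).kept 0 := by
    rw [intraEdges_eq h hT hadj, contract_kept_root h hz]
  rw [intraPairs_ofLabel h hf hl, intraEdges_ofLabel h hT hadj hf hl, hk, hc, h5]
  -- From the optimum to the bound for the edge count of `ζ`, and from there, by monotonicity, to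
  -- the actual pair count of `ζ`.
  exact (hbest _ h3).trans (tailNum_mono _ (h1.trans h2) h4)

end

end Surprise

namespace LoopLang
open WordRAM Surprise

/-! ### Reasoning about the loop language -/

section Simp
variable (n : ℕ) (σ : Store)

@[simp] lemma setV_v (x y : Var) (w : ℕ) : (σ.setV x w).v y = if y = x then w else σ.v y := by
  simp [Store.setV, Function.update_apply]
@[simp] lemma setV_lo (x : Var) (w : ℕ) : (σ.setV x w).lo = σ.lo := rfl
@[simp] lemma setV_a (x : Var) (w : ℕ) : (σ.setV x w).a = σ.a := rfl
@[simp] lemma setLo_v (i w : ℕ) : (σ.setLo i w).v = σ.v := rfl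
@[simp] lemma setLo_lo (i j w : ℕ) : (σ.setLo i w).lo j = if j = i then w else σ.lo j := by
  simp [Store.setLo, Function.update_apply]
@[simp] lemma setLo_a (i w : ℕ) : (σ.setLo i w).a = σ.a := rfl
@[simp] lemma setA_v (b : Arr) (i j k w : ℕ) : (σ.setA b i j k w).v = σ.v := rfl
@[simp] lemma setA_lo (b : Arr) (i j k w : ℕ) : (σ.setA b i j k w).lo = σ.lo := rfl
@[simp] lemma setA_a (b b' : Arr) (i j k w i' j' k' : ℕ) : (σ.setA b i j k w).a b' i' j' k' =
    if b' = b ∧ i' = i ∧ j' = j ∧ k' = k then w else σ.a b' i' j' k' := rfl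

instance : Add Ex := ⟨.op .add⟩
instance : Sub Ex := ⟨.op .sub⟩
instance : Mul Ex := ⟨.op .mul⟩
instance : Div Ex := ⟨.op .div⟩
instance : Mod Ex := ⟨fun e f => e - e / f * f⟩
instance (k : ℕ) : OfNat Ex k := ⟨.lit k⟩
instance : Coe Var Ex := ⟨.var⟩

@[simp] lemma ev_add (e f : Ex) : (e + f).ev n σ = e.ev n σ + f.ev n σ := rfl
@[simp] lemma ev_sub (e f : Ex) : (e - f).ev n σ = e.ev n σ - f.ev n σ := rfl
@[simp] lemma ev_mul (e f : Ex) : (e * f).ev n σ = e.ev n σ * f.ev n σ := rfl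
@[simp] lemma ev_div (e f : Ex) : (e / f).ev n σ = e.ev n σ / f.ev n σ := rfl
@[simp] lemma ev_mod (e f : Ex) : (e % f).ev n σ = e.ev n σ % f.ev n σ := by
  change e.ev n σ - e.ev n σ / f.ev n σ * f.ev n σ = _
  have := Nat.div_add_mod' (e.ev n σ) (f.ev n σ)
  omega
@[simp] lemma ev_ofNat (k : ℕ) :
    (no_index (OfNat.ofNat k : Ex)).ev n σ = (OfNat.ofNat k : ℕ) := rfl
@[simp] lemma ev_lit (k : ℕ) : (Ex.lit k).ev n σ = k := rfl
@[simp] lemma ev_var (x : Var) : (Ex.var x).ev n σ = σ.v x := rfl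
@[simp] lemma ev_len : Ex.len.ev n σ = n := rfl
@[simp] lemma ev_lo (e : Ex) : (Ex.lo e).ev n σ = σ.lo (e.ev n σ % (2 * n)) := rfl
@[simp] lemma ev_get (b : Arr) (e f g : Ex) :
    (Ex.get b e f g).ev n σ = σ.a b (e.ev n σ) (f.ev n σ) (g.ev n σ) := rfl

@[simp] lemma run_skip : Stmt.skip.run n σ = σ := rfl
@[simp] lemma run_asg (x : Var) (e : Ex) :
    (Stmt.asg x e).run n σ = σ.setV x (clamp n (e.ev n σ)) := rfl
@[simp] lemma run_putLo (i e : Ex) : (Stmt.putLo i e).run n σ =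
    σ.setLo (i.ev n σ % (2 * n)) (clamp n (e.ev n σ)) := rfl
@[simp] lemma run_put (b : Arr) (i j k e : Ex) : (Stmt.put b i j k e).run n σ =
    σ.setA b (i.ev n σ) (j.ev n σ) (k.ev n σ) (clamp n (e.ev n σ)) := rfl
@[simp] lemma run_seq (P Q : Stmt) : (Stmt.seq P Q).run n σ = Q.run n (P.run n σ) := rfl
@[simp] lemma run_ite (e f : Ex) (P Q : Stmt) : (Stmt.ite e f P Q).run n σ =
    if e.ev n σ < f.ev n σ then P.run n σ else Q.run n σ := rfl

end Simp

infixr:67 ";;" => Stmt.seq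

lemma clamp_of_lt {n w : ℕ} (h : w < cap n) : clamp n w = w := if_pos h

lemma clamp_of_le_pow {n w d : ℕ} (h : w < (n + 2) ^ d) (hd : d ≤ 6) : clamp n w = w :=
  clamp_of_lt (h.trans_le (base_pow_mono n hd))

lemma clamp_of_lt_self {n w : ℕ} (h : w < n + 2) : clamp n w = w :=
  clamp_of_le_pow (d := 1) (by simpa using h) (by omega)

/-! ### Frame conditions and loop invariants. -/

/-- Whether a statement may write a variable. -/
def Stmt.writesV (y : Var) : Stmt → Bool
  | .asg x _ => x = y
  | .seq P Q => P.writesV y || Q.writesV y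
  | .ite _ _ P Q => P.writesV y || Q.writesV y
  | .loop x _ _ P => x = y || P.writesV y
  | _ => false

/-- Whether a statement may write an array. -/
def Stmt.writesA (b : Arr) : Stmt → Bool
  | .put b' _ _ _ _ => b' = b
  | .seq P Q => P.writesA b || Q.writesA b
  | .ite _ _ P Q => P.writesA b || Q.writesA b
  | .loop _ _ _ P => P.writesA b
  | _ => false

/-- Whether a statement may write the first memory cells. -/
def Stmt.writesLo : Stmt → Bool
  | .putLo _ _ => true
  | .seq P Q => P.writesLo || Q.writesLo
  | .ite _ _ P Q => P.writesLo || Q.writesLo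
  | .loop _ _ _ P => P.writesLo
  | _ => false

/-- `τ` agrees with `σ` on everything that `P` does not write. -/
structure Frame (P : Stmt) (σ τ : Store) : Prop where
  v : ∀ y, P.writesV y = false → τ.v y = σ.v y
  a : ∀ b, P.writesA b = false → τ.a b = σ.a b
  lo : P.writesLo = false → τ.lo = σ.lo

lemma iter_inv {body : ℕ → Store → Store} (I : ℕ → Store → Prop) {σ : Store} {M : ℕ}
    (h0 : I 0 σ) (hs : ∀ i τ, i < M → I i τ → I (i + 1) (body i τ)) : I M (iter body M σ) := by
  have : ∀ m ≤ M, I m (iter body m σ) := by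
    intro m
    induction m with
    | zero => exact fun _ => h0
    | succ m ih => exact fun hm => hs m _ (by omega) (ih (by omega))
  exact this M le_rfl

/-- The write sets are computable from the syntax, so for concrete programs `rfl` shows that a
variable or an array is untouched. -/
lemma Stmt.frame (n : ℕ) (P : Stmt) (σ : Store) : Frame P σ (P.run n σ) := by
  induction P generalizing σ with
  | skip => exact ⟨fun _ _ => rfl, fun _ _ => rfl, fun _ => rfl⟩
  | asg x e =>
    refine ⟨fun y hy => ?_, fun _ _ => rfl, fun _ => rfl⟩
    simp only [writesV, decide_eq_false_iff_not] at hy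
    simp [Ne.symm hy]
  | putLo i e => exact ⟨fun _ _ => rfl, fun _ _ => rfl, fun h => by simp [writesLo] at h⟩
  | put b i j k e =>
    refine ⟨fun _ _ => rfl, fun b' hb => ?_, fun _ => rfl⟩
    simp only [writesA, decide_eq_false_iff_not] at hb
    funext i' j' k'
    simp [Ne.symm hb]
  | seq P Q ihP ihQ =>
    refine ⟨fun y hy => ?_, fun b hb => ?_, fun h => ?_⟩
    · simp only [writesV, Bool.or_eq_false_iff] at hy
      rw [run_seq, (ihQ _).v y hy.2, (ihP _).v y hy.1]
    · simp only [writesA, Bool.or_eq_false_iff] at hb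
      rw [run_seq, (ihQ _).a b hb.2, (ihP _).a b hb.1]
    · simp only [writesLo, Bool.or_eq_false_iff] at h
      rw [run_seq, (ihQ _).lo h.2, (ihP _).lo h.1]
  | ite e f P Q ihP ihQ =>
    rw [run_ite]
    refine ⟨fun y hy => ?_, fun b hb => ?_, fun h => ?_⟩
    · simp only [writesV, Bool.or_eq_false_iff] at hy
      split_ifs
      · exact (ihP _).v y hy.1
      · exact (ihQ _).v y hy.2
    · simp only [writesA, Bool.or_eq_false_iff] at hb
      split_ifs
      · exact (ihP _).a b hb.1
      · exact (ihQ _).a b hb.2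
    · simp only [writesLo, Bool.or_eq_false_iff] at h
      split_ifs
      · exact (ihP _).lo h.1
      · exact (ihQ _).lo h.2
  | loop x d e P ih =>
    refine iter_inv (fun _ τ => Frame (.loop x d e P) σ τ)
      ⟨fun _ _ => rfl, fun _ _ => rfl, fun _ => rfl⟩
      fun i τ _ hτ => ⟨fun y hy => ?_, fun b hb => ?_, fun h => ?_⟩
    · have hy' := hy
      simp only [writesV, Bool.or_eq_false_iff, decide_eq_false_iff_not] at hy'
      rw [(ih _).v y hy'.2, setV_v, if_neg (Ne.symm hy'.1), hτ.v y hy]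
    · rw [(ih _).a b hb, setV_a, hτ.a b hb]
    · rw [(ih _).lo h, setV_lo, hτ.lo h]

/-- Loop invariants. -/
lemma Stmt.loop_inv {n : ℕ} {x : Var} {d : ℕ} {e : Ex} {P : Stmt} {σ : Store} (M : ℕ)
    (hd : d ≤ 6) (hM : e.ev n σ = M) (hMd : M ≤ n ^ d) (I : ℕ → Store → Prop) (h0 : I 0 σ)
    (hs : ∀ i τ, i < M → Frame (.loop x d e P) σ τ → I i τ → I (i + 1) (P.run n (τ.setV x i))) :
    I M ((Stmt.loop x d e P).run n σ) := by
  have h1 : (Stmt.loop x d e P).run n σ = iter (fun i τ => P.run n (τ.setV x (clamp n i))) M σ := by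
    rw [Stmt.run, hM, min_eq_left hMd]
  rw [h1]
  refine (iter_inv (fun i τ => Frame (.loop x d e P) σ τ ∧ I i τ)
    ⟨⟨fun _ _ => rfl, fun _ _ => rfl, fun _ => rfl⟩, h0⟩ fun i τ hi hτ => ?_).2
  -- The counter stays below `n ^ d` with `d ≤ 6`, so clamping does not change it.
  have hc : clamp n i = i := clamp_of_le_pow (d := d)
    ((hi.trans_le hMd).trans_le (Nat.pow_le_pow_left (by omega) d)) hd
  rw [hc]
  refine ⟨⟨fun y hy => ?_, fun b hb => ?_, fun h => ?_⟩, hs i τ hi hτ.1 hτ.2⟩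
  · have hy' := hy
    simp only [writesV, Bool.or_eq_false_iff, decide_eq_false_iff_not] at hy'
    rw [(P.frame n _).v y hy'.2, setV_v, if_neg (Ne.symm hy'.1), hτ.1.v y hy]
  · rw [(P.frame n _).a b hb, setV_a, hτ.1.a b hb]
  · rw [(P.frame n _).lo h, setV_lo, hτ.1.lo h]

/-! ### Ordering the edges -/

/-- The endpoint `x = 1, 2` of the current edge. -/
def endpoint (x : ℕ) : Ex := .lo (2 * Var.edge + .lit x)

/-- Append the edge from endpoint `y` down to endpoint `x` if exactly `y` has been reached. -/
def appendEdge (x y : ℕ) : Stmt :=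
  .ite (.get .seen (endpoint x) 0 0) (.get .seen (endpoint y) 0 0)
    (.put .par Var.cnt 0 0 (endpoint y) ;; .put .child Var.cnt 0 0 (endpoint x) ;;
      .put .seen (endpoint x) 0 0 1 ;; .asg .cnt (Var.cnt + 1)) .skip

/-- Scan the list of edges. -/
def scanEdges : Stmt := .loop .edge 1 (.len - 1) (appendEdge 1 2 ;; appendEdge 2 1)

/-- List the edges from the root downwards. -/
def orderEdges : Stmt := .put .seen 0 0 0 1 ;; .loop .pass 1 .len scanEdges

/-- The first `c` edges of an ordering have been found. -/
structure PartialEdgeOrder {n : ℕ} (hn : 0 < n) (T : SimpleGraph (Fin n)) (c : ℕ)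
    (par child seen : ℕ → ℕ) : Prop where
  child_lt : ∀ i < c, child i < n
  child_ne : ∀ i < c, child i ≠ 0
  child_inj : ∀ i < c, ∀ j < c, child i = child j → i = j
  par_mem : ∀ i < c, Live child i (par i)
  adj : ∀ i < c, T.Adj (vert hn (par i)) (vert hn (child i))
  seen_live : ∀ v < n, Live child c v → seen v = 1
  seen_not_live : ∀ v < n, ¬ Live child c v → seen v = 0

section
variable {n : ℕ} {hn : 0 < n} {T : SimpleGraph (Fin n)} {c : ℕ} {par child seen : ℕ → ℕ}

/-- The vertices reached so far. -/
def reached (c : ℕ) (child : ℕ → ℕ) : Finset ℕ := insert 0 ((Finset.range c).image child)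

lemma mem_reached {v : ℕ} : v ∈ reached c child ↔ Live child c v := by
  simp only [reached, Finset.mem_insert, Finset.mem_image, Finset.mem_range, Live]
  constructor
  · rintro (h | ⟨i, hi, h⟩)
    · exact .inl h
    · exact .inr ⟨i, hi, h.symm⟩
  · rintro (h | ⟨i, hi, h⟩)
    · exact .inl h
    · exact .inr ⟨i, hi, h.symm⟩

lemma PartialEdgeOrder.card_reached (h : PartialEdgeOrder hn T c par child seen) :
    (reached c child).card = c + 1 := by
  rw [reached, Finset.card_insert_of_notMem, Finset.card_image_of_injOn, Finset.card_range]
  · intro i hi j hj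
    simp only [Finset.coe_range, Set.mem_Iio] at hi hj
    exact h.child_inj i hi j hj
  · simp only [Finset.mem_image, Finset.mem_range, not_exists, not_and]
    exact fun i hi => h.child_ne i hi

lemma PartialEdgeOrder.reached_subset (h : PartialEdgeOrder hn T c par child seen) :
    reached c child ⊆ Finset.range n := by
  intro v hv
  rw [Finset.mem_range]
  rcases mem_reached.1 hv with rfl | ⟨i, hi, rfl⟩
  · exact hn
  · exact h.child_lt i hi

lemma PartialEdgeOrder.lt (h : PartialEdgeOrder hn T c par child seen) : c < n := by
  have := Finset.card_le_card h.reached_subset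
  rw [h.card_reached, Finset.card_range] at this
  omega

/-- The root and `n - 1` distinct children are `n` vertices below `n`, hence all of them. -/
lemma PartialEdgeOrder.edgeOrder (h : PartialEdgeOrder hn T (n - 1) par child seen) :
    EdgeOrder n par child where
  pos := hn
  child_lt := h.child_lt
  child_ne := h.child_ne
  child_inj := h.child_inj
  par_mem := h.par_mem
  cover v hv := by
    have h1 : reached (n - 1) child = Finset.range n := by
      refine Finset.eq_of_subset_of_card_le h.reached_subset ?_
      rw [h.card_reached, Finset.card_range]
      omega
    rw [← Finset.mem_range, ← h1, mem_reached] at hv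
    exact hv

/-- If a vertex were not reached, a walk to it from the root would cross an edge from a reached to
an unreached vertex, where `seen` changes. -/
lemma PartialEdgeOrder.le_of_closed (h : PartialEdgeOrder hn T c par child seen) (hT : T.Connected)
    (hcl : ∀ u v : Fin n, T.Adj u v → seen u = seen v) : n ≤ c + 1 := by
  have h1 : ∀ v : Fin n, Live child c v := by
    intro v
    by_contra hv
    obtain ⟨p⟩ := hT.preconnected (vert hn 0) v
    obtain ⟨d, -, h2, h3⟩ := p.exists_boundary_dart {v : Fin n | Live child c v}
      (by left; simp [vert]) hv
    have h4 := hcl d.fst d.snd d.adj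
    rw [h.seen_live _ d.fst.2 h2, h.seen_not_live _ d.snd.2 h3] at h4
    exact one_ne_zero h4
  have h2 : Finset.range n ⊆ reached c child := fun v hv =>
    mem_reached.2 (h1 ⟨v, Finset.mem_range.1 hv⟩)
  have := Finset.card_le_card h2
  rw [h.card_reached, Finset.card_range] at this
  omega

/-- As `seen` takes only the values 0 and 1, the strict inequality says that `w` is reached and `u`
is not. -/
lemma PartialEdgeOrder.append (h : PartialEdgeOrder hn T c par child seen) {u w : ℕ} (hu : u < n)
    (hw : w < n) (hadj : T.Adj (vert hn w) (vert hn u)) (hs : seen u < seen w) :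
    PartialEdgeOrder hn T (c + 1) (fun i => if i = c then w else par i)
      (fun i => if i = c then u else child i) (fun v => if v = u then 1 else seen v) := by
  have hlu : ¬ Live child c u := fun hl => by
    rw [h.seen_live u hu hl] at hs
    by_cases hlw : Live child c w
    · rw [h.seen_live w hw hlw] at hs; omega
    · rw [h.seen_not_live w hw hlw] at hs; omega
  have hlw : Live child c w := by
    by_contra hlw
    rw [h.seen_not_live w hw hlw] at hs; omega
  have hlive : ∀ i ≤ c, ∀ v, Live (fun i => if i = c then u else child i) i v ↔
      Live child i v := by
    intro i hi v
    refine or_congr Iff.rfl (exists_congr fun j => and_congr_right fun hj => ?_)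
    dsimp only
    rw [if_neg (by omega)]
  have hlive' : ∀ v, Live (fun i => if i = c then u else child i) (c + 1) v ↔
      v = u ∨ Live child c v := by
    intro v
    constructor
    · intro hv
      by_cases hvu : v = u
      · exact .inl hvu
      · exact .inr ((hlive c le_rfl v).1 (hv.of_succ (by simpa using hvu)))
    · rintro (rfl | hv)
      · exact .inr ⟨c, by omega, by simp⟩
      · exact ((hlive c le_rfl v).2 hv).mono (by omega)
  refine ⟨fun i hi => ?_, fun i hi => ?_, fun i hi j hj => ?_, fun i hi => ?_, fun i hi => ?_,
    fun v hv hl => ?_, fun v hv hl => ?_⟩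
  · split_ifs
    · exact hu
    · exact h.child_lt i (by omega)
  · split_ifs
    · rintro rfl; exact hlu (.inl rfl)
    · exact h.child_ne i (by omega)
  · split_ifs with h1 h2 h2
    · intro _; omega
    · intro he; exact absurd (.inr ⟨j, by omega, he⟩) hlu
    · intro he; exact absurd (.inr ⟨i, by omega, he.symm⟩) hlu
    · exact h.child_inj i (by omega) j (by omega)
  · rw [hlive i (by omega)]
    split_ifs with h1
    · subst h1; exact hlw
    · exact h.par_mem i (by omega)
  · split_ifs with h1
    · exact hadj
    · exact h.adj i (by omega)
  · rw [hlive'] at hl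
    split_ifs with h1
    · rfl
    · exact h.seen_live v hv (hl.resolve_left h1)
  · rw [hlive', not_or] at hl
    rw [if_neg hl.1]
    exact h.seen_not_live v hv hl.2

end

/-- `PartialEdgeOrder` for the arrays of a store. -/
def Ordered {n : ℕ} (hn : 0 < n) (T : SimpleGraph (Fin n)) (σ : Store) : Prop :=
  PartialEdgeOrder hn T (σ.v .cnt) (fun i => σ.a .par i 0 0) (fun i => σ.a .child i 0 0)
    (fun v => σ.a .seen v 0 0)

/-- If nothing is appended, one inequality between the marks of the endpoints remains; trying the
edge in both directions then yields equality. -/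
lemma appendEdge_spec {n : ℕ} {hn : 0 < n} {T : SimpleGraph (Fin n)} {σ : Store} {x y u w : ℕ}
    (h : Ordered hn T σ) (hx : 2 * σ.v .edge + x < 2 * n) (hy : 2 * σ.v .edge + y < 2 * n)
    (hxu : σ.lo (2 * σ.v .edge + x) = u) (hyw : σ.lo (2 * σ.v .edge + y) = w)
    (hu : u < n) (hw : w < n) (hadj : T.Adj (vert hn w) (vert hn u)) :
    Ordered hn T ((appendEdge x y).run n σ) ∧
      (σ.v .cnt < ((appendEdge x y).run n σ).v .cnt ∨
        ((appendEdge x y).run n σ = σ ∧ σ.a .seen w 0 0 ≤ σ.a .seen u 0 0)) := by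
  have hc : σ.v .cnt < n := h.lt
  by_cases hs : σ.a .seen u 0 0 < σ.a .seen w 0 0
  · have h1 := h.append hu hw hadj hs
    simp only [appendEdge, endpoint, run_ite, run_seq, run_put, run_asg, ev_get, ev_lo, ev_add,
      ev_mul, ev_ofNat, ev_var, ev_lit, setA_lo, setA_v, setA_a, Nat.mod_eq_of_lt hx,
      Nat.mod_eq_of_lt hy, hxu, hyw, hs, if_true, Ordered, setV_v, setV_a,
      clamp_of_lt_self (show u < n + 2 by omega), clamp_of_lt_self (show w < n + 2 by omega),
      clamp_of_lt_self (show σ.v .cnt + 1 < n + 2 by omega),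
      clamp_of_lt_self (show 1 < n + 2 by omega)]
    simpa using h1
  · have h1 : (appendEdge x y).run n σ = σ := by
      simp [appendEdge, endpoint, Nat.mod_eq_of_lt hx, Nat.mod_eq_of_lt hy, hxu, hyw, hs]
    rw [h1]
    exact ⟨h, .inr ⟨rfl, by omega⟩⟩

/-- The memory holds a list of the edges of `T`. -/
structure HoldsEdges {n : ℕ} (hn : 0 < n) (T : SimpleGraph (Fin n)) (lo : ℕ → ℕ) : Prop where
  lt : ∀ j < n - 1, lo (2 * j + 1) < n ∧ lo (2 * j + 2) < n
  adj : ∀ j < n - 1, T.Adj (vert hn (lo (2 * j + 1))) (vert hn (lo (2 * j + 2)))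
  complete : ∀ u v : Fin n, T.Adj u v → ∃ j < n - 1,
    lo (2 * j + 1) = u ∧ lo (2 * j + 2) = v ∨ lo (2 * j + 1) = v ∧ lo (2 * j + 2) = u

/-- A pass that appends nothing has checked that `seen` agrees across every edge, and then all
vertices are reached by `PartialEdgeOrder.le_of_closed`. So each pass gains an edge until there are
`n - 1`. -/
lemma scanEdges_spec {n : ℕ} {hn : 0 < n} {T : SimpleGraph (Fin n)} {σ : Store}
    (hT : T.Connected) (hE : HoldsEdges hn T σ.lo) (h : Ordered hn T σ) :
    Ordered hn T (scanEdges.run n σ) ∧ min (n - 1) (σ.v .cnt + 1) ≤ (scanEdges.run n σ).v .cnt := by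
  have key : Ordered hn T (scanEdges.run n σ) ∧ σ.v .cnt ≤ (scanEdges.run n σ).v .cnt ∧
      (σ.v .cnt < (scanEdges.run n σ).v .cnt ∨ ∀ j < n - 1,
        (scanEdges.run n σ).a .seen (σ.lo (2 * j + 1)) 0 0 =
          (scanEdges.run n σ).a .seen (σ.lo (2 * j + 2)) 0 0) := by
    refine Stmt.loop_inv (n - 1) (by omega) rfl (by simp) (fun i τ => Ordered hn T τ ∧
      σ.v .cnt ≤ τ.v .cnt ∧ (σ.v .cnt < τ.v .cnt ∨ ∀ j < i, τ.a .seen (σ.lo (2 * j + 1)) 0 0 =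
        τ.a .seen (σ.lo (2 * j + 2)) 0 0)) ⟨h, le_rfl, .inr fun j hj => by omega⟩ ?_
    rintro i τ hi hF ⟨h1, h2, h3⟩
    have hlo : τ.lo = σ.lo := hF.lo rfl
    rw [run_seq]
    have hρ : Ordered hn T (τ.setV .edge i) := by simpa [Ordered] using h1
    have hρc : (τ.setV .edge i).v .cnt = τ.v .cnt := by simp
    have hρe : (τ.setV .edge i).v .edge = i := by simp
    have hρl : (τ.setV .edge i).lo = σ.lo := hlo
    have hρa : (τ.setV .edge i).a = τ.a := rfl
    generalize τ.setV .edge i = ρ at *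
    obtain ⟨e1, e2⟩ := hE.lt i hi
    have e3 := hE.adj i hi
    rw [← hρa, ← hρc] at h3
    rw [← hρc] at h2
    rw [← hρl] at e1 e2 e3 h3
    obtain ⟨g1, g2⟩ := appendEdge_spec (x := 1) (y := 2) hρ (by omega) (by omega)
      (by rw [hρe]) (by rw [hρe]) e1 e2 e3.symm
    have hl1 : ((appendEdge 1 2).run n ρ).lo = ρ.lo := (Stmt.frame n _ ρ).lo rfl
    have hv1 : ((appendEdge 1 2).run n ρ).v .edge = i :=
      ((Stmt.frame n _ ρ).v .edge rfl).trans hρe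
    rw [← hρl]
    generalize (appendEdge 1 2).run n ρ = ρ' at *
    rw [← hl1] at e1 e2 e3
    obtain ⟨k1, k2⟩ := appendEdge_spec (x := 2) (y := 1) g1 (by omega) (by omega)
      (by rw [hv1]) (by rw [hv1]) e2 e1 e3
    refine ⟨k1, ?_⟩
    rcases g2 with g2 | ⟨rfl, g3⟩
    · rcases k2 with k2 | ⟨k2, -⟩
      · exact ⟨by omega, .inl (by omega)⟩
      · rw [k2]; exact ⟨by omega, .inl (by omega)⟩
    · rcases k2 with k2 | ⟨k2, k3⟩
      · exact ⟨by omega, .inl (by omega)⟩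
      · rw [k2]
        refine ⟨h2, h3.imp_right fun h3 j hj => ?_⟩
        by_cases hji : j = i
        · subst hji; omega
        · exact h3 j (by omega)
  obtain ⟨k1, k2, k3⟩ := key
  refine ⟨k1, ?_⟩
  rcases k3 with k3 | k3
  · omega
  · have := k1.le_of_closed hT fun u v huv => by
      obtain ⟨j, hj, ⟨h1, h2⟩ | ⟨h1, h2⟩⟩ := hE.complete u v huv
      · have := k3 j hj
        rw [h1, h2] at this
        exact this
      · have := k3 j hj
        rw [h1, h2] at this
        exact this.symm
    omega

lemma orderEdges_spec {n : ℕ} {hn : 0 < n} {T : SimpleGraph (Fin n)} {w : ℕ → ℕ}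
    (hT : T.Connected) (hE : HoldsEdges hn T w) :
    EdgeOrder n (fun i => (orderEdges.run n (startStore w)).a .par i 0 0)
      (fun i => (orderEdges.run n (startStore w)).a .child i 0 0) ∧
    ∀ i < n - 1, T.Adj (vert hn ((orderEdges.run n (startStore w)).a .par i 0 0))
      (vert hn ((orderEdges.run n (startStore w)).a .child i 0 0)) := by
  have key : Ordered hn T (orderEdges.run n (startStore w)) ∧
      min (n - 1) n ≤ (orderEdges.run n (startStore w)).v .cnt := by
    unfold orderEdges
    rw [run_seq]
    refine Stmt.loop_inv n (by omega) rfl (by simp) (fun i τ => Ordered hn T τ ∧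
      min (n - 1) i ≤ τ.v .cnt) ⟨?_, by simp⟩ ?_
    · simp only [run_put, ev_ofNat, Ordered, setA_v, setA_a,
        clamp_of_lt_self (show 1 < n + 2 by omega)]
      refine ⟨?_, ?_, ?_, ?_, ?_, ?_, ?_⟩ <;> simp [startStore, Live]
    · rintro i τ hi hF ⟨h1, h2⟩
      have hlo : τ.lo = w := hF.lo rfl
      obtain ⟨h3, h4⟩ := scanEdges_spec (σ := τ.setV .pass i) hT (by rw [setV_lo, hlo]; exact hE)
        (by simpa [Ordered] using h1)
      refine ⟨h3, ?_⟩
      rw [show (τ.setV .pass i).v .cnt = τ.v .cnt by simp] at h4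
      omega
  obtain ⟨h1, h2⟩ := key
  have h3 : (orderEdges.run n (startStore w)).v .cnt = n - 1 := by
    have := h1.lt
    omega
  unfold Ordered at h1
  rw [h3] at h1
  exact ⟨h1.edgeOrder, h1.adj⟩

/-! ### The table of costs

The table with number `v < n` belongs to the single vertex `v`; the table with number `n + t`
results from contracting the last `t + 1` edges. The entry with indices `a`, `k` is one more than
the least number of intracluster pairs for a top cluster of size `a + 1` and `k` kept edges, and
`0` if there is none. -/

/-- The index of the edge to be contracted. -/
def edgeIdx : Ex := .len - 2 - Var.step

/-- The table of the upper endpoint. -/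
def tableL : Ex := .get .table (.get .par edgeIdx 0 0) 0 0

/-- The table of the lower endpoint. -/
def tableR : Ex := .get .table (.get .child edgeIdx 0 0) 0 0

/-- The index `x < 4` of the current combination of table entries. -/
def quadIdx : ℕ → Ex
  | 0 => Var.quad / (.len * .len * .len)
  | 1 => Var.quad / (.len * .len) % .len
  | 2 => Var.quad / .len % .len
  | _ => Var.quad % .len

/-- Combine two table entries, keeping the edge (`f = 1`) or cutting it (`f = 0`). -/
def relax (f : ℕ) : Stmt :=
  let X : Ex := .get .cost tableL (quadIdx 0) (quadIdx 1)
  let Y : Ex := .get .cost tableR (quadIdx 2) (quadIdx 3)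
  let Z : Ex := X + Y - 1 + .lit f * ((quadIdx 0 + 1) * (quadIdx 2 + 1))
  let id : Ex := .len + Var.step
  let A : Ex := quadIdx 0 + .lit f * (quadIdx 2 + 1)
  let K : Ex := quadIdx 1 + quadIdx 3 + .lit f
  let c : Ex := .get .cost id A K
  .ite 0 (X * Y) (.ite Z ((1 - c) * (.len * .len * .len + 2) + c)
    (.put .flag id A K (.lit f) ;; .put .sizeL id A K (quadIdx 0) ;;
      .put .keptL id A K (quadIdx 1) ;; .put .sizeR id A K (quadIdx 2) ;;
      .put .keptR id A K (quadIdx 3) ;; .put .cost id A K Z) .skip) .skip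

/-- Fill the table of the current step. -/
def combine : Stmt := .loop .quad 4 (.len * .len * .len * .len) (relax 0 ;; relax 1)

/-- Contract all edges, from the last one to the first. -/
def fillTables : Stmt :=
  .loop .step 1 .len (.put .cost Var.step 0 0 1 ;; .put .table Var.step 0 0 Var.step) ;;
  .loop .step 1 (.len - 1) (combine ;; .put .table (.get .par edgeIdx 0 0) 0 0 (.len + Var.step))

/-- The entry `A`, `K` of table `id` arises from entries of the tables `l` and `r`. -/
def ValidCell (n : ℕ) (a : Arr → ℕ → ℕ → ℕ → ℕ) (id l r A K : ℕ) : Prop :=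
  a .cost id A K ≠ 0 → a .flag id A K ≤ 1 ∧
    a .cost l (a .sizeL id A K) (a .keptL id A K) ≠ 0 ∧
    a .cost r (a .sizeR id A K) (a .keptR id A K) ≠ 0 ∧
    a .sizeL id A K < n ∧ a .keptL id A K < n ∧ a .sizeR id A K < n ∧ a .keptR id A K < n ∧
    A = a .sizeL id A K + a .flag id A K * (a .sizeR id A K + 1) ∧
    K = a .keptL id A K + a .keptR id A K + a .flag id A K ∧
    a .cost id A K = a .cost l (a .sizeL id A K) (a .keptL id A K) +
      a .cost r (a .sizeR id A K) (a .keptR id A K) - 1 +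
      a .flag id A K * ((a .sizeL id A K + 1) * (a .sizeR id A K + 1))

/-- Table `id` is at least as good as the combination of two given entries. -/
def Covers (n : ℕ) (a : Arr → ℕ → ℕ → ℕ → ℕ) (id l r f a₁ k₁ a₂ k₂ : ℕ) : Prop :=
  a .cost l a₁ k₁ ≠ 0 → a .cost r a₂ k₂ ≠ 0 →
    a .cost l a₁ k₁ + a .cost r a₂ k₂ - 1 + f * ((a₁ + 1) * (a₂ + 1)) < n * n * n + 2 →
    0 < a .cost id (a₁ + f * (a₂ + 1)) (k₁ + k₂ + f) ∧
    a .cost id (a₁ + f * (a₂ + 1)) (k₁ + k₂ + f) ≤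
      a .cost l a₁ k₁ + a .cost r a₂ k₂ - 1 + f * ((a₁ + 1) * (a₂ + 1))

lemma clamp_of_le_cube {n w : ℕ} (h : w < n * n * n + 2) : clamp n w = w :=
  clamp_of_le_pow (d := 3) (h.trans_le (by ring_nf; omega)) (by omega)

lemma quadIdx_setA (n x : ℕ) (σ : Store) (b : Arr) (i j k w : ℕ) :
    (quadIdx x).ev n (σ.setA b i j k w) = (quadIdx x).ev n σ := by
  rcases x with _ | _ | _ | x <;> simp [quadIdx]

lemma tableL_setA (n : ℕ) (σ : Store) {b : Arr} (h : b ≠ .table) (h' : b ≠ .par)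
    (i j k w : ℕ) : tableL.ev n (σ.setA b i j k w) = tableL.ev n σ := by
  simp [tableL, edgeIdx, h.symm, h'.symm]

lemma tableR_setA (n : ℕ) (σ : Store) {b : Arr} (h : b ≠ .table) (h' : b ≠ .child)
    (i j k w : ℕ) : tableR.ev n (σ.setA b i j k w) = tableR.ev n σ := by
  simp [tableR, edgeIdx, h.symm, h'.symm]

/-- Only the table `id` is written, so the two source tables stay fixed and the recorded choices
remain meaningful. Positive entries never increase, hence combinations covered earlier stay covered.
-/
lemma relax_spec {n t id l r a₁ k₁ a₂ k₂ f : ℕ} {σ : Store} (hid : id = n + t)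
    (ht : σ.v .step = t)
    (hl : tableL.ev n σ = l) (hr : tableR.ev n σ = r) (hli : l ≠ id) (hri : r ≠ id)
    (h0 : (quadIdx 0).ev n σ = a₁) (h1 : (quadIdx 1).ev n σ = k₁)
    (h2 : (quadIdx 2).ev n σ = a₂) (h3 : (quadIdx 3).ev n σ = k₂)
    (ha₁ : a₁ < n) (hk₁ : k₁ < n) (ha₂ : a₂ < n) (hk₂ : k₂ < n) (hf : f ≤ 1)
    (hB : ∀ A K, σ.a .cost id A K < n * n * n + 2) (hV : ∀ A K, ValidCell n σ.a id l r A K) :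
    (∀ b i, i ≠ id → ((relax f).run n σ).a b i = σ.a b i) ∧
    (∀ A K, ((relax f).run n σ).a .cost id A K < n * n * n + 2) ∧
    (∀ A K, ValidCell n ((relax f).run n σ).a id l r A K) ∧
    (∀ A K, 0 < σ.a .cost id A K → 0 < ((relax f).run n σ).a .cost id A K ∧
      ((relax f).run n σ).a .cost id A K ≤ σ.a .cost id A K) ∧
    Covers n ((relax f).run n σ).a id l r f a₁ k₁ a₂ k₂ := by
  obtain ⟨X, hX⟩ : ∃ X, X = σ.a .cost l a₁ k₁ := ⟨_, rfl⟩
  obtain ⟨Y, hY⟩ : ∃ Y, Y = σ.a .cost r a₂ k₂ := ⟨_, rfl⟩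
  obtain ⟨A, hA⟩ : ∃ A, A = a₁ + f * (a₂ + 1) := ⟨_, rfl⟩
  obtain ⟨K, hK⟩ : ∃ K, K = k₁ + k₂ + f := ⟨_, rfl⟩
  obtain ⟨Z, hZ⟩ : ∃ Z, Z = X + Y - 1 + f * ((a₁ + 1) * (a₂ + 1)) := ⟨_, rfl⟩
  obtain ⟨c, hc⟩ : ∃ c, c = σ.a .cost id A K := ⟨_, rfl⟩
  -- The first test asks that both source entries exist. The second compares with the current entry
  -- `c`: with truncated subtraction its right side is `n * n * n + 2` if `c = 0` and `c` otherwise,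
  -- so that an absent entry acts as infinity.
  by_cases hg : 0 < X * Y ∧ Z < (1 - c) * (n * n * n + 2) + c
  · have hX0 : X ≠ 0 := fun h => by simp [h] at hg
    have hY0 : Y ≠ 0 := fun h => by simp [h] at hg
    have hcB : c < n * n * n + 2 := hc ▸ hB A K
    have hZc : Z < n * n * n + 2 ∧ (0 < c → Z < c) := by
      have := hg.2
      rcases Nat.eq_zero_or_pos c with h | h
      · subst h; simpa using this
      · rw [show 1 - c = 0 by omega] at this
        simp only [zero_mul, zero_add] at this
        exact ⟨by omega, fun _ => this⟩
    have hZ1 : 1 ≤ Z := by omega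
    have key : ∀ b i j k, ((relax f).run n σ).a b i j k =
        if i = id ∧ j = A ∧ k = K then
          (match b with
            | .cost => Z | .flag => f | .sizeL => a₁ | .keptL => k₁ | .sizeR => a₂ | .keptR => k₂
            | _ => σ.a b i j k)
        else σ.a b i j k := by
      intro b i j k
      have hfn : clamp n f = f := clamp_of_lt_self (by omega)
      have hg1 := hg.1
      have hg2 := hg.2
      simp only [relax, run_ite, run_seq, run_put, ev_get, ev_add, ev_sub, ev_mul, ev_ofNat,
        ev_lit, ev_len, ev_var, quadIdx_setA, tableL_setA, tableR_setA, h0, h1, h2, h3, hl, hr,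
        setA_v, ht, ← hid, ← hA, ← hK, ← hX,
        ← hY, ← hZ, ← hc, hg1, hg2, if_true, ne_eq, reduceCtorEq, not_false_iff, hfn,
        clamp_of_lt_self (show a₁ < n + 2 by omega),
        clamp_of_lt_self (show k₁ < n + 2 by omega), clamp_of_lt_self (show a₂ < n + 2 by omega),
        clamp_of_lt_self (show k₂ < n + 2 by omega), setA_a]
      cases b <;> simp [← hZ, clamp_of_le_cube hZc.1]
    generalize (relax f).run n σ = τ at *
    have kcost : ∀ i j k, i ≠ id → τ.a .cost i j k = σ.a .cost i j k := fun i j k hi => by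
      rw [key, if_neg (by tauto)]
    refine ⟨fun b i hi => ?_, fun A' K' => ?_, fun A' K' => ?_, fun A' K' h => ?_, ?_⟩
    · funext j k
      rw [key, if_neg (by tauto)]
    · rw [key]
      split_ifs
      · exact hZc.1
      · exact hB A' K'
    · by_cases hAK : A' = A ∧ K' = K
      · obtain ⟨rfl, rfl⟩ := hAK
        have k1 := key .cost id A' K'
        have k2 := key .flag id A' K'
        have k3 := key .sizeL id A' K'
        have k4 := key .keptL id A' K'
        have k5 := key .sizeR id A' K'
        have k6 := key .keptR id A' K'
        rw [if_pos ⟨rfl, rfl, rfl⟩] at k1 k2 k3 k4 k5 k6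
        unfold ValidCell
        simp only [k1, k2, k3, k4, k5, k6, kcost _ _ _ hli, kcost _ _ _ hri, ← hX, ← hY]
        exact fun _ => ⟨hf, hX0, hY0, ha₁, hk₁, ha₂, hk₂, hA, hK, hZ⟩
      · have k : ∀ b, τ.a b id A' K' = σ.a b id A' K' := fun b => by
          rw [key, if_neg (by tauto)]
        have := hV A' K'
        unfold ValidCell at this ⊢
        simpa only [k, kcost _ _ _ hli, kcost _ _ _ hri] using this
    · rw [key]
      split_ifs with h'
      · obtain ⟨-, rfl, rfl⟩ := h'
        rw [← hc] at h ⊢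
        exact ⟨hZ1, (hZc.2 h).le⟩
      · exact ⟨h, le_rfl⟩
    · intro _ _ _
      rw [kcost _ _ _ hli, kcost _ _ _ hri, ← hX, ← hY, ← hA, ← hK, ← hZ, key,
        if_pos ⟨rfl, rfl, rfl⟩]
      exact ⟨hZ1, le_rfl⟩
  · have key : (relax f).run n σ = σ := by
      simp only [relax, run_ite, ev_get, ev_add, ev_sub, ev_mul, ev_ofNat, ev_lit, ev_len,
        ev_var, h0, h1, h2, h3, hl, hr, ht, ← hid, ← hA, ← hK, ← hX, ← hY, ← hZ, ← hc, run_skip]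
      split_ifs with g1 g2
      · exact absurd ⟨g1, g2⟩ hg
      · rfl
      · rfl
    rw [key]
    refine ⟨fun _ _ _ => rfl, hB, hV, fun A K h => ⟨h, le_rfl⟩, ?_⟩
    intro g1 g2 g3
    rw [← hX] at g1 g3 ⊢
    rw [← hY] at g2 g3 ⊢
    rw [← hA, ← hK, ← hZ, ← hc]
    rw [← hZ] at g3
    have g4 : ¬ Z < (1 - c) * (n * n * n + 2) + c := fun h =>
      hg ⟨Nat.mul_pos (by omega) (by omega), h⟩
    rcases Nat.eq_zero_or_pos c with h | h
    · subst h; simp at g4; omega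
    · rw [show 1 - c = 0 by omega] at g4
      omega

lemma Covers.mono {n id l r f a₁ k₁ a₂ k₂ : ℕ} {a a' : Arr → ℕ → ℕ → ℕ → ℕ}
    (h : Covers n a id l r f a₁ k₁ a₂ k₂) (hl : a' .cost l = a .cost l)
    (hr : a' .cost r = a .cost r)
    (hid : ∀ A K, 0 < a .cost id A K → 0 < a' .cost id A K ∧ a' .cost id A K ≤ a .cost id A K) :
    Covers n a' id l r f a₁ k₁ a₂ k₂ := by
  unfold Covers at h ⊢
  rw [hl, hr]
  intro h1 h2 h3
  obtain ⟨h4, h5⟩ := h h1 h2 h3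
  obtain ⟨h6, h7⟩ := hid _ _ h4
  exact ⟨h6, h7.trans h5⟩

/-- The four indices are the base-`n` digits of the loop counter. -/
lemma exists_quad {n a₁ k₁ a₂ k₂ : ℕ} (ha₁ : a₁ < n) (hk₁ : k₁ < n) (ha₂ : a₂ < n)
    (hk₂ : k₂ < n) : ∃ q < n * n * n * n, q / (n * n * n) = a₁ ∧ q / (n * n) % n = k₁ ∧
      q / n % n = a₂ ∧ q % n = k₂ := by
  have hn : 0 < n := by omega
  have e1 : (((a₁ * n + k₁) * n + a₂) * n + k₂) / n = (a₁ * n + k₁) * n + a₂ := by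
    rw [mul_comm _ n, Nat.mul_add_div hn, Nat.div_eq_of_lt hk₂, add_zero]
  have e2 : ((a₁ * n + k₁) * n + a₂) / n = a₁ * n + k₁ := by
    rw [mul_comm _ n, Nat.mul_add_div hn, Nat.div_eq_of_lt ha₂, add_zero]
  have e3 : (a₁ * n + k₁) / n = a₁ := by
    rw [mul_comm _ n, Nat.mul_add_div hn, Nat.div_eq_of_lt hk₁, add_zero]
  refine ⟨((a₁ * n + k₁) * n + a₂) * n + k₂, ?_, ?_, ?_, ?_, ?_⟩
  · have f1 : a₁ * n + k₁ < n * n := by nlinarith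
    have f2 : (a₁ * n + k₁) * n + a₂ < n * n * n := by nlinarith
    nlinarith
  · rw [← Nat.div_div_eq_div_mul, ← Nat.div_div_eq_div_mul, e1, e2, e3]
  · rw [← Nat.div_div_eq_div_mul, e1, e2, Nat.mul_add_mod', Nat.mod_eq_of_lt hk₁]
  · rw [e1, Nat.mul_add_mod', Nat.mod_eq_of_lt ha₂]
  · rw [Nat.mul_add_mod', Nat.mod_eq_of_lt hk₂]

lemma combine_spec {n t id l r : ℕ} {σ : Store} (hid : id = n + t) (ht : σ.v .step = t)
    (hn : 0 < n) (hl : tableL.ev n σ = l) (hr : tableR.ev n σ = r) (hli : l ≠ id) (hri : r ≠ id)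
    (hz : ∀ A K, σ.a .cost id A K = 0) :
    (∀ b i, i ≠ id → (combine.run n σ).a b i = σ.a b i) ∧
    (∀ A K, ValidCell n (combine.run n σ).a id l r A K) ∧
    ∀ f ≤ 1, ∀ a₁ < n, ∀ k₁ < n, ∀ a₂ < n, ∀ k₂ < n,
      Covers n (combine.run n σ).a id l r f a₁ k₁ a₂ k₂ := by
  have key : (∀ b i, i ≠ id → (combine.run n σ).a b i = σ.a b i) ∧
      (∀ A K, (combine.run n σ).a .cost id A K < n * n * n + 2) ∧
      (∀ A K, ValidCell n (combine.run n σ).a id l r A K) ∧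
      ∀ q < n * n * n * n, ∀ f ≤ 1, Covers n (combine.run n σ).a id l r f (q / (n * n * n))
        (q / (n * n) % n) (q / n % n) (q % n) := by
    refine Stmt.loop_inv (n * n * n * n) (by omega) rfl (by ring_nf; exact le_rfl) (fun m τ =>
      (∀ b i, i ≠ id → τ.a b i = σ.a b i) ∧ (∀ A K, τ.a .cost id A K < n * n * n + 2) ∧
      (∀ A K, ValidCell n τ.a id l r A K) ∧ ∀ q < m, ∀ f ≤ 1,
        Covers n τ.a id l r f (q / (n * n * n)) (q / (n * n) % n) (q / n % n) (q % n))
      ⟨fun _ _ _ => rfl, fun A K => by rw [hz]; omega, fun A K h => absurd (hz A K) h,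
        fun q hq => by omega⟩ ?_
    rintro q τ hq hF ⟨i1, i2, i3, i4⟩
    rw [run_seq]
    have hq1 : q / (n * n * n) < n := Nat.div_lt_of_lt_mul (by linarith)
    have hv : (τ.setV .quad q).v .step = t := by
      rw [← ht, ← hF.v .step rfl]; simp
    have hq' : (τ.setV .quad q).v .quad = q := by simp
    have hl' : tableL.ev n (τ.setV .quad q) = l := by
      rw [← hl]
      simp [tableL, edgeIdx, hF.a .par rfl, hF.a .table rfl, hF.v .step rfl]
    have hr' : tableR.ev n (τ.setV .quad q) = r := by
      rw [← hr]
      simp [tableR, edgeIdx, hF.a .child rfl, hF.a .table rfl, hF.v .step rfl]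
    rw [← setV_a τ .quad q] at i1 i2 i3 i4
    generalize τ.setV .quad q = ρ at *
    obtain ⟨j1, j2, j3, j4, j5⟩ := relax_spec (f := 0) hid hv hl' hr' hli hri
      (a₁ := q / (n * n * n)) (k₁ := q / (n * n) % n) (a₂ := q / n % n) (k₂ := q % n)
      (by simp [quadIdx, hq']) (by simp [quadIdx, hq']) (by simp [quadIdx, hq'])
      (by simp [quadIdx, hq']) hq1 (Nat.mod_lt _ hn) (Nat.mod_lt _ hn) (Nat.mod_lt _ hn)
      (by omega) i2 i3
    have hG := (relax 0).frame n ρ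
    have hv' := (hG.v .step rfl).trans hv
    have hq'' := (hG.v .quad rfl).trans hq'
    have hl'' : tableL.ev n ((relax 0).run n ρ) = l := by
      rw [← hl']
      simp [tableL, edgeIdx, hG.a .par rfl, hG.a .table rfl, hG.v .step rfl]
    have hr'' : tableR.ev n ((relax 0).run n ρ) = r := by
      rw [← hr']
      simp [tableR, edgeIdx, hG.a .child rfl, hG.a .table rfl, hG.v .step rfl]
    generalize (relax 0).run n ρ = ρ' at *
    obtain ⟨k1, k2, k3, k4, k5⟩ := relax_spec (f := 1) hid hv' hl'' hr'' hli hri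
      (a₁ := q / (n * n * n)) (k₁ := q / (n * n) % n) (a₂ := q / n % n) (k₂ := q % n)
      (by simp [quadIdx, hq'']) (by simp [quadIdx, hq'']) (by simp [quadIdx, hq''])
      (by simp [quadIdx, hq'']) hq1 (Nat.mod_lt _ hn) (Nat.mod_lt _ hn) (Nat.mod_lt _ hn)
      le_rfl j2 j3
    refine ⟨fun b i hi => by rw [k1 b i hi, j1 b i hi, i1 b i hi], k2, k3, fun q' hq' f hf => ?_⟩
    have m1 : ∀ {f a₁ k₁ a₂ k₂}, Covers n ρ'.a id l r f a₁ k₁ a₂ k₂ →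
        Covers n ((relax 1).run n ρ').a id l r f a₁ k₁ a₂ k₂ := fun h =>
      h.mono (k1 _ _ hli) (k1 _ _ hri) k4
    by_cases hqq : q' = q
    · subst hqq
      rcases Nat.le_one_iff_eq_zero_or_eq_one.1 hf with rfl | rfl
      · exact m1 j5
      · exact k5
    · exact m1 ((i4 q' (by omega) f hf).mono (j1 _ _ hli) (j1 _ _ hri) j4)
  obtain ⟨k1, -, k3, k4⟩ := key
  refine ⟨k1, k3, fun f hf a₁ ha₁ x₁ hk₁ a₂ ha₂ x₂ hk₂ => ?_⟩
  obtain ⟨q, hq, rfl, rfl, rfl, rfl⟩ := exists_quad ha₁ hk₁ ha₂ hk₂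
  exact k4 q hq f hf

/-- The number of the table of a vertex after `t` contractions. -/
def tab (n : ℕ) (par : ℕ → ℕ) : ℕ → ℕ → ℕ
  | 0, v => v
  | t + 1, v => if v = par (n - 2 - t) then n + t else tab n par t v

lemma tab_lt {n : ℕ} (par : ℕ → ℕ) (t : ℕ) {v : ℕ} (hv : v < n) : tab n par t v < n + t := by
  induction t with
  | zero => simpa [tab] using hv
  | succ t ih =>
    unfold tab
    split_ifs <;> omega

/-- The tables of the first `t` steps are correct. -/
structure Filled (n : ℕ) (par child : ℕ → ℕ) (a : Arr → ℕ → ℕ → ℕ → ℕ) (t : ℕ) : Prop where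
  leaf : ∀ v < n, ∀ A K, a .cost v A K = if A = 0 ∧ K = 0 then 1 else 0
  valid : ∀ s < t, ∀ A K, ValidCell n a (n + s) (tab n par s (par (n - 2 - s)))
    (tab n par s (child (n - 2 - s))) A K
  covers : ∀ s < t, ∀ f ≤ 1, ∀ a₁ < n, ∀ k₁ < n, ∀ a₂ < n, ∀ k₂ < n,
    Covers n a (n + s) (tab n par s (par (n - 2 - s))) (tab n par s (child (n - 2 - s)))
      f a₁ k₁ a₂ k₂

/-- A table is final after its own step: later steps write tables with larger numbers and redirect
the table number of the upper endpoint. The sources of a table always have smaller numbers, by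
`tab_lt`. -/
lemma fillTables_spec {n : ℕ} {par child : ℕ → ℕ} (h : EdgeOrder n par child) {σ : Store}
    (hp : ∀ i, σ.a .par i 0 0 = par i) (hc : ∀ i, σ.a .child i 0 0 = child i)
    (hz : ∀ id A K, σ.a .cost id A K = 0) :
    Filled n par child (fillTables.run n σ).a (n - 1) ∧
      ∀ v < n, (fillTables.run n σ).a .table v 0 0 = tab n par (n - 1) v := by
  have hn := h.pos
  unfold fillTables
  rw [run_seq]
  have init : let τ := (Stmt.loop .step 1 .len (.put .cost Var.step 0 0 1 ;;
      .put .table Var.step 0 0 Var.step)).run n σ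
      (∀ v A K, τ.a .cost v A K = if v < n ∧ A = 0 ∧ K = 0 then 1 else 0) ∧
      (∀ v < n, τ.a .table v 0 0 = v) := by
    refine Stmt.loop_inv n (by omega) rfl (by simp) (fun m τ =>
      (∀ v A K, τ.a .cost v A K = if v < m ∧ A = 0 ∧ K = 0 then 1 else 0) ∧
      (∀ v < m, τ.a .table v 0 0 = v)) ⟨fun v A K => by simp [hz], fun v hv => by omega⟩ ?_
    rintro i τ hi - ⟨h1, h2⟩
    refine ⟨fun v A K => ?_, fun v hv => ?_⟩
    · have e1 : clamp n 1 = 1 := clamp_of_lt_self (by omega)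
      simp [h1, e1]
      split_ifs <;> omega
    · have e1 : clamp n i = i := clamp_of_lt_self (by omega)
      by_cases hvi : v = i
      · subst hvi; simp [e1]
      · simpa [hvi] using h2 v (by omega)
  have hF0 := (Stmt.loop .step 1 .len (.put .cost Var.step 0 0 1 ;;
      .put .table Var.step 0 0 Var.step)).frame n σ
  obtain ⟨init1, init2⟩ := init
  have hp' := hF0.a .par rfl
  have hc' := hF0.a .child rfl
  generalize (Stmt.loop .step 1 .len (.put .cost Var.step 0 0 1 ;;
      .put .table Var.step 0 0 Var.step)).run n σ = σ₁ at *
  have key := Stmt.loop_inv (n := n) (x := .step) (d := 1) (e := .len - 1) (σ := σ₁)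
    (P := combine ;; .put .table (.get .par edgeIdx 0 0) 0 0 (.len + Var.step)) (n - 1)
    (by omega) rfl (by simp) (fun t τ => Filled n par child τ.a t ∧
      (∀ v < n, τ.a .table v 0 0 = tab n par t v) ∧
      ∀ id, n + t ≤ id → ∀ A K, τ.a .cost id A K = 0)
    ⟨⟨fun v hv A K => by rw [init1]; simp [hv], fun s hs => by omega, fun s hs => by omega⟩,
      fun v hv => by rw [init2 v hv]; rfl, fun id hid A K => by
        rw [init1, if_neg (by omega)]⟩ ?_
  · exact ⟨key.1, key.2.1⟩
  rintro t τ ht hF ⟨i1, i2, i3⟩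
  have hp2 : ∀ i, τ.a .par i 0 0 = par i := fun i => by rw [hF.a .par rfl, hp', hp]
  have hc2 : ∀ i, τ.a .child i 0 0 = child i := fun i => by rw [hF.a .child rfl, hc', hc]
  have hi : n - 2 - t < n - 1 := by omega
  have hpl := h.par_lt hi
  have hcl := h.child_lt _ hi
  have hst : (τ.setV .step t).v .step = t := by simp
  have hl := tab_lt par t hpl
  have hr := tab_lt par t hcl
  rw [run_seq]
  obtain ⟨j1, j2, j3⟩ := combine_spec (σ := τ.setV .step t) rfl hst hn
    (by simp [tableL, edgeIdx, hp2, i2 _ hpl]) (by simp [tableR, edgeIdx, hc2, i2 _ hcl])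
    hl.ne hr.ne (fun A K => i3 _ le_rfl A K)
  have hG := combine.frame n (τ.setV .step t)
  have hp3 : ∀ i, (combine.run n (τ.setV .step t)).a .par i 0 0 = par i := fun i => by
    rw [hG.a .par rfl]; exact hp2 i
  have ht3 : ∀ v < n, (combine.run n (τ.setV .step t)).a .table v 0 0 = tab n par t v :=
    fun v hv => by rw [hG.a .table rfl]; exact i2 v hv
  have hst3 : (combine.run n (τ.setV .step t)).v .step = t := (hG.v .step rfl).trans hst
  rw [setV_a] at j1
  generalize combine.run n (τ.setV .step t) = ρ at *
  have hcl1 : clamp n (n + t) = n + t :=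
    clamp_of_le_pow (d := 2) (by have : t < n := by omega
                                 nlinarith) (by omega)
  have ha : ∀ b, b ≠ .table → ∀ i j k, (ρ.setA .table (par (n - 2 - t)) 0 0 (n + t)).a b i j k =
      ρ.a b i j k := fun b hb i j k => by simp [hb]
  have hrun : (Stmt.put .table (.get .par edgeIdx 0 0) 0 0 (.len + Var.step)).run n ρ =
      ρ.setA .table (par (n - 2 - t)) 0 0 (n + t) := by
    simp [edgeIdx, hst3, hp3, hcl1]
  rw [hrun]
  -- Everything numbered below `n + t` survives step `t`, so correctness of the earlier tables
  -- carries over.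
  have hold : ∀ b, b ≠ .table → ∀ i < n + t, ∀ j k,
      (ρ.setA .table (par (n - 2 - t)) 0 0 (n + t)).a b i j k = τ.a b i j k :=
    fun b hb i hi j k => by rw [ha b hb, j1 b i (by omega)]
  refine ⟨⟨fun v hv A K => ?_, fun s hs A K => ?_, fun s hs f hf a₁ ha₁ k₁ hk₁ a₂ ha₂ k₂ hk₂ => ?_⟩,
    fun v hv => ?_, fun id hid A K => ?_⟩
  · rw [hold _ (by simp) v (by omega), i1.leaf v hv]
  · by_cases hst : s = t
    · subst hst
      have := j2 A K
      unfold ValidCell at this ⊢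
      simpa only [ha _ (show Arr.cost ≠ .table by simp), ha _ (show Arr.flag ≠ .table by simp),
        ha _ (show Arr.sizeL ≠ .table by simp), ha _ (show Arr.keptL ≠ .table by simp),
        ha _ (show Arr.sizeR ≠ .table by simp), ha _ (show Arr.keptR ≠ .table by simp)] using this
    · have hs' : s < t := by omega
      have := i1.valid s hs' A K
      have hi' : n - 2 - s < n - 1 := by omega
      have hl' := tab_lt par s (h.par_lt hi')
      have hr' := tab_lt par s (h.child_lt _ hi')
      unfold ValidCell at this ⊢
      simpa only [hold _ (show Arr.cost ≠ .table by simp) _ (show n + s < n + t by omega),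
        hold _ (show Arr.cost ≠ .table by simp) _ (hl'.trans (show n + s < n + t by omega)),
        hold _ (show Arr.cost ≠ .table by simp) _ (hr'.trans (show n + s < n + t by omega)),
        hold _ (show Arr.flag ≠ .table by simp) _ (show n + s < n + t by omega),
        hold _ (show Arr.sizeL ≠ .table by simp) _ (show n + s < n + t by omega),
        hold _ (show Arr.keptL ≠ .table by simp) _ (show n + s < n + t by omega),
        hold _ (show Arr.sizeR ≠ .table by simp) _ (show n + s < n + t by omega),
        hold _ (show Arr.keptR ≠ .table by simp) _ (show n + s < n + t by omega)] using this
  · by_cases hst : s = t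
    · subst hst
      have := j3 f hf a₁ ha₁ k₁ hk₁ a₂ ha₂ k₂ hk₂
      unfold Covers at this ⊢
      simpa only [ha _ (show Arr.cost ≠ .table by simp)] using this
    · have hs' : s < t := by omega
      have := i1.covers s hs' f hf a₁ ha₁ k₁ hk₁ a₂ ha₂ k₂ hk₂
      have hi' : n - 2 - s < n - 1 := by omega
      have hl' := tab_lt par s (h.par_lt hi')
      have hr' := tab_lt par s (h.child_lt _ hi')
      unfold Covers at this ⊢
      simpa only [hold _ (show Arr.cost ≠ .table by simp) _ (show n + s < n + t by omega),
        hold _ (show Arr.cost ≠ .table by simp) _ (hl'.trans (show n + s < n + t by omega)),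
        hold _ (show Arr.cost ≠ .table by simp) _ (hr'.trans (show n + s < n + t by omega))]
        using this
  · simp only [setA_a, tab]
    by_cases hv' : v = par (n - 2 - t)
    · simp [hv']
    · simp [hv', ht3 v hv]
  · rw [ha _ (by simp), j1 _ id (by omega), i3 id (by omega)]

/-- The tables bound the cost of every contraction from below. -/
lemma Filled.lower {n : ℕ} {par child : ℕ → ℕ} (h : EdgeOrder n par child)
    {a : Arr → ℕ → ℕ → ℕ → ℕ} (hF : Filled n par child a (n - 1)) {g : ℕ → ℕ}
    (hg : ∀ i, g i ≤ 1) (t : ℕ) (ht : t ≤ n - 1) (v : ℕ) (hv : Live child (n - 1 - t) v) :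
    0 < a .cost (tab n par t v) ((contract n par child g t).size v - 1)
      ((contract n par child g t).kept v) ∧
    a .cost (tab n par t v) ((contract n par child g t).size v - 1)
      ((contract n par child g t).kept v) ≤ (contract n par child g t).cost v + 1 := by
  have hlt : ∀ {i v}, i ≤ n - 1 → Live child i v → v < n := by
    rintro i v hi (rfl | ⟨j, hj, rfl⟩)
    · exact h.pos
    · exact h.child_lt j (by omega)
  induction t generalizing v with
  | zero =>
    simp [contract, tab, hF.leaf v (hlt (by omega) hv)]
  | succ t ih =>
    have hi : n - 2 - t < n - 1 := by omega
    have hi1 : n - 1 - t = n - 2 - t + 1 := by omega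
    have hi2 : n - 1 - (t + 1) = n - 2 - t := by omega
    rw [hi2] at hv
    have hvc := h.live_ne hv le_rfl hi
    have hvn := hlt (by omega) hv
    simp only [contract, Contraction.merge, hvc, if_false, tab]
    by_cases hvp : v = par (n - 2 - t)
    · subst hvp
      simp only [if_true]
      have hLc : Live child (n - 1 - t) (child (n - 2 - t)) := .inr ⟨n - 2 - t, by omega, rfl⟩
      have hLp := hv.mono (show n - 2 - t ≤ n - 1 - t by omega)
      obtain ⟨p1, p2⟩ := ih (by omega) _ hLp
      obtain ⟨c1, c2⟩ := ih (by omega) _ hLc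
      obtain ⟨s1, -, -, -, -⟩ := contract_spec h hg t (by omega)
      have sp := s1 _ hLp
      have sc := s1 _ hLc
      have sp' := contract_size_le h hg (t := t) (by omega) hvn
      have sc' := contract_size_le h hg (t := t) (by omega) (h.child_lt _ hi)
      have kp := contract_kept_lt h hg (t := t) (by omega) hvn
      have kc := contract_kept_lt h hg (t := t) (by omega) (h.child_lt _ hi)
      have hcost := contract_cost_le h hg (t := t + 1) ht hvn
      simp only [contract, Contraction.merge, hvc, if_false, if_true] at hcost
      have hcov := hF.covers t (by omega) _ (hg (n - 2 - t)) _
        (show (contract n par child g t).size (par (n - 2 - t)) - 1 < n by omega) _ kp _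
        (show (contract n par child g t).size (child (n - 2 - t)) - 1 < n by omega) _ kc
        (by omega) (by omega)
      rw [Nat.sub_add_cancel sp, Nat.sub_add_cancel sc] at hcov
      -- With this the combined cost is below `n * n * n + 2`, the cutoff under which `Covers` gives
      -- information.
      have hb : (t + 1) * (n * n) ≤ n * n * n := by
        rw [mul_comm]; exact Nat.mul_le_mul_left _ (by omega)
      obtain ⟨d1, d2⟩ := hcov (by omega)
      have e : (contract n par child g t).size (par (n - 2 - t)) +
          g (n - 2 - t) * (contract n par child g t).size (child (n - 2 - t)) - 1 =
          (contract n par child g t).size (par (n - 2 - t)) - 1 +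
          g (n - 2 - t) * (contract n par child g t).size (child (n - 2 - t)) := by omega
      rw [e]
      exact ⟨d1, d2.trans (by omega)⟩
    · simp only [hvp, if_false]
      exact ih (by omega) v (hv.mono (by omega))

/-! ### Comparing the tails

Numbers are written with `n` digits in base `n ^ 2 + 2`. -/

/-- The base of the number system. -/
def base : Ex := .len * .len + 2

/-- The sum of two digits and the carry, in the row to be changed. -/
def digitSum : Ex :=
  .get .digit (.len - 1 - Var.row) Var.dig 0 + .get .digit (.len - 2 - Var.row) Var.dig 0 +
    Var.carry

/-- Add a row to the next one. -/
def addRow : Stmt :=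
  .asg .carry 0 ;; .loop .dig 1 .len (.ite digitSum base
    (.put .digit (.len - 1 - Var.row) Var.dig 0 digitSum ;; .asg .carry 0)
    (.put .digit (.len - 1 - Var.row) Var.dig 0 (digitSum - base) ;; .asg .carry 1))

/-- One step in Pascal's triangle. -/
def pascalRow : Stmt := .loop .row 1 (.len - 1) addRow

/-- Set the first `e` rows to zero. -/
def clearRows (e : Ex) : Stmt :=
  .loop .row 1 e (.loop .dig 1 .len (.put .digit Var.row Var.dig 0 0))

/-- Compare the last row with the best one. -/
def compareBest : Stmt :=
  .asg .less 0 ;; .loop .dig 1 .len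
    (.ite (.get .digit (.len - 1) Var.dig 0) (.get .best Var.dig 0 0) (.asg .less 1)
      (.ite (.get .best Var.dig 0 0) (.get .digit (.len - 1) Var.dig 0) (.asg .less 0) .skip))

/-- The final table entry for the current numbers of vertices and kept edges. -/
def finalEntry : Ex := .get .cost (.get .table 0 0 0) Var.size Var.kept

/-- Find the least entry for the current number of kept edges. -/
def minEntry : Stmt :=
  .asg .minCost 0 ;; .loop .size 1 .len (.ite 0 finalEntry
    (.ite finalEntry ((1 - Var.minCost) * (.len * .len * .len + 2) + Var.minCost)
      (.asg .minCost finalEntry ;; .asg .minSize Var.size) .skip) .skip)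

/-- Compute the numerator of the tail for the current number of kept edges. -/
def computeTail : Stmt :=
  clearRows .len ;; .put .digit 0 0 0 1 ;; .loop .inner 2 (Var.minCost - 1) pascalRow ;;
    clearRows Var.kept ;;
    .loop .inner 2 (.len * (.len - 1) / 2 - (Var.minCost - 1)) pascalRow

/-- Replace the best row by the last one. -/
def updateBest : Stmt :=
  .loop .dig 1 .len (.put .best Var.dig 0 0 (.get .digit (.len - 1) Var.dig 0)) ;;
    .asg .bestKept Var.kept ;; .asg .bestSize Var.minSize

/-- Find the number of kept edges with the least tail. -/
def chooseBest : Stmt :=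
  .loop .kept 1 .len (minEntry ;; computeTail ;; compareBest ;;
    .ite Var.kept (1 + Var.less * .len) updateBest .skip)

/-- The value of a sequence of digits. -/
def digitVal (n m : ℕ) (g : ℕ → ℕ) : ℕ := ∑ d ∈ Finset.range m, g d * (n * n + 2) ^ d

lemma digitVal_congr {n m : ℕ} {g g' : ℕ → ℕ} (h : ∀ d < m, g d = g' d) :
    digitVal n m g = digitVal n m g' :=
  Finset.sum_congr rfl fun d hd => by rw [h d (Finset.mem_range.1 hd)]

lemma digitVal_succ (n m : ℕ) (g : ℕ → ℕ) :
    digitVal n (m + 1) g = digitVal n m g + g m * (n * n + 2) ^ m := Finset.sum_range_succ _ _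

lemma digitVal_lt {n m : ℕ} {g : ℕ → ℕ} (h : ∀ d < m, g d < n * n + 2) :
    digitVal n m g < (n * n + 2) ^ m := by
  induction m with
  | zero => simp [digitVal]
  | succ m ih =>
    rw [digitVal_succ, pow_succ]
    have h1 := ih fun d hd => h d (by omega)
    have h2 : g m + 1 ≤ n * n + 2 := h m (by omega)
    have h3 := Nat.mul_le_mul_left ((n * n + 2) ^ m) h2
    nlinarith

/-- The digits `g` represent `x`. -/
def Represents (n : ℕ) (g : ℕ → ℕ) (x : ℕ) : Prop :=
  (∀ d < n, g d < n * n + 2) ∧ digitVal n n g = x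

lemma Represents.congr {n : ℕ} {g g' : ℕ → ℕ} {x : ℕ} (h : Represents n g x)
    (hg : ∀ d < n, g' d = g d) : Represents n g' x :=
  ⟨fun d hd => by rw [hg d hd]; exact h.1 d hd, by rw [digitVal_congr hg]; exact h.2⟩

lemma clamp_of_le_square {n w : ℕ} (h : w < n * n + 2) : clamp n w = w :=
  clamp_of_le_pow (d := 2) (h.trans_le (by ring_nf; omega)) (by omega)

/-- Schoolbook addition in place: after `m` digits, the digits written and the carry together
represent the sum of the two numbers truncated to `m` digits. -/
lemma addRow_spec {n i x y : ℕ} {σ : Store} (hi : i < n - 1) (hrow : σ.v .row = i)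
    (hx : Represents n (fun d => σ.a .digit (n - 1 - i) d 0) x)
    (hy : Represents n (fun d => σ.a .digit (n - 2 - i) d 0) y)
    (hxy : x + y < (n * n + 2) ^ n) :
    (∀ j, j ≠ n - 1 - i → ∀ d, (addRow.run n σ).a .digit j d 0 = σ.a .digit j d 0) ∧
      Represents n (fun d => (addRow.run n σ).a .digit (n - 1 - i) d 0) (x + y) := by
  have hne : n - 2 - i ≠ n - 1 - i := by omega
  unfold addRow
  rw [run_seq]
  have key := Stmt.loop_inv (n := n) (x := .dig) (d := 1) (e := .len)
    (σ := (Stmt.asg .carry 0).run n σ) (P := .ite digitSum base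
      (.put .digit (.len - 1 - Var.row) Var.dig 0 digitSum ;; .asg .carry 0)
      (.put .digit (.len - 1 - Var.row) Var.dig 0 (digitSum - base) ;; .asg .carry 1))
    n (by omega) rfl (by simp) (fun m τ =>
      (∀ j, j ≠ n - 1 - i → ∀ d, τ.a .digit j d 0 = σ.a .digit j d 0) ∧
      (∀ d, m ≤ d → τ.a .digit (n - 1 - i) d 0 = σ.a .digit (n - 1 - i) d 0) ∧
      (∀ d < m, τ.a .digit (n - 1 - i) d 0 < n * n + 2) ∧ τ.v .carry ≤ 1 ∧
      digitVal n m (fun d => τ.a .digit (n - 1 - i) d 0) + τ.v .carry * (n * n + 2) ^ m =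
        digitVal n m (fun d => σ.a .digit (n - 1 - i) d 0) +
          digitVal n m (fun d => σ.a .digit (n - 2 - i) d 0)) ?_ ?_
  · obtain ⟨k1, -, k3, k4, k5⟩ := key
    rw [hx.2, hy.2] at k5
    refine ⟨k1, k3, ?_⟩
    -- A carry left over after `n` digits would push the sum to at least `(n * n + 2) ^ n`.
    rcases Nat.eq_zero_or_pos (Store.v (Stmt.run n _ _) .carry) with h0 | h0
    · rw [h0] at k5
      simpa using k5
    · have := Nat.mul_le_mul_right ((n * n + 2) ^ n) h0
      omega
  · refine ⟨fun _ _ _ => rfl, fun _ _ => rfl, fun _ _ => by omega, ?_, ?_⟩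
    · simp [clamp_of_lt_self]
    · simp [digitVal, clamp_of_lt_self]
  · rintro m τ hm hF ⟨i1, i2, i3, i4, i5⟩
    have hrow' : τ.v .row = i := by rw [hF.v .row rfl]; simpa using hrow
    obtain ⟨T, hT⟩ : ∃ T, T = σ.a .digit (n - 1 - i) m 0 + σ.a .digit (n - 2 - i) m 0 +
      τ.v .carry := ⟨_, rfl⟩
    have hsum : digitSum.ev n (τ.setV .dig m) = T := by
      simp [digitSum, hrow', hT, i2 m le_rfl, i1 _ hne]
    have hx1 : σ.a .digit (n - 1 - i) m 0 < n * n + 2 := hx.1 m hm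
    have hy1 : σ.a .digit (n - 2 - i) m 0 < n * n + 2 := hy.1 m hm
    have hb : base.ev n (τ.setV .dig m) = n * n + 2 := by simp [base]
    -- `D` is the new digit and `C` the new carry. One subtraction of the base is enough, since two
    -- digits and a carry sum to less than twice the base.
    obtain ⟨D, C, hD, hC, hDC, hrun⟩ : ∃ D C, D < n * n + 2 ∧ C ≤ 1 ∧ D + C * (n * n + 2) = T ∧
        (Stmt.ite digitSum base
          (.put .digit (.len - 1 - Var.row) Var.dig 0 digitSum ;; .asg .carry 0)
          (.put .digit (.len - 1 - Var.row) Var.dig 0 (digitSum - base) ;; .asg .carry 1)).run n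
            (τ.setV .dig m) =
          ((τ.setV .dig m).setA .digit (n - 1 - i) m 0 D).setV .carry C := by
      by_cases hlt : T < n * n + 2
      · refine ⟨T, 0, hlt, by omega, by omega, ?_⟩
        simp [hsum, hb, hlt, hrow', clamp_of_le_square hlt, clamp_of_lt_self]
      · have hlt' : T - (n * n + 2) < n * n + 2 := by omega
        refine ⟨T - (n * n + 2), 1, hlt', le_rfl, by omega, ?_⟩
        simp [hsum, hb, hlt, hrow', clamp_of_le_square hlt', clamp_of_lt_self]
    rw [hrun]
    have hdig : ∀ d, (((τ.setV .dig m).setA .digit (n - 1 - i) m 0 D).setV .carry C).a .digit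
        (n - 1 - i) d 0 = if d = m then D else τ.a .digit (n - 1 - i) d 0 := fun d => by simp
    refine ⟨fun j hj d => ?_, fun d hd => ?_, fun d hd => ?_, ?_, ?_⟩
    · simp [hj, i1 j hj]
    · rw [hdig, if_neg (by omega), i2 d (by omega)]
    · rw [hdig]
      split_ifs with h
      · exact hD
      · exact i3 d (by omega)
    · simpa using hC
    · simp only [hdig]
      rw [digitVal_succ, digitVal_succ, digitVal_succ,
        digitVal_congr (g' := fun d => τ.a .digit (n - 1 - i) d 0)
          (fun d hd => if_neg (by omega)), if_pos rfl]
      simp only [setV_v, if_true]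
      have h1 : (D + C * (n * n + 2)) * (n * n + 2) ^ m = T * (n * n + 2) ^ m := by rw [hDC]
      rw [hT] at h1
      rw [pow_succ]
      linarith

/-- The rows of digits represent the numbers `R j`. -/
def RowsAre (n : ℕ) (σ : Store) (R : ℕ → ℕ) : Prop :=
  ∀ j < n, Represents n (fun d => σ.a .digit j d 0) (R j)

/-- Updating from the highest index downwards allows a single copy: entry `j - 1` still has its old
value when it is added to entry `j`. -/
lemma pascalRow_spec {n : ℕ} {σ : Store} {R : ℕ → ℕ} (h : RowsAre n σ R)
    (hR : ∀ j < n, pascalStep R j < (n * n + 2) ^ n) :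
    RowsAre n (pascalRow.run n σ) (pascalStep R) := by
  unfold pascalRow
  have key := Stmt.loop_inv (n := n) (x := .row) (d := 1) (e := .len - 1) (σ := σ) (P := addRow)
    (n - 1) (by omega) rfl (by simp)
    (fun i τ => RowsAre n τ fun j => if n - 1 - i < j then pascalStep R j else R j) ?_ ?_
  · intro j hj
    have := key j hj
    rcases Nat.eq_zero_or_pos j with rfl | h0
    · simpa [pascalStep] using this
    · simpa only [Nat.sub_self, h0, if_true] using this
  · intro j hj
    simpa [show ¬ n - 1 < j by omega] using h j hj
  · intro i τ hi _ ih
    have hx := ih (n - 1 - i) (by omega)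
    have hy := ih (n - 2 - i) (by omega)
    simp only [lt_irrefl, if_false, show ¬ n - 1 - i < n - 2 - i by omega] at hx hy
    have hs : R (n - 1 - i) + R (n - 2 - i) = pascalStep R (n - 1 - i) := by
      rw [show n - 1 - i = n - 2 - i + 1 by omega]
      rfl
    obtain ⟨k1, k2⟩ := addRow_spec (σ := τ.setV .row i) hi (by simp) hx hy
      (by rw [hs]; exact hR _ (by omega))
    intro j hj
    by_cases hji : j = n - 1 - i
    · subst hji
      rw [hs] at k2
      simpa [show n - 1 - (i + 1) < n - 1 - i by omega] using k2
    · have h1 : n - 1 - (i + 1) < j ↔ n - 1 - i < j := by omega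
      simp only [h1]
      exact (ih j hj).congr fun d _ => k1 j hji d

lemma pascalRows_spec {n x : ℕ} {e : Ex} {σ : Store} {R : ℕ → ℕ} (h : RowsAre n σ R)
    (he : e.ev n σ = x) (hx : x ≤ n ^ 2)
    (hR : ∀ i ≤ x, ∀ j < n, pascalStep^[i] R j < (n * n + 2) ^ n) :
    RowsAre n ((Stmt.loop .inner 2 e pascalRow).run n σ) (pascalStep^[x] R) := by
  refine Stmt.loop_inv x (by omega) he hx (fun i τ => RowsAre n τ (pascalStep^[i] R)) h ?_
  intro i τ hi _ ih
  rw [Function.iterate_succ_apply']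
  refine pascalRow_spec (σ := τ.setV .inner i) ih fun j hj => ?_
  have := hR (i + 1) (by omega) j hj
  rwa [Function.iterate_succ_apply'] at this

lemma clearRows_spec {n x : ℕ} {e : Ex} {σ : Store} (he : e.ev n σ = x) (hx : x ≤ n)
    (j d : ℕ) (hd : d < n) : ((clearRows e).run n σ).a .digit j d 0 =
      if j < x then 0 else σ.a .digit j d 0 := by
  have key := Stmt.loop_inv (n := n) (x := .row) (d := 1) (e := e) (σ := σ)
    (P := .loop .dig 1 .len (.put .digit Var.row Var.dig 0 0)) x (by omega) he (by simpa using hx)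
    (fun i τ => ∀ j, ∀ d < n, τ.a .digit j d 0 = if j < i then 0 else σ.a .digit j d 0) ?_ ?_
  · exact key j d hd
  · intro j d _; simp
  · intro i τ hi _ ih
    have key' := Stmt.loop_inv (n := n) (x := .dig) (d := 1) (e := .len) (σ := τ.setV .row i)
      (P := .put .digit Var.row Var.dig 0 0) n (by omega) rfl (by simp)
      (fun m ρ => ∀ j d, ρ.a .digit j d 0 = if j = i ∧ d < m then 0 else τ.a .digit j d 0) ?_ ?_
    · intro j d hd
      rw [key' j d, ih j d hd]
      split_ifs <;> first | rfl | omega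
    · intro j d; simp
    · intro m ρ hm hF ih' j d
      have hr : ρ.v .row = i := by rw [hF.v .row rfl]; simp
      simp [hr, ih', clamp_of_lt_self]
      split_ifs <;> first | rfl | omega

lemma represents_zero {n : ℕ} {g : ℕ → ℕ} (hg : ∀ d < n, g d = 0) : Represents n g 0 :=
  ⟨fun d hd => by rw [hg d hd]; omega, by
    rw [digitVal_congr (g' := fun _ => 0) hg]; simp [digitVal]⟩

/-- Column indices are below `n` and row indices at most `n ^ 2`, so `n` digits in base `n ^ 2 + 2`
hold every entry. -/
lemma choose_lt_base_pow {n x j : ℕ} (hx : x ≤ n ^ 2) (hj : j < n) :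
    x.choose j < (n * n + 2) ^ n := by
  calc x.choose j ≤ x ^ j := Nat.choose_le_pow x j
    _ ≤ (n * n + 2) ^ j := Nat.pow_le_pow_left (by rw [sq] at hx; omega) j
    _ < (n * n + 2) ^ n := Nat.pow_lt_pow_right (by omega) hj

/-- The code carries out `tailNum_eq_pascalStep`. Since `minCost` is one more than the number of
pairs, the first loop makes `ip` steps and the second `n.choose 2 - ip`. Only columns below `n` are
needed, as the tail is read in column `n - 1`. -/
lemma computeTail_spec {n k ip : ℕ} {σ : Store} (hn : 0 < n) (hk : σ.v .kept = k) (hkn : k < n)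
    (hip : σ.v .minCost = ip + 1) (hp : ip ≤ n.choose 2) :
    Represents n (fun d => (computeTail.run n σ).a .digit (n - 1) d 0)
      (tailNum (n.choose 2) (n - 1) ip k) := by
  have hpn : n.choose 2 ≤ n ^ 2 := Nat.choose_le_pow n 2
  unfold computeTail
  simp only [run_seq]
  have h1 := clearRows_spec (n := n) (e := .len) (σ := σ) rfl le_rfl
  have hF1 := (clearRows .len).frame n σ
  have hk1 := (hF1.v .kept rfl).trans hk
  have hi1 := (hF1.v .minCost rfl).trans hip
  generalize (clearRows .len).run n σ = σ₁ at *
  have h2 : RowsAre n ((Stmt.put .digit 0 0 0 1).run n σ₁) pascalZero := by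
    intro j hj
    have e : ∀ d < n, ((Stmt.put .digit 0 0 0 1).run n σ₁).a .digit j d 0 =
        if j = 0 ∧ d = 0 then 1 else 0 := fun d hd => by
      simp [h1 j d hd, hj, clamp_of_lt_self (show 1 < n + 2 by omega)]
    by_cases hj0 : j = 0
    · subst hj0
      refine Represents.congr (g := fun d => if d = 0 then 1 else 0) ⟨fun d _ => ?_, ?_⟩
        fun d hd => by simpa using e d hd
      · dsimp only
        split_ifs <;> omega
      · rw [digitVal, Finset.sum_eq_single_of_mem 0 (Finset.mem_range.2 hn)]
        · simp [pascalZero]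
        · intro d _ hd; simp [hd]
    · rw [show pascalZero j = 0 by simp [pascalZero, hj0]]
      exact represents_zero fun d hd => by simpa [hj0] using e d hd
  have hk2 : ((Stmt.put .digit 0 0 0 1).run n σ₁).v .kept = k := hk1
  have hi2 : ((Stmt.put .digit 0 0 0 1).run n σ₁).v .minCost = ip + 1 := hi1
  generalize (Stmt.put .digit 0 0 0 1).run n σ₁ = σ₂ at *
  have h3 := pascalRows_spec (e := Var.minCost - 1) (x := ip) h2 (by simp [hi2]) (by omega)
    (fun i hi j hj => by
      rw [pascalStep_iterate_zero]; exact choose_lt_base_pow (by omega) hj)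
  rw [pascalStep_iterate_zero] at h3
  have hF3 := (Stmt.loop .inner 2 (Var.minCost - 1) pascalRow).frame n σ₂
  have hk3 := (hF3.v .kept rfl).trans hk2
  have hi3 := (hF3.v .minCost rfl).trans hi2
  generalize (Stmt.loop .inner 2 (Var.minCost - 1) pascalRow).run n σ₂ = σ₃ at *
  have h4 := clearRows_spec (n := n) (e := Var.kept) (σ := σ₃) hk3 hkn.le
  have h4' : RowsAre n ((clearRows Var.kept).run n σ₃) (cutRow ip k) := by
    intro j hj
    unfold cutRow
    split_ifs with hjk
    · exact represents_zero fun d hd => by rw [h4 j d hd, if_pos hjk]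
    · exact (h3 j hj).congr fun d hd => by rw [h4 j d hd, if_neg hjk]
  have hF4 := (clearRows Var.kept).frame n σ₃
  have hi4 := (hF4.v .minCost rfl).trans hi3
  generalize (clearRows Var.kept).run n σ₃ = σ₄ at *
  have h5 := pascalRows_spec (e := .len * (.len - 1) / 2 - (Var.minCost - 1))
    (x := n.choose 2 - ip) h4' (by simp [hi4, Nat.choose_two_right]) (by omega)
    (fun i hi j hj => (pascalStep_iterate_le (cutRow_le ip k) i j).trans_lt
      (choose_lt_base_pow (by omega) hj))
  rw [tailNum_eq_pascalStep]
  exact h5 (n - 1) (by omega)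

/-- The scan goes from the least significant digit upwards: a differing digit overrules all earlier
ones, an equal digit leaves the verdict. -/
lemma compareBest_spec {n x y : ℕ} {σ : Store}
    (hx : Represents n (fun d => σ.a .digit (n - 1) d 0) x)
    (hy : Represents n (fun d => σ.a .best d 0 0) y) :
    (compareBest.run n σ).v .less = if x < y then 1 else 0 := by
  unfold compareBest
  rw [run_seq]
  have key := Stmt.loop_inv (n := n) (x := .dig) (d := 1) (e := .len)
    (σ := (Stmt.asg .less 0).run n σ) (P := .ite (.get .digit (.len - 1) Var.dig 0)
      (.get .best Var.dig 0 0) (.asg .less 1)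
      (.ite (.get .best Var.dig 0 0) (.get .digit (.len - 1) Var.dig 0) (.asg .less 0) .skip))
    n (by omega) rfl (by simp) (fun m τ => τ.v .less =
      if digitVal n m (fun d => σ.a .digit (n - 1) d 0) < digitVal n m (fun d => σ.a .best d 0 0)
      then 1 else 0) ?_ ?_
  · rw [key, hx.2, hy.2]
  · simp [digitVal, clamp_of_lt_self]
  · intro m τ hm hF ih
    have h1 : τ.a = σ.a := by
      funext b; exact hF.a b (by cases b <;> rfl)
    have hX := digitVal_lt (n := n) (m := m) fun d hd => hx.1 d (by omega)
    have hY := digitVal_lt (n := n) (m := m) fun d hd => hy.1 d (by omega)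
    simp only [digitVal_succ]
    generalize digitVal n m (fun d => σ.a .digit (n - 1) d 0) = X at *
    generalize digitVal n m (fun d => σ.a .best d 0 0) = Y at *
    simp only [run_ite, ev_get, ev_sub, ev_len, ev_ofNat, ev_var, setV_v, if_true, setV_a, h1,
      run_asg, run_skip, clamp_of_lt_self (show 1 < n + 2 by omega),
      clamp_of_lt_self (show 0 < n + 2 by omega)]
    generalize σ.a .digit (n - 1) m 0 = u at *
    generalize σ.a .best m 0 0 = w at *
    rcases lt_trichotomy u w with h | h | h
    · have := Nat.mul_le_mul_right ((n * n + 2) ^ m) (show u + 1 ≤ w from h)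
      rw [Nat.add_mul] at this
      simp only [h, if_true, setV_v]
      rw [if_pos (by omega)]
    · subst h
      simp [ih]
    · have := Nat.mul_le_mul_right ((n * n + 2) ^ m) (show w + 1 ≤ u from h)
      rw [Nat.add_mul] at this
      simp only [h, h.not_gt, if_true, if_false, setV_v]
      rw [if_neg (by omega)]

/-- A zero in `minCost` means that nothing has been found. Any other value is an actual entry and at
least `w`, so once the value `w` has been met it stays. -/
lemma minEntry_spec {n root k w : ℕ} {σ : Store} (hroot : σ.a .table 0 0 0 = root)
    (hk : σ.v .kept = k) (hw0 : 0 < w) (hw : w < n * n * n + 2)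
    (hex : ∃ A < n, σ.a .cost root A k = w)
    (hmin : ∀ A < n, 0 < σ.a .cost root A k → w ≤ σ.a .cost root A k) :
    (minEntry.run n σ).v .minCost = w ∧ (minEntry.run n σ).v .minSize < n ∧
      σ.a .cost root ((minEntry.run n σ).v .minSize) k = w := by
  unfold minEntry
  rw [run_seq]
  have key := Stmt.loop_inv (n := n) (x := .size) (d := 1) (e := .len)
    (σ := (Stmt.asg .minCost 0).run n σ) (P := .ite 0 finalEntry
    (.ite finalEntry ((1 - Var.minCost) * (.len * .len * .len + 2) + Var.minCost)
      (.asg .minCost finalEntry ;; .asg .minSize Var.size) .skip) .skip)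
    n (by omega) rfl (by simp) (fun m τ => τ.v .minCost < n * n * n + 2 ∧
      (τ.v .minCost ≠ 0 → w ≤ τ.v .minCost ∧ τ.v .minSize < n ∧
        σ.a .cost root (τ.v .minSize) k = τ.v .minCost) ∧
      ∀ A < m, σ.a .cost root A k = w → τ.v .minCost = w) ?_ ?_
  · obtain ⟨-, k2, k3⟩ := key
    obtain ⟨A, hA, hA'⟩ := hex
    have h1 := k3 A hA hA'
    obtain ⟨-, h2, h3⟩ := k2 (by omega)
    exact ⟨h1, h2, h3.trans h1⟩
  · refine ⟨?_, ?_, fun A hA => by omega⟩ <;> simp [clamp_of_lt_self]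
  · rintro A τ hA hF ⟨i1, i2, i3⟩
    have h1 : τ.a = σ.a := by
      funext b; exact hF.a b (by cases b <;> rfl)
    have h2 : τ.v .kept = k := by rw [hF.v .kept rfl]; simpa using hk
    obtain ⟨c, hc⟩ : ∃ c, c = σ.a .cost root A k := ⟨_, rfl⟩
    have hfin : ∀ ρ : Store, ρ.a = σ.a → ρ.v .kept = k → ρ.v .size = A →
        finalEntry.ev n ρ = c := fun ρ e1 e2 e3 => by
      simp [finalEntry, e1, e2, e3, hroot, hc]
    have hf0 : finalEntry.ev n (τ.setV .size A) = c := hfin _ h1 (by simpa using h2) (by simp)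
    simp only [run_ite, run_seq, run_asg, run_skip, hf0, ev_ofNat, ev_add, ev_mul, ev_sub,
      ev_len, ev_var, setV_v, reduceCtorEq, if_false, if_true]
    generalize hmc : τ.v .minCost = mc at *
    have hmin' := hmin A hA
    rw [← hc] at hmin'
    by_cases hg : 0 < c ∧ c < (1 - mc) * (n * n * n + 2) + mc
    · have hcB : c < n * n * n + 2 := by
        have := hg.2
        rcases Nat.eq_zero_or_pos mc with h | h
        · subst h; simpa using this
        · rw [show 1 - mc = 0 by omega] at this; omega
      rw [if_pos hg.1, if_pos hg.2, clamp_of_le_cube hcB, clamp_of_lt_self (by omega)]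
      simp only [setV_v, reduceCtorEq, if_false, if_true]
      refine ⟨hcB, fun _ => ⟨hmin' hg.1, hA, hc.symm⟩, fun A' hA' hw' => ?_⟩
      by_cases hAA : A' = A
      · subst hAA; omega
      · have := i3 A' (by omega) hw'
        have h3 := hmin' hg.1
        have h4 := hg.2
        rw [show 1 - mc = 0 by omega] at h4
        omega
    · have : (if 0 < c then if c < (1 - mc) * (n * n * n + 2) + mc then
          ((τ.setV .size A).setV .minCost (clamp n c)).setV .minSize (clamp n A)
          else τ.setV .size A else τ.setV .size A) = τ.setV .size A := by
        split_ifs with g1 g2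
        · exact absurd ⟨g1, g2⟩ hg
        · rfl
        · rfl
      rw [this]
      simp only [setV_v, reduceCtorEq, if_false, hmc]
      refine ⟨i1, i2, fun A' hA' hw' => ?_⟩
      by_cases hAA : A' = A
      · subst hAA
        have hcw : c = w := hc.trans hw'
        by_contra hne
        apply hg
        refine ⟨by omega, ?_⟩
        rcases Nat.eq_zero_or_pos mc with h | h
        · subst h; simp; omega
        · have := (i2 (by omega)).1
          omega
      · exact i3 A' (by omega) hw'

/-- The invariant holds the best choice among the edge counts tried so far, with the digits of its
tail in `best`; it says nothing before the first round. -/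
lemma chooseBest_spec {n root : ℕ} {σ : Store} {V : ℕ → ℕ} (hn : 0 < n)
    (hroot : σ.a .table 0 0 0 = root)
    (hex : ∀ k < n, ∃ A < n, σ.a .cost root A k = V k + 1)
    (hmin : ∀ k < n, ∀ A < n, 0 < σ.a .cost root A k → V k + 1 ≤ σ.a .cost root A k)
    (hV : ∀ k < n, V k ≤ n.choose 2) :
    ∃ k A, (chooseBest.run n σ).v .bestKept = k ∧ (chooseBest.run n σ).v .bestSize = A ∧ k < n ∧
      A < n ∧ σ.a .cost root A k = V k + 1 ∧ ∀ k' < n,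
        tailNum (n.choose 2) (n - 1) (V k) k ≤ tailNum (n.choose 2) (n - 1) (V k') k' := by
  have hpn : n.choose 2 ≤ n * n := by
    have := Nat.choose_le_pow n 2
    rwa [sq] at this
  have key := Stmt.loop_inv (n := n) (x := .kept) (d := 1) (e := .len) (σ := σ)
    (P := minEntry ;; computeTail ;; compareBest ;;
      .ite Var.kept (1 + Var.less * .len) updateBest .skip)
    n (by omega) rfl (by simp) (fun m τ => 0 < m → ∃ k A, τ.v .bestKept = k ∧
      τ.v .bestSize = A ∧ k < m ∧ A < n ∧ σ.a .cost root A k = V k + 1 ∧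
      Represents n (fun d => τ.a .best d 0 0) (tailNum (n.choose 2) (n - 1) (V k) k) ∧
      ∀ k' < m, tailNum (n.choose 2) (n - 1) (V k) k ≤ tailNum (n.choose 2) (n - 1) (V k') k')
    (fun h => absurd h (lt_irrefl 0)) ?_
  · obtain ⟨k, A, h1, h2, h3, h4, h5, -, h7⟩ := key hn
    exact ⟨k, A, h1, h2, h3, h4, h5, h7⟩
  intro m τ hm hF ih _
  have hco : τ.a .cost = σ.a .cost := hF.a .cost rfl
  have hta : τ.a .table = σ.a .table := hF.a .table rfl
  simp only [run_seq]
  have hkept : (τ.setV .kept m).v .kept = m := by simp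
  obtain ⟨a1, a2, a3⟩ := minEntry_spec (n := n) (root := root) (k := m) (w := V m + 1)
    (σ := τ.setV .kept m) (by rw [setV_a, hta, hroot]) hkept (by omega)
    (by have := hV m hm
        have h2 : n * n * 1 ≤ n * n * n := Nat.mul_le_mul_left _ hn
        omega)
    (by rw [setV_a, hco]; exact hex m hm) (by rw [setV_a, hco]; exact hmin m hm)
  have hF1 := minEntry.frame n (τ.setV .kept m)
  rw [setV_a, hco] at a3
  have b1 := (hF1.v .kept rfl).trans hkept
  have b2 : (minEntry.run n (τ.setV .kept m)).a .best = τ.a .best := hF1.a .best rfl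
  have b3 : (minEntry.run n (τ.setV .kept m)).v .bestKept = τ.v .bestKept := by
    rw [hF1.v .bestKept rfl]; simp
  have b4 : (minEntry.run n (τ.setV .kept m)).v .bestSize = τ.v .bestSize := by
    rw [hF1.v .bestSize rfl]; simp
  generalize minEntry.run n (τ.setV .kept m) = σ₁ at *
  have t1 := computeTail_spec hn b1 hm a1 (hV m hm)
  have hF2 := computeTail.frame n σ₁
  have c1 := (hF2.v .kept rfl).trans b1
  have c2 := (hF2.a .best rfl).trans b2
  have c3 := (hF2.v .bestKept rfl).trans b3
  have c4 := (hF2.v .bestSize rfl).trans b4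
  have c5 := hF2.v .minSize rfl
  rw [← c5] at a2 a3
  generalize computeTail.run n σ₁ = σ₂ at *
  have hF3 := compareBest.frame n σ₂
  have d1 := (hF3.v .kept rfl).trans c1
  have d2 := (hF3.a .best rfl).trans c2
  have d3 := (hF3.v .bestKept rfl).trans c3
  have d4 := (hF3.v .bestSize rfl).trans c4
  have d5 := hF3.v .minSize rfl
  have d6 := hF3.a .digit rfl
  have hcmp : ∀ y, Represents n (fun d => τ.a .best d 0 0) y →
      (compareBest.run n σ₂).v .less =
        if tailNum (n.choose 2) (n - 1) (V m) m < y then 1 else 0 := fun y hy =>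
    compareBest_spec t1 (by rw [c2]; exact hy)
  rw [← d5] at a2 a3
  rw [← d6] at t1
  generalize compareBest.run n σ₂ = σ₃ at *
  have hupd : ∃ A, (updateBest.run n σ₃).v .bestKept = m ∧
      (updateBest.run n σ₃).v .bestSize = A ∧ A < n ∧ σ.a .cost root A m = V m + 1 ∧
      Represents n (fun d => (updateBest.run n σ₃).a .best d 0 0)
        (tailNum (n.choose 2) (n - 1) (V m) m) := by
    unfold updateBest
    simp only [run_seq]
    have hcp := Stmt.loop_inv (n := n) (x := .dig) (d := 1) (e := .len) (σ := σ₃)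
      (P := .put .best Var.dig 0 0 (.get .digit (.len - 1) Var.dig 0)) n (by omega) rfl (by simp)
      (fun m τ => ∀ d < m, τ.a .best d 0 0 = σ₃.a .digit (n - 1) d 0) (fun d hd => by omega) ?_
    · have hF4 := (Stmt.loop .dig 1 .len (.put .best Var.dig 0 0
        (.get .digit (.len - 1) Var.dig 0))).frame n σ₃
      have e1 := (hF4.v .kept rfl).trans d1
      have e2 := hF4.v .minSize rfl
      generalize (Stmt.loop .dig 1 .len (.put .best Var.dig 0 0
        (.get .digit (.len - 1) Var.dig 0))).run n σ₃ = σ₄ at *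
      refine ⟨σ₃.v .minSize, ?_, ?_, a2, a3, ?_⟩
      · simp [e1, clamp_of_lt_self (show m < n + 2 by omega)]
      · simp [e2, clamp_of_lt_self (show σ₃.v .minSize < n + 2 by omega)]
      · exact t1.congr fun d hd => hcp d hd
    · intro i ρ hi hF5 ih5 d hd
      have e1 : ρ.a .digit = σ₃.a .digit := hF5.a .digit rfl
      have e2 : clamp n (σ₃.a .digit (n - 1) i 0) = σ₃.a .digit (n - 1) i 0 :=
        clamp_of_le_square (t1.1 i hi)
      by_cases hdi : d = i
      · subst hdi; simp [e1, e2]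
      · simpa [hdi] using ih5 d (by omega)
  rw [run_ite]
  simp only [ev_var, ev_add, ev_mul, ev_ofNat, ev_len, d1, run_skip]
  obtain ⟨A', u1, u2, u3, u4, u5⟩ := hupd
  -- The test `kept < 1 + less * n` always succeeds for `kept = 0`, which initializes the record.
  -- For `0 < kept < n` it succeeds exactly when `less` is 1.
  rcases Nat.eq_zero_or_pos m with hm0 | hm0
  · rw [if_pos (by omega)]
    refine ⟨m, A', u1, u2, by omega, u3, u4, u5, fun k' hk' => ?_⟩
    rw [show k' = m by omega]
  · obtain ⟨k, A, i1, i2, i3, i4, i5, i6, i7⟩ := ih hm0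
    have hl := hcmp _ i6
    by_cases hlt : tailNum (n.choose 2) (n - 1) (V m) m < tailNum (n.choose 2) (n - 1) (V k) k
    · rw [if_pos hlt] at hl
      rw [hl, if_pos (by omega)]
      refine ⟨m, A', u1, u2, by omega, u3, u4, u5, fun k' hk' => ?_⟩
      by_cases hkm : k' = m
      · rw [hkm]
      · exact hlt.le.trans (i7 k' (by omega))
    · rw [if_neg hlt] at hl
      rw [hl, if_neg (by omega)]
      refine ⟨k, A, d3.trans i1, d4.trans i2, by omega, i4, i5, by rw [d2]; exact i6,
        fun k' hk' => ?_⟩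
      by_cases hkm : k' = m
      · rw [hkm]; omega
      · exact i7 k' (by omega)

/-! ### Reading off the clustering -/

/-- The table that belongs to the contraction of the current edge. -/
def edgeTable : Ex := .len + (.len - 2 - Var.edge)

/-- The upper endpoint of the current edge. -/
def upper : Ex := .get .par Var.edge 0 0

/-- The lower endpoint of the current edge. -/
def lower : Ex := .get .child Var.edge 0 0

/-- Decide whether the current edge is kept, and which entries of the two tables below it are
to be realized. -/
def splitEdge : Stmt :=
  .asg .size (.get .wantSize upper 0 0) ;; .asg .kept (.get .wantKept upper 0 0) ;;
  .ite 0 (.get .flag edgeTable Var.size Var.kept) (.putLo lower (.lo upper))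
    (.putLo lower lower) ;;
  .put .wantSize lower 0 0 (.get .sizeR edgeTable Var.size Var.kept) ;;
  .put .wantKept lower 0 0 (.get .keptR edgeTable Var.size Var.kept) ;;
  .put .wantSize upper 0 0 (.get .sizeL edgeTable Var.size Var.kept) ;;
  .put .wantKept upper 0 0 (.get .keptL edgeTable Var.size Var.kept)

/-- Write the labels of a clustering that realizes the chosen entry of the root's table. -/
def traceBack : Stmt :=
  .put .wantSize 0 0 0 Var.bestSize ;; .put .wantKept 0 0 0 Var.bestKept ;; .putLo 0 0 ;;
  .loop .edge 1 (.len - 1) splitEdge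

/-- The wanted indices of the upper endpoint are saved in `size` and `kept` before they are
overwritten. The bounds on the recorded indices keep the clamps inactive. -/
lemma splitEdge_spec {n i p c id S K : ℕ} {σ : Store} (he : σ.v .edge = i)
    (hp : σ.a .par i 0 0 = p) (hc : σ.a .child i 0 0 = c) (hpc : p ≠ c) (hpn : p < n)
    (hcn : c < n) (hid : id = n + (n - 2 - i)) (hS : σ.a .wantSize p 0 0 = S)
    (hK : σ.a .wantKept p 0 0 = K) (hSn : S < n) (hKn : K < n) (hlo : σ.lo p < n)
    (h1 : σ.a .sizeL id S K < n) (h2 : σ.a .keptL id S K < n)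
    (h3 : σ.a .sizeR id S K < n) (h4 : σ.a .keptR id S K < n) :
    (∀ v, (splitEdge.run n σ).lo v =
      if v = c then if σ.a .flag id S K = 0 then c else σ.lo p else σ.lo v) ∧
    (∀ v, (splitEdge.run n σ).a .wantSize v 0 0 = if v = c then σ.a .sizeR id S K else
      if v = p then σ.a .sizeL id S K else σ.a .wantSize v 0 0) ∧
    (∀ v, (splitEdge.run n σ).a .wantKept v 0 0 = if v = c then σ.a .keptR id S K else
      if v = p then σ.a .keptL id S K else σ.a .wantKept v 0 0) := by
  have hcS : clamp n S = S := clamp_of_lt_self (by omega)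
  have hcK : clamp n K = K := clamp_of_lt_self (by omega)
  have hcc : clamp n c = c := clamp_of_lt_self (by omega)
  have hcl : clamp n (σ.lo p) = σ.lo p := clamp_of_lt_self (by omega)
  have k1 : clamp n (σ.a .sizeL id S K) = σ.a .sizeL id S K := clamp_of_lt_self (by omega)
  have k2 : clamp n (σ.a .keptL id S K) = σ.a .keptL id S K := clamp_of_lt_self (by omega)
  have k3 : clamp n (σ.a .sizeR id S K) = σ.a .sizeR id S K := clamp_of_lt_self (by omega)
  have k4 : clamp n (σ.a .keptR id S K) = σ.a .keptR id S K := clamp_of_lt_self (by omega)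
  have m1 : c % (2 * n) = c := Nat.mod_eq_of_lt (by omega)
  have m2 : p % (2 * n) = p := Nat.mod_eq_of_lt (by omega)
  by_cases hf : σ.a .flag id S K = 0
  all_goals
    simp only [splitEdge, upper, lower, edgeTable, run_seq, run_asg, run_ite, run_putLo, run_put,
      ev_get, ev_add, ev_sub, ev_len, ev_var, ev_ofNat, ev_lo, setV_v, setV_a, setV_lo, setLo_a,
      setLo_v, setLo_lo, setA_v, setA_a, setA_lo, he, hp, hc, hS, hK, hcS, hcK, ← hid, if_true,
      reduceCtorEq, if_false, false_and, m1, m2, hf, Nat.pos_iff_ne_zero, ne_eq,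
      not_true, not_false_iff, and_true, true_and, hcc,
      hcl, k1, k2, k3, k4]
    refine ⟨fun v => trivial, fun v => ?_, fun v => ?_⟩ <;>
    · by_cases hv : v = c
      · subst hv; simp [hpc.symm]
      · simp [hv]

/-- The contraction determined by `g` realizes the wanted entries before edge `i`. -/
def Realizes (n : ℕ) (par child : ℕ → ℕ) (a : Arr → ℕ → ℕ → ℕ → ℕ) (g S K : ℕ → ℕ) (i : ℕ) :
    Prop :=
  ∀ v, Live child i v → (contract n par child g (n - 1 - i)).size v = S v + 1 ∧
    (contract n par child g (n - 1 - i)).kept v = K v ∧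
    (contract n par child g (n - 1 - i)).cost v + 1 = a .cost (tab n par (n - 1 - i) v) (S v) (K v)

/-- `Realizes` is passed on upwards if the wanted entries of the endpoints are those recorded in
the table of the edge. -/
lemma Realizes.of_succ {n i : ℕ} {par child : ℕ → ℕ} (h : EdgeOrder n par child)
    {a : Arr → ℕ → ℕ → ℕ → ℕ} (hF : Filled n par child a (n - 1)) (hi : i < n - 1)
    {g S K S' K' : ℕ → ℕ}
    (h0 : a .cost (n + (n - 2 - i)) (S (par i)) (K (par i)) ≠ 0)
    (hg : g i = a .flag (n + (n - 2 - i)) (S (par i)) (K (par i)))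
    (hS : ∀ v, S' v = if v = child i then a .sizeR (n + (n - 2 - i)) (S (par i)) (K (par i)) else
      if v = par i then a .sizeL (n + (n - 2 - i)) (S (par i)) (K (par i)) else S v)
    (hK : ∀ v, K' v = if v = child i then a .keptR (n + (n - 2 - i)) (S (par i)) (K (par i)) else
      if v = par i then a .keptL (n + (n - 2 - i)) (S (par i)) (K (par i)) else K v)
    (hR : Realizes n par child a g S' K' (i + 1)) : Realizes n par child a g S K i := by
  have hpc := h.par_ne_child le_rfl hi
  have hlp : Live child (i + 1) (par i) :=
    Live.mono (i := i) (h.par_mem i hi) (by omega)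
  have hlc : Live child (i + 1) (child i) := .inr ⟨i, by omega, rfl⟩
  obtain ⟨s, hs⟩ : ∃ s, s = n - 2 - i := ⟨_, rfl⟩
  -- The validity of the table entry supplies exactly the arithmetic of `Contraction.merge`, with
  -- sizes shifted by one in the indices and costs shifted by one in the entries.
  have hv := hF.valid s (by omega) (S (par i)) (K (par i))
  rw [← hs] at h0 hg hS hK
  rw [show n - 2 - s = i by omega] at hv
  obtain ⟨-, v1, v2, -, -, -, -, vA, vK, vc⟩ := hv h0
  unfold Realizes at hR ⊢
  rw [show n - 1 - (i + 1) = s by omega] at hR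
  rw [show n - 1 - i = s + 1 by omega]
  obtain ⟨p1, p2, p3⟩ := hR _ hlp
  obtain ⟨c1, c2, c3⟩ := hR _ hlc
  rw [hS, if_neg hpc, if_pos rfl] at p1 p3
  rw [hK, if_neg hpc, if_pos rfl] at p2 p3
  rw [hS, if_pos rfl] at c1 c3
  rw [hK, if_pos rfl] at c2 c3
  intro v hvl
  have hvc := h.live_ne hvl le_rfl hi
  simp only [contract, tab, show n - 2 - s = i by omega, Contraction.merge, hvc, if_false]
  by_cases hvp : v = par i
  · subst hvp
    simp only [if_true, hg, p1, p2, c1, c2]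
    refine ⟨by omega, vK.symm, ?_⟩
    rw [vc, ← p3, ← c3]
    omega
  · simp only [hvp, if_false]
    obtain ⟨q1, q2, q3⟩ := hR v (hvl.mono (by omega))
    rw [hS, if_neg hvc, if_neg hvp] at q1 q3
    rw [hK, if_neg hvc, if_neg hvp] at q2 q3
    exact ⟨q1, q2, q3⟩

/-- The trace goes down from the root, while contraction goes up from the leaves. The invariant is
therefore an implication: any `g` that agrees with the flags found so far and realizes the wanted
entries at level `i` realizes the root entry. Labels may overwrite the input, because the edges are
available in the arrays. -/
lemma traceBack_spec {n : ℕ} {par child : ℕ → ℕ} (h : EdgeOrder n par child) {σ : Store}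
    (hF : Filled n par child σ.a (n - 1)) (hp : ∀ i, σ.a .par i 0 0 = par i)
    (hc : ∀ i, σ.a .child i 0 0 = child i) (hS : σ.v .bestSize < n) (hK : σ.v .bestKept < n)
    (h0 : σ.a .cost (tab n par (n - 1) 0) (σ.v .bestSize) (σ.v .bestKept) ≠ 0) :
    ∃ f : ℕ → ℕ, (∀ i, f i ≤ 1) ∧ IsLabel n par child f (traceBack.run n σ).lo ∧
      (contract n par child f (n - 1)).kept 0 = σ.v .bestKept ∧
      (contract n par child f (n - 1)).cost 0 + 1 =
        σ.a .cost (tab n par (n - 1) 0) (σ.v .bestSize) (σ.v .bestKept) := by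
  have hn := h.pos
  have hlt : ∀ {i v}, i ≤ n - 1 → Live child i v → v < n := by
    rintro i v hi (rfl | ⟨j, hj, rfl⟩)
    · exact hn
    · exact h.child_lt j (by omega)
  obtain ⟨ρ, hρ⟩ : ∃ ρ, ρ = ((σ.setA .wantSize 0 0 0 (σ.v .bestSize)).setA .wantKept 0 0 0
    (σ.v .bestKept)).setLo 0 0 := ⟨_, rfl⟩
  have hrun : traceBack.run n σ = (Stmt.loop .edge 1 (.len - 1) splitEdge).run n ρ := by
    simp [traceBack, hρ, clamp_of_lt_self (show σ.v .bestSize < n + 2 by omega),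
      clamp_of_lt_self (show σ.v .bestKept < n + 2 by omega),
      clamp_of_lt_self (show 0 < n + 2 by omega)]
  have hρa : ∀ b, b ≠ .wantSize → b ≠ .wantKept → ρ.a b = σ.a b := by
    intro b h1 h2
    funext i j k
    simp [hρ, h1, h2]
  have key := Stmt.loop_inv (n := n) (x := .edge) (d := 1) (e := .len - 1) (σ := ρ)
    (P := splitEdge) (n - 1) (by omega) rfl (by simp) (fun i τ =>
      (∀ v, Live child i v → τ.lo v < n ∧ τ.a .wantSize v 0 0 < n ∧ τ.a .wantKept v 0 0 < n ∧
        σ.a .cost (tab n par (n - 1 - i) v) (τ.a .wantSize v 0 0) (τ.a .wantKept v 0 0) ≠ 0) ∧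
      τ.lo 0 = 0 ∧ ∃ f : ℕ → ℕ, (∀ j, f j ≤ 1) ∧
        (∀ j < i, τ.lo (child j) = if f j = 0 then child j else τ.lo (par j)) ∧
        ∀ g : ℕ → ℕ, (∀ j < i, g j = f j) →
          Realizes n par child σ.a g (τ.a .wantSize · 0 0) (τ.a .wantKept · 0 0) i →
          Realizes n par child σ.a g (fun _ => σ.v .bestSize) (fun _ => σ.v .bestKept) 0) ?_ ?_
  · rw [← hrun] at key
    obtain ⟨k1, k2, f, hf, hl, hR⟩ := key
    -- At the last level all tables belong to single vertices. Their only nonzero entry has both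
    -- indices 0, so the wanted entries are realized by the uncontracted tree.
    have := hR f (fun _ _ => rfl) fun v hv => by
      have hv' := k1 v hv
      simp only [Nat.sub_self, tab, hF.leaf v (hlt le_rfl hv), ne_eq, ite_eq_right_iff,
        one_ne_zero, imp_false, not_not] at hv'
      simp [contract, tab, hF.leaf v (hlt le_rfl hv), hv'.2.2.2]
    obtain ⟨-, r2, r3⟩ := this 0 (.inl rfl)
    exact ⟨f, hf, ⟨k2, hl⟩, r2, r3⟩
  · have hz : ∀ v, Live child 0 v → v = 0 := by
      rintro v (hv | ⟨j, hj, -⟩)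
      · exact hv
      · omega
    refine ⟨fun v hv => ?_, by simp [hρ], fun _ => 0, by simp, by simp, fun g _ hR v hv => ?_⟩
    · obtain rfl := hz v hv
      simpa [hρ, hn, hS, hK] using h0
    · have := hR v hv
      obtain rfl := hz v hv
      simpa [hρ] using this
  · rintro i τ hi hfr ⟨i1, i2, f, hf, hl, hR⟩
    have hτa : ∀ b, b ≠ .wantSize → b ≠ .wantKept → τ.a b = σ.a b := by
      intro b h1 h2
      rw [← hρa b h1 h2]
      exact hfr.a b (by cases b <;> first | rfl | exact absurd rfl h1 | exact absurd rfl h2)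
    have hpc := h.par_ne_child le_rfl hi
    have hlp : Live child i (par i) := h.par_mem i hi
    obtain ⟨S, hSd⟩ : ∃ S, S = τ.a .wantSize (par i) 0 0 := ⟨_, rfl⟩
    obtain ⟨K, hKd⟩ : ∃ K, K = τ.a .wantKept (par i) 0 0 := ⟨_, rfl⟩
    obtain ⟨p1, p2, p3, p4⟩ := i1 _ hlp
    have htab : tab n par (n - 1 - i) (par i) = n + (n - 2 - i) := by
      rw [show n - 1 - i = n - 2 - i + 1 by omega, tab,
        show n - 2 - (n - 2 - i) = i by omega, if_pos rfl]
    rw [htab] at p4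
    rw [← hSd] at p2 p4
    rw [← hKd] at p3 p4
    have hv := hF.valid (n - 2 - i) (by omega) S K p4
    rw [show n - 2 - (n - 2 - i) = i by omega] at hv
    obtain ⟨v0, v1, v2, v3, v4, v5, v6, -, -, -⟩ := hv
    obtain ⟨s1, s2, s3⟩ := splitEdge_spec (i := i) (σ := τ.setV .edge i) (p := par i) (c := child i)
      (by simp) (by simp [hτa, hp]) (by simp [hτa, hc]) hpc (h.par_lt hi) (h.child_lt i hi) rfl
      hSd.symm hKd.symm p2 p3 p1 (by simpa [hτa] using v3) (by simpa [hτa] using v4)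
      (by simpa [hτa] using v5) (by simpa [hτa] using v6)
    simp only [setV_a, setV_lo, hτa .flag (by simp) (by simp), hτa .sizeL (by simp) (by simp),
      hτa .sizeR (by simp) (by simp), hτa .keptL (by simp) (by simp),
      hτa .keptR (by simp) (by simp)] at s1 s2 s3
    generalize splitEdge.run n (τ.setV .edge i) = τ' at *
    -- The flag recorded in the wanted entry of the upper endpoint decides whether edge `i` is kept.
    refine ⟨fun v hv => ?_, ?_, Function.update f i (σ.a .flag (n + (n - 2 - i)) S K),
      fun j => ?_, fun j hj => ?_, fun g hg hR' => ?_⟩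
    · rw [s1, s2, s3, show n - 1 - (i + 1) = n - 2 - i by omega]
      by_cases hvc : v = child i
      · subst hvc
        simp only [if_true]
        refine ⟨?_, v5, v6, v2⟩
        split_ifs
        · exact h.child_lt i hi
        · exact p1
      · simp only [hvc, if_false]
        have hvl := i1 v (hv.of_succ hvc)
        refine ⟨hvl.1, ?_⟩
        by_cases hvp : v = par i
        · subst hvp
          simp only [if_true]
          exact ⟨v3, v4, v1⟩
        · simp only [hvp, if_false]
          have := hvl.2
          rwa [show n - 1 - i = n - 2 - i + 1 by omega, tab,
            show n - 2 - (n - 2 - i) = i by omega, if_neg hvp] at this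
    · rw [s1, if_neg (h.child_ne i hi).symm, i2]
    · by_cases hj : j = i
      · subst hj; simpa using v0
      · rw [Function.update_of_ne hj]; exact hf j
    · rw [s1, s1, if_neg (h.par_ne_child (show j ≤ i by omega) hi)]
      by_cases hji : j = i
      · subst hji; simp
      · have : child j ≠ child i := fun he => hji (h.child_inj j (by omega) i hi he)
        rw [if_neg this, Function.update_of_ne hji, hl j (by omega)]
    · refine hR g (fun j hj => ?_) ?_
      · rw [hg j (by omega), Function.update_of_ne (by omega)]
      · refine Realizes.of_succ h hF hi (S' := (τ'.a .wantSize · 0 0))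
          (K' := (τ'.a .wantKept · 0 0)) ?_ ?_ ?_ ?_ hR'
        · simpa only [← hSd, ← hKd] using p4
        · rw [hg i (by omega), Function.update_self, hSd, hKd]
        · simpa only [← hSd, ← hKd] using s2
        · simpa only [← hSd, ← hKd] using s3

/-! ### The algorithm -/

/-- Compute the labels of a surprise optimal clustering of a tree. -/
def optimalClustering : Stmt := orderEdges ;; fillTables ;; chooseBest ;; traceBack

/-- Two loop nests attain the degree: `step` and `quad` with `1 + 4`, and `kept`, `inner`, `row` and
`dig` with `1 + 2 + 1 + 1`. -/
lemma optimalClustering_deg : optimalClustering.deg = 5 := by decide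

/-- Each possible number of kept edges occurs in the root's table, with a least cost. -/
lemma Filled.exists_least {n : ℕ} {par child : ℕ → ℕ} (h : EdgeOrder n par child)
    {a : Arr → ℕ → ℕ → ℕ → ℕ} (hF : Filled n par child a (n - 1)) :
    ∃ V : ℕ → ℕ, (∀ k < n, ∃ A < n, a .cost (tab n par (n - 1) 0) A k = V k + 1) ∧
      (∀ k < n, ∀ A < n, 0 < a .cost (tab n par (n - 1) 0) A k →
        V k + 1 ≤ a .cost (tab n par (n - 1) 0) A k) ∧
      (∀ k < n, V k ≤ n.choose 2) ∧
      ∀ g : ℕ → ℕ, (∀ i, g i ≤ 1) → V ((contract n par child g (n - 1)).kept 0) ≤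
        (contract n par child g (n - 1)).cost 0 := by
  classical
  have hlow : ∀ g : ℕ → ℕ, (∀ i, g i ≤ 1) → ∃ A < n,
      0 < a .cost (tab n par (n - 1) 0) A ((contract n par child g (n - 1)).kept 0) ∧
      a .cost (tab n par (n - 1) 0) A ((contract n par child g (n - 1)).kept 0) ≤
        (contract n par child g (n - 1)).cost 0 + 1 := fun g hg => by
    have h1 := contract_size_le h hg le_rfl h.pos
    have hn := h.pos
    exact ⟨_, by omega, hF.lower h hg (n - 1) le_rfl 0 (.inl rfl)⟩
  have hex : ∀ k < n, ∃ c, (∃ A < n, a .cost (tab n par (n - 1) 0) A k = c + 1) ∧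
      (∀ A < n, 0 < a .cost (tab n par (n - 1) 0) A k →
        c + 1 ≤ a .cost (tab n par (n - 1) 0) A k) ∧ c ≤ n.choose 2 := by
    intro k hk
    -- Keeping the first `k` edges shows that a root entry with `k` kept edges exists. As its cost
    -- is the pair count of a clustering, the least cost is at most `n.choose 2`.
    obtain ⟨g, hg⟩ : ∃ g : ℕ → ℕ, g = fun i => if i < k then 1 else 0 := ⟨_, rfl⟩
    have hg1 : ∀ i, g i ≤ 1 := fun i => by rw [hg]; dsimp only; split_ifs <;> omega
    obtain ⟨A, hA, h1, h2⟩ := hlow g hg1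
    have hk' : (contract n par child g (n - 1)).kept 0 = k := by
      rw [contract_kept_root h hg1, hg, ← Finset.sum_filter, ← Finset.card_eq_sum_ones]
      have : (Finset.range (n - 1)).filter (· < k) = Finset.range k := by
        ext i
        simp only [Finset.mem_filter, Finset.mem_range]
        omega
      rw [this, Finset.card_range]
    obtain ⟨lab, hl⟩ := exists_isLabel h g
    have h3 := intraPairs_le_choose (ofLabel n lab)
    rw [intraPairs_ofLabel h hg1 hl, Fintype.card_fin] at h3
    rw [hk'] at h1 h2
    have hP : ∃ c, ∃ A < n, a .cost (tab n par (n - 1) 0) A k = c + 1 := ⟨_, A, hA, by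
      rw [Nat.sub_add_cancel h1]⟩
    refine ⟨Nat.find hP, Nat.find_spec hP, fun B hB h4 => ?_, ?_⟩
    · have := Nat.find_min' hP ⟨B, hB, (Nat.sub_add_cancel h4).symm⟩
      omega
    · have := Nat.find_min' hP ⟨A, hA, (Nat.sub_add_cancel h1).symm⟩
      omega
  choose! V hV using hex
  refine ⟨V, fun k hk => (hV k hk).1, fun k hk => (hV k hk).2.1, fun k hk => (hV k hk).2.2,
    fun g hg => ?_⟩
  obtain ⟨A, hA, h1, h2⟩ := hlow g hg
  have := (hV _ (contract_kept_lt h hg le_rfl h.pos)).2.1 A hA h1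
  omega

/-- The minima `V` from `Filled.exists_least` bound all contractions from below, and the trace
attains `V k` for the chosen `k`. The tables reach the trace unchanged, since choosing `k` writes
only the arrays `digit` and `best`. -/
theorem optimalClustering_spec {n : ℕ} {hn : 0 < n} {T : SimpleGraph (Fin n)} {w : ℕ → ℕ}
    (hT : T.IsTree) (hE : HoldsEdges hn T w) :
    IsOptimal T (ofLabel n (optimalClustering.run n (startStore w)).lo) := by
  unfold optimalClustering
  simp only [run_seq]
  obtain ⟨h, hadj⟩ := orderEdges_spec hT.connected hE
  have hz : ∀ id A K, (orderEdges.run n (startStore w)).a .cost id A K = 0 := fun id A K => by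
    rw [(orderEdges.frame n _).a .cost rfl]
    rfl
  generalize orderEdges.run n (startStore w) = σ₁ at *
  obtain ⟨hF, htab⟩ := fillTables_spec h (fun _ => rfl) (fun _ => rfl) hz
  have p1 : (fillTables.run n σ₁).a .par = σ₁.a .par := (fillTables.frame n σ₁).a .par rfl
  have c1 : (fillTables.run n σ₁).a .child = σ₁.a .child := (fillTables.frame n σ₁).a .child rfl
  generalize fillTables.run n σ₁ = σ₂ at *
  obtain ⟨V, hex, hmin, hVn, hV⟩ := hF.exists_least h
  obtain ⟨k, A, hk, hA, hkn, hAn, hcost, hbest⟩ :=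
    chooseBest_spec hn (htab 0 hn) hex hmin hVn
  have hfr := chooseBest.frame n σ₂
  have ha : ∀ b, b ≠ .digit → b ≠ .best → (chooseBest.run n σ₂).a b = σ₂.a b := by
    intro b h1 h2
    exact hfr.a b (by cases b <;> first | rfl | exact absurd rfl h1 | exact absurd rfl h2)
  generalize chooseBest.run n σ₂ = σ₃ at *
  have hF3 : Filled n (fun i => σ₁.a .par i 0 0) (fun i => σ₁.a .child i 0 0) σ₃.a (n - 1) := by
    refine ⟨fun v hv A K => ?_, fun s hs A K => ?_, fun s hs f hf a₁ h₁ k₁ h₂ a₂ h₃ k₂ h₄ => ?_⟩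
    · rw [ha .cost (by simp) (by simp)]
      exact hF.leaf v hv A K
    · have := hF.valid s hs A K
      unfold ValidCell at this ⊢
      simpa [ha] using this
    · have := hF.covers s hs f hf a₁ h₁ k₁ h₂ a₂ h₃ k₂ h₄
      unfold Covers at this ⊢
      simpa [ha] using this
  obtain ⟨f, hf, hl, f1, f2⟩ := traceBack_spec h hF3
    (fun i => by rw [ha .par (by simp) (by simp), p1])
    (fun i => by rw [ha .child (by simp) (by simp), c1]) (hA ▸ hAn) (hk ▸ hkn)
    (by rw [ha .cost (by simp) (by simp), hA, hk, hcost]; omega)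
  rw [ha .cost (by simp) (by simp), hA, hk, hcost] at f2
  exact isOptimal_ofLabel h hT hadj hf hl hV (f1.trans hk) (by omega) hbest

end LoopLang

namespace WordRAM
open Surprise LoopLang

/-! ### The edge list in the initial memory. -/

section Input
variable {n : ℕ} (L : List (Fin n × Fin n))

lemma getD_flatMap_pair (d j : ℕ) (hj : j < L.length) :
    (L.flatMap fun q => [(q.1 : ℕ), (q.2 : ℕ)]).getD (2 * j) d = (L[j].1 : ℕ) ∧
    (L.flatMap fun q => [(q.1 : ℕ), (q.2 : ℕ)]).getD (2 * j + 1) d = (L[j].2 : ℕ) := by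
  induction L generalizing j with
  | nil => simp at hj
  | cons q L ih =>
    cases j with
    | zero => simp
    | succ j =>
      have := ih j (by simpa using hj)
      simpa [Nat.mul_succ] using this

lemma length_inputWords : (inputWords L).length = 2 * L.length + 1 := by
  simp [inputWords, List.length_flatMap, mul_comm]

lemma initState_mem_pair (j : ℕ) (hj : j < L.length) :
    (initState L).mem (2 * j + 1) = L[j].1 ∧ (initState L).mem (2 * j + 2) = L[j].2 := by
  have := getD_flatMap_pair L 0 j hj
  simpa [initState, inputWords] using this

lemma initState_mem_eq_zero {i : ℕ} (hi : 2 * L.length + 1 ≤ i) : (initState L).mem i = 0 :=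
  List.getD_eq_default _ _ (by rwa [length_inputWords])

lemma initState_mem_le (i : ℕ) : (initState L).mem i ≤ n := by
  by_cases hi : i < (inputWords L).length
  · have h1 : (initState L).mem i ∈ inputWords L := by
      change (inputWords L).getD i 0 ∈ _
      rw [List.getD_eq_getElem _ _ hi]
      exact List.getElem_mem hi
    simp only [inputWords, List.mem_cons, List.mem_flatMap, List.not_mem_nil, or_false] at h1
    rcases h1 with h1 | ⟨q, -, h1 | h1⟩ <;> omega
  · rw [length_inputWords] at hi
    rw [initState_mem_eq_zero L (by omega)]
    omega

lemma IsEdgeList.length_eq {L : List (Fin n × Fin n)} {T : SimpleGraph (Fin n)} (hT : T.IsTree)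
    (hL : IsEdgeList T L) : L.length = n - 1 := by
  classical
  have h1 : T.edgeSet = ((L.map fun q => s(q.1, q.2)).toFinset : Set (Sym2 (Fin n))) := by
    ext e
    rw [← hL.2 e]
    simp
  have h2 := ncard_edgeSet_of_isTree hT
  rwa [h1, Set.ncard_coe_finset, List.toFinset_card_of_nodup hL.1, List.length_map] at h2

lemma IsEdgeList.holdsEdges {L : List (Fin n × Fin n)} {T : SimpleGraph (Fin n)} (hn : 0 < n)
    (hT : T.IsTree) (hL : IsEdgeList T L) : HoldsEdges hn T (initState L).mem := by
  have hlen := hL.length_eq hT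
  have hmem : ∀ j (hj : j < L.length), T.Adj L[j].1 L[j].2 := fun j hj => by
    rw [← SimpleGraph.mem_edgeSet, ← hL.2]
    exact List.mem_map.2 ⟨_, List.getElem_mem hj, rfl⟩
  refine ⟨fun j hj => ?_, fun j hj => ?_, fun u v huv => ?_⟩
  · obtain ⟨h1, h2⟩ := initState_mem_pair L j (by omega)
    rw [h1, h2]
    exact ⟨Fin.is_lt _, Fin.is_lt _⟩
  · obtain ⟨h1, h2⟩ := initState_mem_pair L j (by omega)
    rw [h1, h2, vert_coe, vert_coe]
    exact hmem j (by omega)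
  · rw [← SimpleGraph.mem_edgeSet, ← hL.2] at huv
    obtain ⟨q, hq, he⟩ := List.mem_map.1 huv
    obtain ⟨j, hj, rfl⟩ := List.getElem_of_mem hq
    obtain ⟨h1, h2⟩ := initState_mem_pair L j hj
    refine ⟨j, by omega, ?_⟩
    rw [h1, h2]
    rcases Sym2.eq_iff.1 he with ⟨e1, e2⟩ | ⟨e1, e2⟩
    · exact .inl ⟨by rw [e1], by rw [e2]⟩
    · exact .inr ⟨by rw [e1], by rw [e2]⟩

end Input

end WordRAM

/-- There is a word RAM program (with words of `O(log n)` bits, that is, with word bound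
polynomial in `n`) that on every tree with `n` vertices halts after `O(n ^ 5)` steps and outputs
a clustering of optimal surprise. -/
theorem theorem14 :
    ∃ (P : WordRAM.Prog) (c K : ℕ),
      ∀ (n : ℕ) (T : SimpleGraph (Fin n)), T.IsTree →
        ∀ L : List (Fin n × Fin n), WordRAM.IsEdgeList T L →
          ∃ (t : ℕ) (s : WordRAM.State),
            WordRAM.Runs ((n + 2) ^ c) P (WordRAM.initState L) t s ∧
            t ≤ K * n ^ 5 ∧
            ∃ ζ : Finpartition (Finset.univ : Finset (Fin n)),
              WordRAM.Outputs s ζ ∧ Surprise.IsOptimal T ζ := by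
  obtain ⟨P, c, K, h⟩ := LoopLang.Stmt.exists_prog LoopLang.optimalClustering
  refine ⟨P, c, K, fun n T hT L hL => ?_⟩
  -- A tree has a vertex; this excludes `n = 0`.
  have hn : 0 < n := Fin.pos hT.connected.nonempty.some
  have hlen := hL.length_eq hT
  obtain ⟨t, s, hrun, ht, hs⟩ := h n (WordRAM.initState L) hn rfl (fun _ => rfl)
    (WordRAM.initState_mem_le L)
    -- The input has `2 * (n - 1) + 1` words and so ends before cell `2 * n`, where the arrays
    -- begin.
    (fun i hi => WordRAM.initState_mem_eq_zero L (by omega))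
  rw [LoopLang.optimalClustering_deg] at ht
  refine ⟨t, s, hrun, ht, _, fun u v => ?_,
    LoopLang.optimalClustering_spec hT (hL.holdsEdges hn hT)⟩
  rw [Surprise.ofLabel_part_eq_iff, hs u (by omega), hs v (by omega)]
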